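/- Let $\mathbb T=\mathbb R/2\pi\mathbb Z$, $\lambda\in\mathbb R$, $s>\tfrac12$, and let $\varphi,\gamma:\mathbb T\to\mathbb C$ be $C^\infty$ functions (independent of $c$). For $c>0$ consider the cubic Klein–Gordon equation $$\tfrac1{c^2}\partial_{tt}z-\partial_{xx}z+c^2z=\lambda|z|^2z,\qquad z(0)=\varphi,\quad \partial_tz(0)=c^2\gamma, \tag{KG}$$ and the limit Schrödinger system $$i\partial_tu_0=\tfrac12\partial_{xx}u_0+\tfrac\lambda8(|u_0|^2+2|v_0|^2)u_0,\quad u_0(0)=\varphi-i\gamma,$$ $$i\partial_tv_0=\tfrac12\partial_{xx}v_0+\tfrac\lambda8(|v_0|^2+2|u_0|^2)v_0,\quad v_0(0)=\overline{\varphi+i\gamma}.$$ Numerical scheme. For a mesh size $h=1/K$, $K\in\mathbb N$, $K\ge1$, use the grid points $x_j=2\pi jh$ of $\mathbb T$ ($K$ distinct points) and the $K$ frequencies $-\lfloor K/2\rfloor\le k<K-\lfloor K/2\rfloor$; grid functions are identified with their trigonometric interpolation polynomials with these frequencies. Given $\tau>0$ let $(u_0^{0,h},v_0^{0,h})$ be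 the trigonometric interpolants of $(u_0(0),v_0(0))$, and let $$(u_0^{n,h},v_0^{n,h})=\bigl(\Phi_P^{\tau/2}\circ\Phi_T^{\tau}\circ\Phi_P^{\tau/2}\bigr)^n(u_0^{0,h},v_0^{0,h}),$$ where $\Phi_T^t$ is the flow of $i\partial_tw=\tfrac12\partial_{xx}w$ on trigonometric polynomials (multiplication of the $k$-th discrete Fourier coefficient of each component by $e^{itk^2/2}$), and $\Phi_P^t$ is the flow of the potential part evaluated at the grid points, i.e. $u\mapsto e^{-it\frac\lambda8(|u|^2+2|v|^2)}u$, $v\mapsto e^{-it\frac\lambda8(|v|^2+2|u|^2)}v$ at each $x_j$, followed by trigonometric interpolation. With $t_n=n\tau$ put $$z_0^{n,h}=\tfrac12u_0^{n,h}e^{ic^2t_n}+\tfrac12\overline{v_0^{n,h}}e^{-ic^2t_n}.$$ Then there exist constants $T,c_0,C,h_0,\tau_0>0$ (depending only on $\lambda,s,\varphi,\gamma$) such that for all $c>c_0$ the problem (KG) has a unique classical ($C^2$) solution $z$ on $[0,T]\times\mathbb T$, and for all $0<\tau<\tau_0$, all $h=1/K<h_0$ and all $n\in\mathbb N$ with $t_n=n\tau\le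 T$, $$\|z(t_n)-z_0^{n,h}\|_{L^2(\mathbb T)}\le C\,(\tau^2+h^s+c^{-2}),$$ where $\|f\|_{L^2}^2=\frac1{2\pi}\int_0^{2\pi}|f|^2\,dx=\sum_{k\in\mathbb Z}|\hat f_k|^2$. -/

import Mathlib

open scoped ContDiff

noncomputable section

namespace KGStrang

/-- `z` is a classical (`C²`) solution on `[0,T] × 𝕋`, `𝕋 = ℝ / 2πℤ`, of the cubic Klein-Gordon
problem `c⁻² ∂ₜₜ z - ∂ₓₓ z + c² z = lam |z|² z`, `z(0) = φ`, `∂ₜ z(0) = c² γ`.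
Functions on the torus are `2π`-periodic functions on `ℝ`; time derivatives are one-sided at the
two end points of `[0,T]`. -/
structure IsKleinGordonSolution (lam c T : ℝ) (φ γ : ℝ → ℂ) (z : ℝ → ℝ → ℂ) : Prop where
  periodic : ∀ t ∈ Set.Icc (0 : ℝ) T, Function.Periodic (z t) (2 * Real.pi)
  contDiffOn : ContDiffOn ℝ 2 (fun p : ℝ × ℝ => z p.1 p.2) (Set.Icc (0 : ℝ) T ×ˢ Set.univ)
  init : ∀ x, z 0 x = φ x
  init_deriv : ∀ x, derivWithin (fun t => z t x) (Set.Icc (0 : ℝ) T) 0 = (c : ℂ) ^ 2 * γ x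
  equation : ∀ t ∈ Set.Icc (0 : ℝ) T, ∀ x,
    1 / (c : ℂ) ^ 2 * iteratedDerivWithin 2 (fun r => z r x) (Set.Icc (0 : ℝ) T) t
      - iteratedDeriv 2 (z t) x + (c : ℂ) ^ 2 * z t x
      = (lam : ℂ) * (‖z t x‖ : ℂ) ^ 2 * z t x

/-- The normalised norm of `L²(𝕋)`, so that `‖f‖² = ∑ₖ |f̂ₖ|²`. -/
def l2Norm (f : ℝ → ℂ) : ℝ :=
  Real.sqrt ((1 / (2 * Real.pi)) * ∫ x in (0 : ℝ)..(2 * Real.pi), ‖f x‖ ^ 2)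

/-- The `k`-th Fourier mode `x ↦ e^{ikx}`. -/
def mode (k : ℤ) (x : ℝ) : ℂ := Complex.exp (Complex.I * (k : ℂ) * (x : ℂ))

/-- The `K` frequencies of the pseudo-spectral method: `-K/2, …, K/2 - 1` for even `K` and
`-(K-1)/2, …, (K-1)/2` for odd `K`. -/
def freqs (K : ℕ) : Finset ℤ := Finset.Ico (-((K / 2 : ℕ) : ℤ)) ((K : ℤ) - ((K / 2 : ℕ) : ℤ))

/-- The grid points `x_j = 2πjh`, `h = 1/K`; those with `0 ≤ j < K` form the grid on the torus. -/
def gridPoint (K : ℕ) (j : ℕ) : ℝ := 2 * Real.pi * j * (1 / K)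

/-- The `k`-th discrete Fourier coefficient of the grid values of `f`. -/
def dftCoeff (K : ℕ) (f : ℝ → ℂ) (k : ℤ) : ℂ :=
  (1 / (K : ℂ)) * ∑ j ∈ Finset.range K, f (gridPoint K j) * mode (-k) (gridPoint K j)

/-- The trigonometric polynomial with frequencies in `freqs K` that takes the values of `f` at
the grid points. -/
def trigInterp (K : ℕ) (f : ℝ → ℂ) (x : ℝ) : ℂ :=
  ∑ k ∈ freqs K, dftCoeff K f k * mode k x

/-- The flow at time `t` of the kinetic equation `i ∂ₜ w = ½ ∂ₓₓ w`, computed in discrete Fourier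
space: on a trigonometric polynomial with frequencies in `freqs K` it is the exact flow. -/
def kineticFlow (K : ℕ) (t : ℝ) (f : ℝ → ℂ) (x : ℝ) : ℂ :=
  ∑ k ∈ freqs K, Complex.exp (Complex.I * (t : ℂ) * ((k : ℂ) ^ 2 / 2)) * dftCoeff K f k * mode k x

/-- The exact flow at time `t` of the potential equation at one point of space,
`i ∂ₜ u = (lam/8) (|u|² + 2|v|²) u`, `i ∂ₜ v = (lam/8) (|v|² + 2|u|²) v`. -/
def potentialFlow (lam t : ℝ) (w : ℂ × ℂ) : ℂ × ℂ :=
  (Complex.exp (-Complex.I * (t : ℂ) * ((lam / 8 * (‖w.1‖ ^ 2 + 2 * ‖w.2‖ ^ 2) : ℝ) : ℂ)) * w.1,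
   Complex.exp (-Complex.I * (t : ℂ) * ((lam / 8 * (‖w.2‖ ^ 2 + 2 * ‖w.1‖ ^ 2) : ℝ) : ℂ)) * w.2)

/-- The kinetic substep, acting on both components. -/
def kineticStep (K : ℕ) (t : ℝ) (w : (ℝ → ℂ) × (ℝ → ℂ)) : (ℝ → ℂ) × (ℝ → ℂ) :=
  (kineticFlow K t w.1, kineticFlow K t w.2)

/-- The potential substep: the exact potential flow at every grid point, the new grid values being
represented by their trigonometric interpolation polynomials. -/
def potentialStep (lam : ℝ) (K : ℕ) (t : ℝ) (w : (ℝ → ℂ) × (ℝ → ℂ)) : (ℝ → ℂ) × (ℝ → ℂ) :=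
  (trigInterp K (fun x => (potentialFlow lam t (w.1 x, w.2 x)).1),
   trigInterp K (fun x => (potentialFlow lam t (w.1 x, w.2 x)).2))

/-- One step `Φ_P^{τ/2} ∘ Φ_T^τ ∘ Φ_P^{τ/2}` of the fully discrete Strang splitting. -/
def strangStep (lam : ℝ) (K : ℕ) (τ : ℝ) (w : (ℝ → ℂ) × (ℝ → ℂ)) : (ℝ → ℂ) × (ℝ → ℂ) :=
  potentialStep lam K (τ / 2) (kineticStep K τ (potentialStep lam K (τ / 2) w))

/-- The discrete initial value: interpolation of `u₀(0) = φ - iγ` and `v₀(0) = conj (φ + iγ)`. -/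
def discreteInit (K : ℕ) (φ γ : ℝ → ℂ) : (ℝ → ℂ) × (ℝ → ℂ) :=
  (trigInterp K (fun x => φ x - Complex.I * γ x),
   trigInterp K (fun x => (starRingEnd ℂ) (φ x + Complex.I * γ x)))

/-- The numerical approximation `(u₀^{n,h}, v₀^{n,h})`, `h = 1/K`, at time `nτ`. -/
def strangSolution (lam : ℝ) (K : ℕ) (τ : ℝ) (φ γ : ℝ → ℂ) (n : ℕ) : (ℝ → ℂ) × (ℝ → ℂ) :=
  (strangStep lam K τ)^[n] (discreteInit K φ γ)

/-- `z₀^{n,h} = ½ u₀^{n,h} e^{ic²tₙ} + ½ conj(v₀^{n,h}) e^{-ic²tₙ}`, `tₙ = nτ`. -/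
def zNum (lam c : ℝ) (K : ℕ) (τ : ℝ) (φ γ : ℝ → ℂ) (n : ℕ) (x : ℝ) : ℂ :=
  1 / 2 * (strangSolution lam K τ φ γ n).1 x * Complex.exp (Complex.I * (c : ℂ) ^ 2 * (n * τ : ℂ))
  + 1 / 2 * (starRingEnd ℂ) ((strangSolution lam K τ φ γ n).2 x)
      * Complex.exp (-Complex.I * (c : ℂ) ^ 2 * (n * τ : ℂ))

end KGStrang

end

/-!
The proof never leaves weighted Wiener algebras. For `m : ℕ` the space `Wiener m` consists of pairs
of Fourier series with `∑ (1 + |k|)^m ‖aₖ‖ < ∞`. It is a Banach algebra, Fourier multipliers act on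
it with an explicit loss of weights, and its norm for `m = 0` dominates the supremum norm and hence
the norm of `L²(𝕋)`. The smooth data belong to all of these algebras, so the regularity `m` can be
chosen as large as the exponent `s` requires.

Klein-Gordon equation. With `z = (u + v̄)/2` the equation becomes a first-order system for the pair
`y = (u, v)`, of the form `∂ₜ y = iθ_c y + M_c N(y)` with frequencies `θ_c(k) = c √(k² + c²)`
(`kgFreq`) and the smoothing multiplier `M_c = c / √(k² + c²)` (`damp`) in front of the cubic
nonlinearity. The profile `e^{-itθ_c} y` solves an ordinary differential equation with a Lipschitz
right-hand side whose constants do not depend on `c`, so Picard iteration gives a solution on an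
interval independent of `c` (`exists_isMildSol`), and the field of `y` is a classical solution
(`isKleinGordonSolution_of_isMildSol`). Uniqueness of classical solutions is elementary in one space
dimension: the derivatives of a difference along the two families of characteristics are
controlled by the difference itself (`IsKleinGordonSolution.unique`).

Modulation. On a fixed Fourier mode `θ_c(k) = c² + k²/2 + O(c⁻²)` and `M_c = 1 + O(c⁻²)`. Inserting
`e^{ic²t} w` into the system, with `w` the solution of the limit system, leaves the cubic terms that
oscillate like `e^{± 2ic²t}` and `e^{-4ic²t}` as a defect of size one. They are removed by adding
their time integral at frozen `w`, which is `c⁻²` times the `corrector`; the defect is then `O(c⁻²)`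
in `Wiener 0`, and Gronwall's lemma for the profiles yields `exists_modulation_error`.

Splitting. The potential flow is multiplication by the exponential `e^{-itV(a)}` in the Banach
algebra, hence stable with constant `1 + O(t)` and easily expanded in `t`. Comparing second-order
Taylor expansions of one step and of the exact solution gives the local error `O(τ³)`
(`isBigO_strang_sub`). Trigonometric interpolation moves each frequency to its representative in
`freqs K` (`interp`). It is a contraction of every `Wiener m`, it is accurate of any order
`h^q` on regular functions, and it may be inserted in front of a potential step because that step
only sees grid values. The only remaining contribution of the space discretization to the error of
one step is the commutator of interpolation with the kinetic flow, which is `O(τ h^q)`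
(`norm_commutator_le`). Summation of the local errors gives `exists_strang_error`.
-/

noncomputable section

namespace KGStrang

/-! ### Weighted Wiener algebras -/

/-- The weight `1 + |k|` on the frequencies. -/
def wt (k : ℤ) : ℝ := 1 + |(k : ℝ)|

lemma one_le_wt (k : ℤ) : 1 ≤ wt k := by unfold wt; linarith [abs_nonneg (k : ℝ)]
lemma wt_pos (k : ℤ) : 0 < wt k := lt_of_lt_of_le one_pos (one_le_wt k)
lemma abs_le_wt (k : ℤ) : |(k : ℝ)| ≤ wt k := by unfold wt; linarith
lemma wt_neg (k : ℤ) : wt (-k) = wt k := by simp [wt]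
lemma wt_zero : wt 0 = 1 := by simp [wt]
lemma wt_add_le (j k : ℤ) : wt (j + k) ≤ wt j * wt k := by
  unfold wt
  push_cast
  nlinarith [abs_add_le (j : ℝ) k, abs_nonneg (j : ℝ), abs_nonneg (k : ℝ),
    mul_nonneg (abs_nonneg (j : ℝ)) (abs_nonneg (k : ℝ))]
lemma wt_pow_pos (m : ℕ) (k : ℤ) : 0 < wt k ^ m := pow_pos (wt_pos k) m
lemma wt_pow_add_le (m : ℕ) (j k : ℤ) : wt (j + k) ^ m ≤ wt j ^ m * wt k ^ m := by
  rw [← mul_pow]; exact pow_le_pow_left₀ (wt_pos _).le (wt_add_le j k) m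

/-- The weighted Wiener algebra of pairs of functions on the torus: Fourier coefficients
`a : ℤ → ℂ × ℂ` with `∑ₖ (1 + |k|)ᵐ ‖aₖ‖ < ∞`. It is stored as the `ℓ¹` sequence of the weighted
coefficients `(1 + |k|)ᵐ aₖ`; the unweighted ones are given by `Wiener.coeff`. -/
def Wiener (_m : ℕ) : Type := lp (fun _ : ℤ => ℂ × ℂ) 1

namespace Wiener

variable {m n : ℕ}

instance : NormedAddCommGroup (Wiener m) :=
  inferInstanceAs (NormedAddCommGroup (lp (fun _ : ℤ => ℂ × ℂ) 1))
instance : NormedSpace ℂ (Wiener m) :=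
  inferInstanceAs (NormedSpace ℂ (lp (fun _ : ℤ => ℂ × ℂ) 1))
instance : CompleteSpace (Wiener m) :=
  inferInstanceAs (CompleteSpace (lp (fun _ : ℤ => ℂ × ℂ) 1))

/-- The `k`-th Fourier coefficient. -/
def coeff (a : Wiener m) (k : ℤ) : ℂ × ℂ :=
  (wt k ^ m)⁻¹ • (show lp (fun _ : ℤ => ℂ × ℂ) 1 from a) k

@[simp] lemma coeff_zero (k : ℤ) : (0 : Wiener m).coeff k = 0 := by
  change (wt k ^ m)⁻¹ • ((0 : lp (fun _ : ℤ => ℂ × ℂ) 1) k) = 0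
  simp
@[simp] lemma coeff_add (a b : Wiener m) (k : ℤ) : (a + b).coeff k = a.coeff k + b.coeff k :=
  smul_add _ _ _
@[simp] lemma coeff_sub (a b : Wiener m) (k : ℤ) : (a - b).coeff k = a.coeff k - b.coeff k :=
  smul_sub _ _ _
@[simp] lemma coeff_neg (a : Wiener m) (k : ℤ) : (-a).coeff k = -a.coeff k :=
  smul_neg _ _
@[simp] lemma coeff_smul (c : ℂ) (a : Wiener m) (k : ℤ) : (c • a).coeff k = c • a.coeff k :=
  smul_comm (wt k ^ m)⁻¹ c ((show lp (fun _ : ℤ => ℂ × ℂ) 1 from a) k)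
@[simp] lemma coeff_real_smul (c : ℝ) (a : Wiener m) (k : ℤ) :
    (c • a).coeff k = c • a.coeff k := by
  have h := coeff_smul (c : ℂ) a k
  simpa using h

lemma norm_stored (a : Wiener m) (k : ℤ) :
    ‖(show lp (fun _ : ℤ => ℂ × ℂ) 1 from a) k‖ = wt k ^ m * ‖a.coeff k‖ := by
  unfold coeff
  rw [norm_smul, norm_inv, Real.norm_of_nonneg (wt_pow_pos m k).le, ← mul_assoc,
    mul_inv_cancel₀ (wt_pow_pos m k).ne', one_mul]

lemma hasSum_norm (a : Wiener m) : HasSum (fun k => wt k ^ m * ‖a.coeff k‖) ‖a‖ := by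
  have h := lp.hasSum_norm (p := 1) (by simp) (show lp (fun _ : ℤ => ℂ × ℂ) 1 from a)
  simp only [ENNReal.toReal_one, Real.rpow_one] at h
  exact h.congr_fun fun k => (norm_stored a k).symm

lemma summable_norm (a : Wiener m) : Summable fun k => wt k ^ m * ‖a.coeff k‖ :=
  a.hasSum_norm.summable

lemma norm_eq_tsum (a : Wiener m) : ‖a‖ = ∑' k, wt k ^ m * ‖a.coeff k‖ :=
  a.hasSum_norm.tsum_eq.symm

lemma summable_coeff_norm (a : Wiener m) : Summable fun k => ‖a.coeff k‖ :=
  a.summable_norm.of_nonneg_of_le (fun _ => norm_nonneg _) fun k =>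
    le_mul_of_one_le_left (norm_nonneg _) (one_le_pow₀ (one_le_wt k))

@[ext] lemma ext {a b : Wiener m} (h : ∀ k, a.coeff k = b.coeff k) : a = b := by
  refine lp.ext (funext fun k => ?_)
  have := h k
  unfold coeff at this
  exact (smul_right_injective _ (inv_ne_zero (wt_pow_pos m k).ne')) this

/-- The element with prescribed Fourier coefficients. -/
def mk (f : ℤ → ℂ × ℂ) (hf : Summable fun k => wt k ^ m * ‖f k‖) : Wiener m :=
  (⟨fun k => (wt k ^ m) • f k, memℓp_gen (by
    simpa [norm_smul, abs_of_pos (wt_pos _)] using hf)⟩ : lp (fun _ : ℤ => ℂ × ℂ) 1)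

@[simp] lemma coeff_mk (f : ℤ → ℂ × ℂ) (hf : Summable fun k => wt k ^ m * ‖f k‖) (k : ℤ) :
    (mk f hf).coeff k = f k := by
  change (wt k ^ m)⁻¹ • ((wt k ^ m) • f k) = f k
  rw [smul_smul, inv_mul_cancel₀ (wt_pow_pos m k).ne', one_smul]

lemma norm_mk (f : ℤ → ℂ × ℂ) (hf : Summable fun k => wt k ^ m * ‖f k‖) :
    ‖mk f hf‖ = ∑' k, wt k ^ m * ‖f k‖ := by
  rw [norm_eq_tsum]; simp

lemma norm_coeff_le (a : Wiener m) (k : ℤ) : ‖a.coeff k‖ ≤ ‖a‖ := by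
  have h := le_hasSum a.hasSum_norm k fun j _ =>
    mul_nonneg (wt_pow_pos m j).le (norm_nonneg _)
  exact (le_mul_of_one_le_left (norm_nonneg _) (one_le_pow₀ (one_le_wt k))).trans h

/-! ### Convolution -/

/-- `(j, k) ↦ (j, k - j)`, which turns a convolution into a product of sums. -/
def shear : ℤ × ℤ ≃ ℤ × ℤ where
  toFun p := (p.1, p.2 - p.1)
  invFun p := (p.1, p.2 + p.1)
  left_inv p := by simp
  right_inv p := by simp

lemma hasSum_weighted_mul (a b : Wiener m) :
    HasSum (fun p : ℤ × ℤ => (wt p.1 ^ m * ‖a.coeff p.1‖) *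
      (wt (p.2 - p.1) ^ m * ‖b.coeff (p.2 - p.1)‖)) (‖a‖ * ‖b‖) := by
  have h := a.hasSum_norm.mul b.hasSum_norm (a.summable_norm.mul_of_nonneg b.summable_norm
    (fun k => mul_nonneg (wt_pow_pos m k).le (norm_nonneg _))
    (fun k => mul_nonneg (wt_pow_pos m k).le (norm_nonneg _)))
  exact (shear.hasSum_iff (f := fun p : ℤ × ℤ => (wt p.1 ^ m * ‖a.coeff p.1‖) *
      (wt p.2 ^ m * ‖b.coeff p.2‖))).mpr h

lemma weighted_term_le (a b : Wiener m) (j k : ℤ) :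
    wt k ^ m * ‖a.coeff j * b.coeff (k - j)‖ ≤ (wt j ^ m * ‖a.coeff j‖) *
      (wt (k - j) ^ m * ‖b.coeff (k - j)‖) := by
  have h1 := wt_pow_add_le m j (k - j)
  rw [add_sub_cancel] at h1
  calc _ ≤ (wt j ^ m * wt (k - j) ^ m) * (‖a.coeff j‖ * ‖b.coeff (k - j)‖) :=
        mul_le_mul h1 (norm_mul_le _ _) (norm_nonneg _)
          (mul_nonneg (wt_pow_pos m _).le (wt_pow_pos m _).le)
    _ = _ := by ring

lemma summable_conv_prod (a b : Wiener m) :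
    Summable fun p : ℤ × ℤ => wt p.2 ^ m * ‖a.coeff p.1 * b.coeff (p.2 - p.1)‖ :=
  (hasSum_weighted_mul a b).summable.of_nonneg_of_le
    (fun _ => mul_nonneg (wt_pow_pos m _).le (norm_nonneg _))
    fun p => weighted_term_le a b p.1 p.2

lemma summable_conv_pair (a b : Wiener m) :
    Summable fun p : ℤ × ℤ => a.coeff p.1 * b.coeff (p.2 - p.1) :=
  Summable.of_norm <| (summable_conv_prod a b).of_nonneg_of_le (fun _ => norm_nonneg _)
    fun p => le_mul_of_one_le_left (norm_nonneg _) (one_le_pow₀ (one_le_wt p.2))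

lemma summable_conv_norm (a b : Wiener m) (k : ℤ) :
    Summable fun j => ‖a.coeff j * b.coeff (k - j)‖ := by
  have := ((summable_conv_prod a b).prod_symm.prod_factor k).mul_left (wt k ^ m)⁻¹
  refine this.congr fun j => ?_
  simp only [Prod.swap_prod_mk]
  rw [← mul_assoc, inv_mul_cancel₀ (wt_pow_pos m k).ne', one_mul]

lemma summable_conv (a b : Wiener m) (k : ℤ) :
    Summable fun j => a.coeff j * b.coeff (k - j) := (summable_conv_norm a b k).of_norm

lemma norm_conv_le (a b : Wiener m) (k : ℤ) :
    wt k ^ m * ‖∑' j, a.coeff j * b.coeff (k - j)‖ ≤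
      ∑' j, wt k ^ m * ‖a.coeff j * b.coeff (k - j)‖ := by
  rw [tsum_mul_left]
  exact mul_le_mul_of_nonneg_left (norm_tsum_le_tsum_norm (summable_conv_norm a b k))
    (wt_pow_pos m k).le

lemma summable_conv_weighted (a b : Wiener m) :
    Summable fun k => wt k ^ m * ‖∑' j, a.coeff j * b.coeff (k - j)‖ :=
  (summable_conv_prod a b).prod_symm.prod.of_nonneg_of_le
    (fun _ => mul_nonneg (wt_pow_pos m _).le (norm_nonneg _)) (norm_conv_le a b)

instance : Mul (Wiener m) :=
  ⟨fun a b => mk (fun k => ∑' j, a.coeff j * b.coeff (k - j)) (summable_conv_weighted a b)⟩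

lemma coeff_mul (a b : Wiener m) (k : ℤ) :
    (a * b).coeff k = ∑' j, a.coeff j * b.coeff (k - j) := coeff_mk _ _ k

instance : One (Wiener m) :=
  ⟨mk (Pi.single 0 1) (summable_of_ne_finset_zero (s := {0}) fun k hk => by
    simp at hk; simp [hk])⟩

lemma coeff_one (k : ℤ) : (1 : Wiener m).coeff k = (Pi.single 0 1 : ℤ → ℂ × ℂ) k := coeff_mk _ _ k

lemma norm_mul_le' (a b : Wiener m) : ‖a * b‖ ≤ ‖a‖ * ‖b‖ := by
  rw [← (hasSum_weighted_mul a b).tsum_eq, norm_eq_tsum]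
  calc ∑' k, wt k ^ m * ‖(a * b).coeff k‖
      ≤ ∑' k, ∑' j, wt k ^ m * ‖a.coeff j * b.coeff (k - j)‖ := by
        simp only [coeff_mul]
        exact (summable_conv_weighted a b).tsum_le_tsum (norm_conv_le a b)
          (summable_conv_prod a b).prod_symm.prod
    _ = ∑' p : ℤ × ℤ, wt p.2 ^ m * ‖a.coeff p.1 * b.coeff (p.2 - p.1)‖ := by
        rw [← (Equiv.prodComm ℤ ℤ).tsum_eq]
        exact ((summable_conv_prod a b).prod_symm.tsum_prod).symm
    _ ≤ _ := (summable_conv_prod a b).tsum_le_tsum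
        (fun p => weighted_term_le a b p.1 p.2) (hasSum_weighted_mul a b).summable

lemma mul_comm' (a b : Wiener m) : a * b = b * a := by
  ext1 k
  rw [coeff_mul, coeff_mul, ← (Equiv.subLeft k).tsum_eq]
  refine tsum_congr fun j => ?_
  simp [mul_comm]

lemma one_mul' (a : Wiener m) : 1 * a = a := by
  ext1 k
  rw [coeff_mul, tsum_eq_single 0]
  · simp [coeff_one]
  · intro j hj; simp [coeff_one, hj]

lemma left_distrib' (a b c : Wiener m) : a * (b + c) = a * b + a * c := by
  ext1 k
  simp only [coeff_mul, coeff_add, mul_add]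
  exact (summable_conv a b k).tsum_add (summable_conv a c k)

lemma mul_assoc' (a b c : Wiener m) : a * b * c = a * (b * c) := by
  ext1 k
  -- the double family `aᵢ b_{j-i} c_{k-j}` is absolutely summable
  have hs : Summable fun p : ℤ × ℤ => a.coeff p.1 * b.coeff (p.2 - p.1) * c.coeff (k - p.2) := by
    refine Summable.of_norm (((summable_conv_prod a b).mul_right ‖c‖).of_nonneg_of_le
      (fun _ => norm_nonneg _) fun p => ?_)
    refine (norm_mul_le _ _).trans (mul_le_mul ?_ (norm_coeff_le _ _) (norm_nonneg _) ?_)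
    · exact le_mul_of_one_le_left (norm_nonneg _) (one_le_pow₀ (one_le_wt p.2))
    · exact mul_nonneg (wt_pow_pos m _).le (norm_nonneg _)
  have h1 : ((a * b) * c).coeff k
      = ∑' j, ∑' i, a.coeff i * b.coeff (j - i) * c.coeff (k - j) := by
    rw [coeff_mul]
    refine tsum_congr fun j => ?_
    rw [coeff_mul, ← (summable_conv a b j).tsum_mul_right]
  have h2 : (a * (b * c)).coeff k
      = ∑' i, ∑' j, a.coeff i * b.coeff (j - i) * c.coeff (k - j) := by
    rw [coeff_mul]
    refine tsum_congr fun i => ?_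
    rw [coeff_mul, ← (summable_conv b c _).tsum_mul_left, ← (Equiv.subRight i).tsum_eq]
    refine tsum_congr fun j => ?_
    simp [mul_assoc]
  rw [h1, h2]
  exact Summable.tsum_comm hs

instance : NormedCommRing (Wiener m) where
  mul_assoc := mul_assoc'
  one_mul := one_mul'
  mul_one a := by rw [mul_comm', one_mul']
  left_distrib := left_distrib'
  right_distrib a b c := by rw [mul_comm', left_distrib', mul_comm' c a, mul_comm' c b]
  zero_mul a := by ext1 k; simp [coeff_mul]
  mul_zero a := by ext1 k; simp [coeff_mul]
  dist_eq := dist_eq_norm_neg_add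
  norm_mul_le := norm_mul_le'
  mul_comm := mul_comm'

lemma smul_mul' (c : ℂ) (a b : Wiener m) : c • a * b = c • (a * b) := by
  ext1 k
  simp only [coeff_mul, coeff_smul, smul_mul_assoc]
  exact (summable_conv a b k).tsum_const_smul c

instance : Algebra ℂ (Wiener m) :=
  Algebra.ofModule smul_mul' fun c a b => by rw [mul_comm', smul_mul', mul_comm']

instance : NormedAlgebra ℂ (Wiener m) where
  norm_smul_le := norm_smul_le

instance : NormedAlgebra ℚ (Wiener m) := NormedAlgebra.restrictScalars ℚ ℂ (Wiener m)

instance : NormOneClass (Wiener m) where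
  norm_one := by
    rw [norm_eq_tsum, tsum_eq_single 0]
    · simp [coeff_one, wt_zero]
    · intro j hj; simp [coeff_one, hj]

/-! ### Fourier multipliers -/

/-- The symbol `σ` maps `Wiener m` to `Wiener n` with norm at most `C`. -/
def MultBound (m n : ℕ) (C : ℝ) (σ : ℤ → ℂ) : Prop := ∀ k, ‖σ k‖ * wt k ^ n ≤ C * wt k ^ m

/-- The symbol `σ` defines a bounded Fourier multiplier from `Wiener m` to `Wiener n`. -/
def IsMult (m n : ℕ) (σ : ℤ → ℂ) : Prop := ∃ C, MultBound m n C σ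

lemma MultBound.isMult {C : ℝ} {σ : ℤ → ℂ} (h : MultBound m n C σ) : IsMult m n σ := ⟨C, h⟩

lemma MultBound.term_le {C : ℝ} {σ : ℤ → ℂ} (h : MultBound m n C σ) (a : Wiener m) (k : ℤ) :
    wt k ^ n * ‖σ k • a.coeff k‖ ≤ C * (wt k ^ m * ‖a.coeff k‖) := by
  rw [norm_smul]
  nlinarith [mul_le_mul_of_nonneg_right (h k) (norm_nonneg (a.coeff k))]

lemma MultBound.of_growth {C : ℝ} {σ : ℤ → ℂ} {q : ℕ} (hσ : ∀ k, ‖σ k‖ ≤ C * wt k ^ q)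
    (h : n + q ≤ m) : MultBound m n C σ := by
  intro k
  have hC : 0 ≤ C := by
    by_contra hC
    have := (norm_nonneg _).trans (hσ k)
    nlinarith [wt_pow_pos q k]
  calc ‖σ k‖ * wt k ^ n ≤ (C * wt k ^ q) * wt k ^ n :=
        mul_le_mul_of_nonneg_right (hσ k) (wt_pow_pos n k).le
    _ = C * wt k ^ (n + q) := by ring
    _ ≤ C * wt k ^ m := mul_le_mul_of_nonneg_left (pow_le_pow_right₀ (one_le_wt k) h) hC

lemma IsMult.summable {σ : ℤ → ℂ} (h : IsMult m n σ) (a : Wiener m) :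
    Summable fun k => wt k ^ n * ‖σ k • a.coeff k‖ := by
  obtain ⟨C, hC⟩ := h
  exact (a.summable_norm.mul_left C).of_nonneg_of_le
    (fun k => mul_nonneg (wt_pow_pos n k).le (norm_nonneg _)) (hC.term_le a)

/-- The Fourier multiplier with symbol `σ`, as a real-linear map. -/
def mult (m n : ℕ) (σ : ℤ → ℂ) (h : IsMult m n σ) : Wiener m →L[ℝ] Wiener n :=
  LinearMap.mkContinuousOfExistsBound
    { toFun := fun a => mk (fun k => σ k • a.coeff k) (h.summable a)
      map_add' := fun a b => by ext1 k; simp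
      map_smul' := fun c a => by ext1 k; simpa using smul_comm _ _ _ }
    (by
      obtain ⟨C, hC⟩ := h
      refine ⟨C, fun a => ?_⟩
      simp only [LinearMap.coe_mk, AddHom.coe_mk]
      rw [norm_mk, norm_eq_tsum, ← tsum_mul_left]
      exact (IsMult.summable ⟨C, hC⟩ a).tsum_le_tsum (hC.term_le a)
        (a.summable_norm.mul_left C))

@[simp] lemma coeff_mult (σ : ℤ → ℂ) (h : IsMult m n σ) (a : Wiener m) (k : ℤ) :
    (mult m n σ h a).coeff k = σ k • a.coeff k := coeff_mk _ (h.summable a) k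

lemma norm_mult_le {C : ℝ} {σ : ℤ → ℂ} (h : IsMult m n σ) (hC : MultBound m n C σ)
    (a : Wiener m) : ‖mult m n σ h a‖ ≤ C * ‖a‖ := by
  rw [norm_eq_tsum, norm_eq_tsum, ← tsum_mul_left]
  simp only [coeff_mult]
  exact (IsMult.summable ⟨C, hC⟩ a).tsum_le_tsum (hC.term_le a) (a.summable_norm.mul_left C)

lemma mult_smul (σ : ℤ → ℂ) (h : IsMult m n σ) (c : ℂ) (a : Wiener m) :
    mult m n σ h (c • a) = c • mult m n σ h a := by
  ext1 k; simpa using smul_comm _ _ _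

lemma multBound_one (h : n ≤ m) : MultBound m n 1 (fun _ => 1) :=
  MultBound.of_growth (q := 0) (by simp) (by simpa using h)

/-- The inclusion of a Wiener algebra into one of lower regularity. -/
def incl (h : n ≤ m) : Wiener m →L[ℝ] Wiener n := mult m n (fun _ => 1) (multBound_one h).isMult

@[simp] lemma coeff_incl (h : n ≤ m) (a : Wiener m) (k : ℤ) :
    (incl h a).coeff k = a.coeff k := by simp [incl]

@[simp] lemma incl_mul (h : n ≤ m) (a b : Wiener m) : incl h (a * b) = incl h a * incl h b := by
  ext1 k; simp [coeff_mul]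

@[simp] lemma incl_one (h : n ≤ m) : incl h (1 : Wiener m) = 1 := by
  ext1 k; simp [coeff_one]

lemma incl_smul (h : n ≤ m) (c : ℂ) (a : Wiener m) : incl h (c • a) = c • incl h a :=
  mult_smul _ _ c a

lemma norm_incl_le (h : n ≤ m) (a : Wiener m) : ‖incl h a‖ ≤ ‖a‖ :=
  (norm_mult_le (multBound_one h).isMult (multBound_one h) a).trans_eq (one_mul _)

/-! ### Unitary groups of multipliers -/

/-- The symbol `e^{itθₖ}`. -/
def phase (θ : ℤ → ℝ) (t : ℝ) (k : ℤ) : ℂ := Complex.exp (Complex.I * ((t * θ k : ℝ) : ℂ))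

@[simp] lemma norm_phase (θ : ℤ → ℝ) (t : ℝ) (k : ℤ) : ‖phase θ t k‖ = 1 := by
  rw [phase, mul_comm]; exact Complex.norm_exp_ofReal_mul_I _

lemma phase_zero (θ : ℤ → ℝ) (k : ℤ) : phase θ 0 k = 1 := by simp [phase]

lemma phase_add (θ : ℤ → ℝ) (s t : ℝ) (k : ℤ) :
    phase θ (s + t) k = phase θ s k * phase θ t k := by
  rw [phase, phase, phase, ← Complex.exp_add]; congr 1; push_cast; ring

lemma multBound_phase (θ : ℤ → ℝ) (t : ℝ) (h : n ≤ m) : MultBound m n 1 (phase θ t) :=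
  MultBound.of_growth (q := 0) (by simp) (by simpa using h)

/-- The multiplier `e^{itθ}`. -/
def evo (θ : ℤ → ℝ) (t : ℝ) (h : n ≤ m) : Wiener m →L[ℝ] Wiener n :=
  mult m n (phase θ t) (multBound_phase θ t h).isMult

@[simp] lemma coeff_evo (θ : ℤ → ℝ) (t : ℝ) (h : n ≤ m) (a : Wiener m) (k : ℤ) :
    (evo θ t h a).coeff k = phase θ t k • a.coeff k := coeff_mult _ _ a k

lemma norm_evo_le (θ : ℤ → ℝ) (t : ℝ) (h : n ≤ m) (a : Wiener m) : ‖evo θ t h a‖ ≤ ‖a‖ :=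
  (norm_mult_le (multBound_phase θ t h).isMult (multBound_phase θ t h) a).trans_eq (one_mul _)

lemma norm_evo (θ : ℤ → ℝ) (t : ℝ) (a : Wiener m) : ‖evo θ t le_rfl a‖ = ‖a‖ := by
  rw [norm_eq_tsum, norm_eq_tsum]; simp [norm_smul]

lemma evo_evo {p : ℕ} (θ : ℤ → ℝ) (s t : ℝ) (h : n ≤ m) (h' : p ≤ n) (a : Wiener m) :
    evo θ s h' (evo θ t h a) = evo θ (s + t) (h'.trans h) a := by
  ext1 k; simp [phase_add, mul_smul]

lemma evo_zero (θ : ℤ → ℝ) (a : Wiener m) : evo θ 0 le_rfl a = a := by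
  ext1 k; simp [phase_zero]

lemma norm_phase_sub_one_le (θ : ℤ → ℝ) (t : ℝ) (k : ℤ) : ‖phase θ t k - 1‖ ≤ |t| * |θ k| := by
  rw [phase, ← abs_mul]
  exact Real.norm_exp_I_mul_ofReal_sub_one_le

lemma norm_exp_I_sub_le (x : ℝ) :
    ‖Complex.exp (Complex.I * x) - 1 - Complex.I * x‖ ≤ x ^ 2 := by
  have hd : ∀ y : ℝ, HasDerivAt (fun y : ℝ => Complex.exp (Complex.I * y) - 1 - Complex.I * y)
      (Complex.I * (Complex.exp (Complex.I * y) - 1)) y := by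
    intro y
    have h1 : HasDerivAt (fun y : ℝ => Complex.I * (y : ℂ)) (Complex.I * 1) y :=
      (Complex.ofRealCLM.hasDerivAt (x := y)).const_mul Complex.I
    refine ((h1.cexp.sub_const 1).sub h1).congr_deriv ?_
    ring
  have hb : ∀ y ∈ Set.uIcc 0 x,
      ‖Complex.I * (Complex.exp (Complex.I * y) - 1)‖ ≤ |x| := by
    intro y hy
    rw [norm_mul, Complex.norm_I, one_mul]
    refine Real.norm_exp_I_mul_ofReal_sub_one_le.trans ?_
    rw [Real.norm_eq_abs]
    rcases Set.mem_uIcc.1 hy with h | h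
    · rw [abs_of_nonneg h.1]; exact h.2.trans (le_abs_self x)
    · rw [abs_of_nonpos h.2, abs_of_nonpos (h.1.trans h.2)]; linarith [h.1]
  have := (convex_uIcc 0 x).norm_image_sub_le_of_norm_hasDerivWithin_le
    (fun y _ => (hd y).hasDerivWithinAt) hb (Set.left_mem_uIcc) (Set.right_mem_uIcc)
  simp only [Complex.ofReal_zero, mul_zero, Complex.exp_zero, sub_zero, sub_self,
    Real.norm_eq_abs, abs_mul_abs_self] at this
  rw [sq]; exact this

/-- The symbol of the generator: multiplication of `σ` by `iθ`. -/
def gen (θ : ℤ → ℝ) (k : ℤ) : ℂ := Complex.I * (θ k : ℂ)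

lemma norm_gen (θ : ℤ → ℝ) (k : ℤ) : ‖gen θ k‖ = |θ k| := by
  simp [gen]

lemma multBound_gen {θ : ℤ → ℝ} {C : ℝ} {q : ℕ} (hθ : ∀ k, |θ k| ≤ C * wt k ^ q)
    (h : n + q ≤ m) : MultBound m n C (gen θ) :=
  MultBound.of_growth (q := q) (fun k => by rw [norm_gen]; exact hθ k) h

lemma multBound_gen_phase {θ : ℤ → ℝ} {C : ℝ} {q : ℕ} (hθ : ∀ k, |θ k| ≤ C * wt k ^ q) (t : ℝ)
    (h : n + q ≤ m) : MultBound m n C (fun k => gen θ k * phase θ t k) :=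
  MultBound.of_growth (q := q) (fun k => by rw [norm_mul, norm_gen, norm_phase, mul_one]; exact hθ k) h

/-- With a loss of twice the order of `θ`, the group `e^{itθ}` is differentiable in operator
norm. -/
lemma hasDerivAt_evo {θ : ℤ → ℝ} {C : ℝ} {q : ℕ} (hθ : ∀ k, |θ k| ≤ C * wt k ^ q)
    (h : n ≤ m) (h2 : n + 2 * q ≤ m) (hg : IsMult m n (fun k => gen θ k * phase θ t k)) :
    HasDerivAt (fun t => evo θ t h) (mult m n (fun k => gen θ k * phase θ t k) hg) t := by
  rw [hasDerivAt_iff_isLittleO]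
  have key : ∀ s : ℝ, ‖evo θ s h - evo θ t h
      - (s - t) • mult m n (fun k => gen θ k * phase θ t k) hg‖ ≤ C ^ 2 * ‖(s - t) ^ 2‖ := by
    intro s
    refine ContinuousLinearMap.opNorm_le_bound _ (by positivity) fun a => ?_
    have hb : MultBound m n (C ^ 2 * ‖(s - t) ^ 2‖)
        (fun k => phase θ s k - phase θ t k - ((s - t : ℝ) : ℂ) * (gen θ k * phase θ t k)) := by
      refine MultBound.of_growth (q := 2 * q) (fun k => ?_) h2
      have e1 : phase θ s k - phase θ t k - ((s - t : ℝ) : ℂ) * (gen θ k * phase θ t k)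
          = (Complex.exp (Complex.I * ((s - t) * θ k : ℝ)) - 1
              - Complex.I * ((s - t) * θ k : ℝ)) * phase θ t k := by
        have : phase θ s k = Complex.exp (Complex.I * ((s - t) * θ k : ℝ)) * phase θ t k := by
          rw [← phase, ← phase_add, sub_add_cancel]
        rw [this, gen]; push_cast; ring
      rw [e1, norm_mul, norm_phase, mul_one]
      refine (norm_exp_I_sub_le _).trans ?_
      have h3 : (θ k) ^ 2 ≤ (C * wt k ^ q) ^ 2 := sq_le_sq' (by linarith [neg_abs_le (θ k), hθ k])
        ((le_abs_self _).trans (hθ k))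
      rw [Real.norm_of_nonneg (sq_nonneg (s - t)), mul_pow]
      calc (s - t) ^ 2 * θ k ^ 2 ≤ (s - t) ^ 2 * (C * wt k ^ q) ^ 2 :=
            mul_le_mul_of_nonneg_left h3 (sq_nonneg _)
        _ = _ := by ring
    have e2 : (evo θ s h - evo θ t h
        - (s - t) • mult m n (fun k => gen θ k * phase θ t k) hg) a = mult m n _ hb.isMult a := by
      ext1 k
      simp only [sub_apply, smul_apply, coeff_sub,
        coeff_evo, coeff_real_smul, coeff_mult]
      rw [← Complex.coe_smul, smul_smul, ← sub_smul, ← sub_smul]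
    rw [e2]
    exact norm_mult_le _ hb a
  refine (Asymptotics.IsBigO.of_bound (C ^ 2) (Filter.Eventually.of_forall key)).trans_isLittleO ?_
  have := Asymptotics.isLittleO_pow_sub_sub (x₀ := t) (m := 2) (by norm_num)
  simpa using this

/-- The derivative of `t ↦ e^{itθ} U(t)`, measured with a loss of twice the order of `θ`. -/
lemma hasDerivAt_evo_apply {θ : ℤ → ℝ} {C : ℝ} {q : ℕ} (hθ : ∀ k, |θ k| ≤ C * wt k ^ q)
    (h : n ≤ m) (h2 : n + 2 * q ≤ m) (hg : IsMult m n (gen θ)) {U : ℝ → Wiener m} {U' : Wiener m}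
    {t : ℝ} (hU : HasDerivAt U U' t) :
    HasDerivAt (fun t => evo θ t h (U t))
      (mult m n (gen θ) hg (evo θ t le_rfl (U t)) + evo θ t h U') t := by
  have hq : n + q ≤ m := by omega
  refine ((hasDerivAt_evo hθ h h2 (multBound_gen_phase hθ t hq).isMult).clm_apply hU).congr_deriv ?_
  congr 1
  ext1 k
  simp [mul_smul]

lemma continuous_evo_apply (θ : ℤ → ℝ) (h : n ≤ m) (a : Wiener m) :
    Continuous fun t => evo θ t h a := by
  rw [continuous_iff_continuousAt]
  intro t
  rw [ContinuousAt, tendsto_iff_norm_sub_tendsto_zero]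
  have h1 : ∀ s, ‖evo θ s h a - evo θ t h a‖
      = ∑' k, wt k ^ n * ‖phase θ s k • a.coeff k - phase θ t k • a.coeff k‖ := fun s => by
    rw [norm_eq_tsum]; simp
  simp only [h1]
  have h0 : (0 : ℝ) = ∑' _ : ℤ, (0 : ℝ) := by simp
  rw [h0]
  refine tendsto_tsum_of_dominated_convergence
    (bound := fun k => 2 * (wt k ^ m * ‖a.coeff k‖)) (a.summable_norm.mul_left 2) ?_ ?_
  · intro k
    have hc : Continuous fun s => wt k ^ n * ‖phase θ s k • a.coeff k - phase θ t k • a.coeff k‖ := by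
      unfold phase; fun_prop
    have := hc.tendsto t
    simpa using this
  · refine Filter.Eventually.of_forall fun s k => ?_
    rw [Real.norm_of_nonneg (mul_nonneg (wt_pow_pos n k).le (norm_nonneg _))]
    have h2 : ‖phase θ s k • a.coeff k - phase θ t k • a.coeff k‖ ≤ 2 * ‖a.coeff k‖ := by
      refine (norm_sub_le _ _).trans ?_
      rw [norm_smul, norm_smul, norm_phase, norm_phase]; linarith
    calc _ ≤ wt k ^ m * (2 * ‖a.coeff k‖) := mul_le_mul
          (pow_le_pow_right₀ (one_le_wt k) h) h2 (norm_nonneg _) (wt_pow_pos m k).le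
      _ = _ := by ring

/-- The group `e^{itθ}` is strongly continuous without any loss. -/
lemma continuousOn_evo_apply (θ : ℤ → ℝ) (h : n ≤ m) {s : Set ℝ} {U : ℝ → Wiener m}
    (hU : ContinuousOn U s) : ContinuousOn (fun t => evo θ t h (U t)) s := by
  intro t ht
  have h1 := (continuous_evo_apply θ h (U t)).continuousWithinAt (s := s) (x := t)
  have h2 : Filter.Tendsto (fun r => evo θ r h (U r) - evo θ r h (U t)) (nhdsWithin t s)
      (nhds 0) := by
    rw [tendsto_zero_iff_norm_tendsto_zero]
    refine squeeze_zero (fun _ => norm_nonneg _) (fun r => ?_)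
      (tendsto_iff_norm_sub_tendsto_zero.1 (hU t ht))
    rw [← map_sub]
    exact norm_evo_le _ _ _ _
  have := h2.add h1
  rw [zero_add] at this
  refine this.congr fun r => ?_
  simp

/-! ### Conjugation and exchange of the two components -/

lemma summable_twist (e : ℤ ≃+ ℤ) (he : ∀ k, wt (e k) = wt k) (f : (ℂ × ℂ) →ₐ[ℝ] (ℂ × ℂ))
    (hf : ∀ x, ‖f x‖ = ‖x‖) (a : Wiener m) :
    Summable fun k => wt k ^ m * ‖f (a.coeff (e k))‖ := by
  have := (e.toEquiv.summable_iff (f := fun k => wt k ^ m * ‖a.coeff k‖)).mpr a.summable_norm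
  refine this.congr fun k => ?_
  simp [he, hf]

/-- The ring endomorphism acting by `e` on the frequencies and by `f` on the coefficients. -/
def twist (e : ℤ ≃+ ℤ) (he : ∀ k, wt (e k) = wt k) (f : (ℂ × ℂ) →ₐ[ℝ] (ℂ × ℂ))
    (hf : ∀ x, ‖f x‖ = ‖x‖) : Wiener m →ₐ[ℝ] Wiener m :=
  AlgHom.ofLinearMap
    { toFun := fun a => mk (fun k => f (a.coeff (e k))) (summable_twist e he f hf a)
      map_add' := fun a b => by ext1 k; simp
      map_smul' := fun c a => by ext1 k; simp }
    (by
      ext1 k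
      by_cases hk : k = 0
      · simp [coeff_one, hk]
      · simp [coeff_one, hk])
    (fun a b => by
      ext1 k
      have hc : Continuous f := AddMonoidHomClass.continuous_of_bound f 1 (by simp [hf])
      simp only [LinearMap.coe_mk, AddHom.coe_mk, coeff_mk, coeff_mul]
      rw [(summable_conv a b _).map_tsum f hc, ← e.toEquiv.tsum_eq]
      exact tsum_congr fun j => by simp)

@[simp] lemma coeff_twist (e : ℤ ≃+ ℤ) (he : ∀ k, wt (e k) = wt k) (f : (ℂ × ℂ) →ₐ[ℝ] (ℂ × ℂ))
    (hf : ∀ x, ‖f x‖ = ‖x‖) (a : Wiener m) (k : ℤ) :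
    (twist e he f hf a).coeff k = f (a.coeff (e k)) :=
  coeff_mk _ (summable_twist e he f hf a) k

lemma norm_twist (e : ℤ ≃+ ℤ) (he : ∀ k, wt (e k) = wt k) (f : (ℂ × ℂ) →ₐ[ℝ] (ℂ × ℂ))
    (hf : ∀ x, ‖f x‖ = ‖x‖) (a : Wiener m) : ‖twist e he f hf a‖ = ‖a‖ := by
  rw [norm_eq_tsum, norm_eq_tsum, ← e.toEquiv.tsum_eq (fun k => wt k ^ m * ‖a.coeff k‖)]
  exact tsum_congr fun k => by simp [he, hf]

/-- Complex conjugation of both components of a pair, as a real algebra map. -/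
def pairStar : (ℂ × ℂ) →ₐ[ℝ] (ℂ × ℂ) :=
  AlgHom.ofLinearMap
    { toFun := star, map_add' := star_add, map_smul' := fun c x => by ext <;> simp }
    (star_one _) (fun x y => by simp)

@[simp] lemma pairStar_apply (x : ℂ × ℂ) : pairStar x = star x := rfl

/-- Exchange of the two components of a pair, as a real algebra map. -/
def pairSwap : (ℂ × ℂ) →ₐ[ℝ] (ℂ × ℂ) :=
  AlgHom.ofLinearMap
    { toFun := Prod.swap, map_add' := fun _ _ => rfl, map_smul' := fun _ _ => rfl }
    rfl (fun _ _ => rfl)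

@[simp] lemma pairSwap_apply (x : ℂ × ℂ) : pairSwap x = x.swap := rfl

/-- Pointwise complex conjugation of both functions. -/
def conj : Wiener m →ₐ[ℝ] Wiener m :=
  twist (AddEquiv.neg ℤ) wt_neg pairStar (by simp)

/-- Exchange of the two functions. -/
def swap : Wiener m →ₐ[ℝ] Wiener m :=
  twist (AddEquiv.refl ℤ) (fun _ => rfl) pairSwap (by simp [Prod.norm_def, max_comm])

@[simp] lemma coeff_conj (a : Wiener m) (k : ℤ) : (conj a).coeff k = star (a.coeff (-k)) :=
  coeff_twist _ _ _ _ a k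
@[simp] lemma coeff_swap (a : Wiener m) (k : ℤ) : (swap a).coeff k = (a.coeff k).swap :=
  coeff_twist _ _ _ _ a k
@[simp] lemma norm_conj (a : Wiener m) : ‖conj a‖ = ‖a‖ := norm_twist _ _ _ _ a
@[simp] lemma norm_swap (a : Wiener m) : ‖swap a‖ = ‖a‖ := norm_twist _ _ _ _ a
@[simp] lemma conj_conj (a : Wiener m) : conj (conj a) = a := by ext1 k; simp
@[simp] lemma swap_swap (a : Wiener m) : swap (swap a) = a := by ext1 k; simp
lemma conj_swap (a : Wiener m) : conj (swap a) = swap (conj a) := by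
  ext1 k; simp only [coeff_conj, coeff_swap]; rfl
lemma conj_smul (c : ℂ) (a : Wiener m) : conj (c • a) = (starRingEnd ℂ) c • conj a := by
  ext1 k; simp
@[simp] lemma swap_smul (c : ℂ) (a : Wiener m) : swap (c • a) = c • swap a := by
  ext1 k; simp
@[simp] lemma incl_conj (h : n ≤ m) (a : Wiener m) : incl h (conj a) = conj (incl h a) := by
  ext1 k; simp
@[simp] lemma incl_swap (h : n ≤ m) (a : Wiener m) : incl h (swap a) = swap (incl h a) := by
  ext1 k; simp

lemma swap_mult (σ : ℤ → ℂ) (h : IsMult m n σ) (a : Wiener m) :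
    swap (mult m n σ h a) = mult m n σ h (swap a) := by
  ext1 k; simp

/-- An even real symbol commutes with complex conjugation. -/
lemma conj_mult {σ : ℤ → ℂ} (hσ : ∀ k, (starRingEnd ℂ) (σ (-k)) = σ k) (h : IsMult m n σ)
    (a : Wiener m) : conj (mult m n σ h a) = mult m n σ h (conj a) := by
  ext1 k; simp [hσ]

/-- `conj` as a continuous real-linear map. -/
def conjL : Wiener m →L[ℝ] Wiener m :=
  conj.toLinearMap.mkContinuous 1 (fun a => by simp)
/-- `swap` as a continuous real-linear map. -/
def swapL : Wiener m →L[ℝ] Wiener m :=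
  swap.toLinearMap.mkContinuous 1 (fun a => by simp)

lemma _root_.HasDerivAt.wiener_conj {u : ℝ → Wiener m} {u' : Wiener m} {t : ℝ}
    (h : HasDerivAt u u' t) : HasDerivAt (fun t => conj (u t)) (conj u') t :=
  (conjL (m := m)).hasFDerivAt.comp_hasDerivAt t h
lemma _root_.HasDerivAt.wiener_swap {u : ℝ → Wiener m} {u' : Wiener m} {t : ℝ}
    (h : HasDerivAt u u' t) : HasDerivAt (fun t => swap (u t)) (swap u') t :=
  (swapL (m := m)).hasFDerivAt.comp_hasDerivAt t h
lemma continuous_conj : Continuous (conj : Wiener m → Wiener m) := (conjL (m := m)).continuous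
lemma continuous_swap : Continuous (swap : Wiener m → Wiener m) := (swapL (m := m)).continuous

/-! ### Evaluation at a point -/

lemma norm_mode (k : ℤ) (x : ℝ) : ‖mode k x‖ = 1 := by
  have : Complex.I * (k : ℂ) * (x : ℂ) = ((k * x : ℝ) : ℂ) * Complex.I := by push_cast; ring
  rw [mode, this]; exact Complex.norm_exp_ofReal_mul_I _

lemma mode_add (j k : ℤ) (x : ℝ) : mode (j + k) x = mode j x * mode k x := by
  rw [mode, mode, mode, ← Complex.exp_add]; congr 1; push_cast; ring

lemma mode_neg (k : ℤ) (x : ℝ) : mode (-k) x = (starRingEnd ℂ) (mode k x) := by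
  rw [mode, mode, ← Complex.exp_conj]; congr 1; simp

lemma mode_zero_left (x : ℝ) : mode 0 x = 1 := by simp [mode]

lemma mode_eq_phase (k : ℤ) (x : ℝ) : mode k x = phase (fun k => (k : ℝ)) x k := by
  rw [mode, phase]; congr 1; push_cast; ring

lemma summable_mode (x : ℝ) (a : Wiener m) : Summable fun k => mode k x • a.coeff k :=
  Summable.of_norm (a.summable_coeff_norm.congr fun k => by rw [norm_smul, norm_mode, one_mul])

/-- Evaluation of the pair of functions with the given Fourier coefficients at a point. -/
def ev (x : ℝ) : Wiener m →ₐ[ℂ] ℂ × ℂ :=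
  AlgHom.ofLinearMap
    { toFun := fun a => ∑' k, mode k x • a.coeff k
      map_add' := fun a b => by
        simp only [coeff_add, smul_add]
        exact (summable_mode x a).tsum_add (summable_mode x b)
      map_smul' := fun c a => by
        simp only [coeff_smul, RingHom.id_apply]
        rw [← (summable_mode x a).tsum_const_smul c]
        exact tsum_congr fun k => smul_comm _ _ _ }
    (by
      simp only [LinearMap.coe_mk, AddHom.coe_mk]
      rw [tsum_eq_single 0]
      · simp [coeff_one, mode_zero_left]
      · intro j hj; simp [coeff_one, hj])
    (fun a b => by
      simp only [LinearMap.coe_mk, AddHom.coe_mk]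
      have hs : Summable fun p : ℤ × ℤ => (mode p.1 x • a.coeff p.1) *
          (mode (p.2 - p.1) x • b.coeff (p.2 - p.1)) := by
        refine Summable.of_norm ((summable_conv_pair a b).norm.congr fun p => ?_)
        rw [smul_mul_smul_comm, norm_smul, ← mode_add, norm_mode, one_mul]
      rw [(summable_mode x a).tsum_mul_tsum (summable_mode x b)
        ((shear.summable_iff (f := fun p : ℤ × ℤ => (mode p.1 x • a.coeff p.1) *
          (mode p.2 x • b.coeff p.2))).mp hs), ← shear.tsum_eq]
      change _ = ∑' p : ℤ × ℤ, (mode p.1 x • a.coeff p.1) *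
          (mode (p.2 - p.1) x • b.coeff (p.2 - p.1))
      rw [← (Equiv.prodComm ℤ ℤ).tsum_eq (fun p : ℤ × ℤ => (mode p.1 x • a.coeff p.1) *
          (mode (p.2 - p.1) x • b.coeff (p.2 - p.1)))]
      refine Eq.trans ?_ (((Equiv.prodComm ℤ ℤ).summable_iff.mpr hs).tsum_prod).symm
      refine tsum_congr fun k => ?_
      rw [coeff_mul, ← (summable_conv a b k).tsum_const_smul]
      refine tsum_congr fun j => ?_
      simp only [Function.comp_apply, Equiv.prodComm_apply, Prod.swap_prod_mk]
      rw [smul_mul_smul_comm, ← mode_add, add_sub_cancel])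

lemma ev_eq_tsum (x : ℝ) (a : Wiener m) : ev x a = ∑' k, mode k x • a.coeff k := rfl

lemma norm_ev_le (x : ℝ) (a : Wiener m) : ‖ev x a‖ ≤ ‖a‖ := by
  rw [ev_eq_tsum, norm_eq_tsum]
  have h : Summable fun k => ‖mode k x • a.coeff k‖ := (summable_mode x a).norm
  refine (norm_tsum_le_tsum_norm h).trans (h.tsum_le_tsum (fun k => ?_) a.summable_norm)
  rw [norm_smul, norm_mode, one_mul]
  exact le_mul_of_one_le_left (norm_nonneg _) (one_le_pow₀ (one_le_wt k))

lemma continuous_ev (x : ℝ) : Continuous (ev x : Wiener m → ℂ × ℂ) :=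
  AddMonoidHomClass.continuous_of_bound (ev x) 1 (by simpa using norm_ev_le x)

lemma ev_exp (x : ℝ) (a : Wiener m) : ev x (NormedSpace.exp a) = NormedSpace.exp (ev x a) :=
  NormedSpace.map_exp (ev x) (continuous_ev x) a

lemma ev_incl (h : n ≤ m) (x : ℝ) (a : Wiener m) : ev x (incl h a) = ev x a := by
  simp [ev_eq_tsum]

lemma ev_conj (x : ℝ) (a : Wiener m) : ev x (conj a) = star (ev x a) := by
  rw [ev_eq_tsum, ev_eq_tsum, tsum_star, ← (Equiv.neg ℤ).tsum_eq]
  refine tsum_congr fun k => ?_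
  simp [mode_neg]

lemma ev_swap (x : ℝ) (a : Wiener m) : ev x (swap a) = (ev x a).swap := by
  have := (summable_mode x a).map_tsum pairSwap
    (AddMonoidHomClass.continuous_of_bound pairSwap 1 (by simp [Prod.norm_def, max_comm]))
  simp only [pairSwap_apply] at this
  rw [ev_eq_tsum, ev_eq_tsum, this]
  simp

/-- Evaluation at `0` as a continuous real-linear map. -/
def evZero : Wiener m →L[ℝ] ℂ × ℂ :=
  ((ev 0).toLinearMap.restrictScalars ℝ).mkContinuous 1 (fun a => by simpa using norm_ev_le 0 a)

/-- Evaluation at `x` is evaluation at `0` after a translation by `x`. -/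
lemma ev_eq_evZero (h : n ≤ m) (x : ℝ) (a : Wiener m) :
    ev x a = evZero (evo (n := n) (fun k => (k : ℝ)) x h a) := by
  change _ = ev 0 (evo (fun k => (k : ℝ)) x h a)
  rw [ev_eq_tsum, ev_eq_tsum]
  refine tsum_congr fun k => ?_
  simp [mode_eq_phase, phase]

/-! ### The cubic nonlinearities -/

/-- The potential `(λ/8)(|u|² + 2|v|², |v|² + 2|u|²)` of the pair `a = (u, v)`. -/
def pot (lam : ℝ) (a : Wiener m) : Wiener m :=
  ((lam / 8 : ℝ) : ℂ) • (a * conj a + (2 : ℂ) • swap (a * conj a))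

/-- The nonlinearity of the limit system, written as `∂ₜ a = nls a + ` linear part. -/
def nls (lam : ℝ) (a : Wiener m) : Wiener m := -(Complex.I • (pot lam a * a))

/-- For `a = (u, v)` the pair `(z, z̄)` with `z = (u + v̄)/2`. -/
def field (a : Wiener m) : Wiener m := (1 / 2 : ℂ) • (a + swap (conj a))

/-- The Klein-Gordon nonlinearity `-iλ (|z|² z, |z|² z̄)` with `z = (u + v̄)/2`. -/
def kgs (lam : ℝ) (a : Wiener m) : Wiener m :=
  (-Complex.I * (lam : ℂ)) • (field a * field a * swap (field a))

lemma norm_mul_sub_mul_le {R : Type*} [NormedCommRing R] {ρ ρ' : ℝ} {a a' b b' : R}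
    (hb : ‖b‖ ≤ ρ') (ha' : ‖a'‖ ≤ ρ) :
    ‖a * b - a' * b'‖ ≤ ρ' * ‖a - a'‖ + ρ * ‖b - b'‖ := by
  have e : a * b - a' * b' = (a - a') * b + a' * (b - b') := by ring
  rw [e]
  refine (norm_add_le _ _).trans (add_le_add ?_ ?_)
  · rw [mul_comm ρ']
    exact (norm_mul_le _ _).trans (mul_le_mul_of_nonneg_left hb (norm_nonneg _))
  · exact (norm_mul_le _ _).trans (mul_le_mul_of_nonneg_right ha' (norm_nonneg _))

lemma norm_mul_le_sq {R : Type*} [NormedCommRing R] {ρ ρ' : ℝ} {a b : R} (ha : ‖a‖ ≤ ρ)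
    (hb : ‖b‖ ≤ ρ') : ‖a * b‖ ≤ ρ * ρ' :=
  (norm_mul_le a b).trans (mul_le_mul ha hb (norm_nonneg _) ((norm_nonneg _).trans ha))

lemma norm_ofReal_smul (c : ℝ) (a : Wiener m) : ‖(c : ℂ) • a‖ = |c| * ‖a‖ := by
  rw [norm_smul, Complex.norm_real, Real.norm_eq_abs]

lemma norm_two_smul (a : Wiener m) : ‖(2 : ℂ) • a‖ = 2 * ‖a‖ := by
  rw [norm_smul]; norm_num

lemma norm_I_smul (a : Wiener m) : ‖Complex.I • a‖ = ‖a‖ := by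
  rw [norm_smul, Complex.norm_I, one_mul]

lemma norm_pot_le {lam ρ : ℝ} {a : Wiener m} (ha : ‖a‖ ≤ ρ) : ‖pot lam a‖ ≤ |lam| * ρ ^ 2 := by
  have h1 : ‖a * conj a‖ ≤ ρ * ρ := norm_mul_le_sq ha (by simpa using ha)
  rw [pot, norm_ofReal_smul, abs_div, abs_of_pos (by norm_num : (0 : ℝ) < 8)]
  have h2 : ‖a * conj a + (2 : ℂ) • swap (a * conj a)‖ ≤ 3 * (ρ * ρ) := by
    refine (norm_add_le _ _).trans ?_
    rw [norm_two_smul, norm_swap]; linarith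
  nlinarith [abs_nonneg lam, mul_le_mul_of_nonneg_left h2 (abs_nonneg lam),
    mul_nonneg (abs_nonneg lam) (sq_nonneg ρ)]

lemma norm_pot_sub_le {lam ρ : ℝ} {a b : Wiener m} (ha : ‖a‖ ≤ ρ) (hb : ‖b‖ ≤ ρ) :
    ‖pot lam a - pot lam b‖ ≤ |lam| * ρ * ‖a - b‖ := by
  have h1 : ‖a * conj a - b * conj b‖ ≤ ρ * ‖a - b‖ + ρ * ‖a - b‖ := by
    have := norm_mul_sub_mul_le (a := a) (a' := b) (b := conj a) (b' := conj b)
      (ρ := ρ) (ρ' := ρ) (by simpa using ha) hb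
    rwa [← map_sub, norm_conj] at this
  have e : pot lam a - pot lam b = ((lam / 8 : ℝ) : ℂ) •
      ((a * conj a - b * conj b) + (2 : ℂ) • swap (a * conj a - b * conj b)) := by
    rw [pot, pot, map_sub]; module
  rw [e, norm_ofReal_smul, abs_div, abs_of_pos (by norm_num : (0 : ℝ) < 8)]
  have h2 : ‖(a * conj a - b * conj b) + (2 : ℂ) • swap (a * conj a - b * conj b)‖
      ≤ 3 * (ρ * ‖a - b‖ + ρ * ‖a - b‖) := by
    refine (norm_add_le _ _).trans ?_
    rw [norm_two_smul, norm_swap]; linarith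
  have hρ : 0 ≤ ρ := (norm_nonneg _).trans ha
  nlinarith [mul_le_mul_of_nonneg_left h2 (abs_nonneg lam),
    mul_nonneg (mul_nonneg (abs_nonneg lam) hρ) (norm_nonneg (a - b))]

lemma norm_nls_le {lam ρ : ℝ} {a : Wiener m} (ha : ‖a‖ ≤ ρ) : ‖nls lam a‖ ≤ 3 * |lam| * ρ ^ 3 := by
  rw [nls, norm_neg, norm_I_smul]
  have hρ : 0 ≤ ρ := (norm_nonneg _).trans ha
  have := norm_mul_le_sq (norm_pot_le (lam := lam) ha) ha
  have : 0 ≤ |lam| * ρ ^ 3 := by positivity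
  nlinarith

lemma norm_nls_sub_le {lam ρ : ℝ} {a b : Wiener m} (ha : ‖a‖ ≤ ρ) (hb : ‖b‖ ≤ ρ) :
    ‖nls lam a - nls lam b‖ ≤ 3 * |lam| * ρ ^ 2 * ‖a - b‖ := by
  have e : nls lam a - nls lam b = -(Complex.I • (pot lam a * a - pot lam b * b)) := by
    rw [nls, nls]; module
  rw [e, norm_neg, norm_I_smul]
  refine (norm_mul_sub_mul_le ha (norm_pot_le hb)).trans ?_
  have hρ : 0 ≤ ρ := (norm_nonneg _).trans ha
  have h1 := mul_le_mul_of_nonneg_left (norm_pot_sub_le (lam := lam) ha hb) hρ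
  have : 0 ≤ |lam| * ρ ^ 2 * ‖a - b‖ := by positivity
  nlinarith

lemma field_sub (a b : Wiener m) : field a - field b = field (a - b) := by
  simp only [field, map_sub]; module

lemma norm_field_le (a : Wiener m) : ‖field a‖ ≤ ‖a‖ := by
  rw [field, norm_smul]
  have := norm_add_le a (swap (conj a))
  rw [norm_swap, norm_conj] at this
  norm_num
  linarith

lemma norm_kgs_le {lam ρ : ℝ} {a : Wiener m} (ha : ‖a‖ ≤ ρ) : ‖kgs lam a‖ ≤ 3 * |lam| * ρ ^ 3 := by
  have h := (norm_field_le a).trans ha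
  have h1 := norm_mul_le_sq (norm_mul_le_sq h h) ((norm_swap (field a)).trans_le h)
  have hρ : 0 ≤ ρ := (norm_nonneg _).trans ha
  rw [kgs, norm_smul, norm_mul, norm_neg, Complex.norm_I, Complex.norm_real, one_mul,
    Real.norm_eq_abs]
  have := mul_le_mul_of_nonneg_left h1 (abs_nonneg lam)
  have : 0 ≤ |lam| * ρ ^ 3 := by positivity
  nlinarith

lemma norm_kgs_sub_le {lam ρ : ℝ} {a b : Wiener m} (ha : ‖a‖ ≤ ρ) (hb : ‖b‖ ≤ ρ) :
    ‖kgs lam a - kgs lam b‖ ≤ 3 * |lam| * ρ ^ 2 * ‖a - b‖ := by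
  have hA := (norm_field_le a).trans ha
  have hB := (norm_field_le b).trans hb
  have hd : ‖field a - field b‖ ≤ ‖a - b‖ := by rw [field_sub]; exact norm_field_le _
  have hρ : 0 ≤ ρ := (norm_nonneg _).trans ha
  have h1 := norm_mul_sub_mul_le (a := field a) (a' := field b) (b := field a) (b' := field b) hA hB
  have h2 := norm_mul_sub_mul_le (a := field a * field a) (a' := field b * field b)
    (b := swap (field a)) (b' := swap (field b)) ((norm_swap _).trans_le hA) (norm_mul_le_sq hB hB)
  rw [← map_sub, norm_swap] at h2
  have h3 : ‖field a * field a * swap (field a) - field b * field b * swap (field b)‖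
      ≤ 3 * ρ ^ 2 * ‖a - b‖ := by
    refine h2.trans ?_
    have h4 := mul_le_mul_of_nonneg_left h1 hρ
    have h5 := mul_le_mul_of_nonneg_left hd (mul_nonneg hρ hρ)
    nlinarith
  rw [kgs, kgs, ← smul_sub, norm_smul, norm_mul, norm_neg, Complex.norm_I, Complex.norm_real,
    one_mul, Real.norm_eq_abs]
  nlinarith [mul_le_mul_of_nonneg_left h3 (abs_nonneg lam)]

lemma incl_pot (h : n ≤ m) (lam : ℝ) (a : Wiener m) : incl h (pot lam a) = pot lam (incl h a) := by
  simp [pot, incl_smul]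

lemma incl_nls (h : n ≤ m) (lam : ℝ) (a : Wiener m) : incl h (nls lam a) = nls lam (incl h a) := by
  simp [nls, incl_smul, incl_pot]

lemma incl_field (h : n ≤ m) (a : Wiener m) : incl h (field a) = field (incl h a) := by
  simp [field, incl_smul]

lemma incl_kgs (h : n ≤ m) (lam : ℝ) (a : Wiener m) : incl h (kgs lam a) = kgs lam (incl h a) := by
  simp [kgs, incl_smul, incl_field]

/-! ### Local solutions of dispersive equations with bounded nonlinearity -/

/-- `u` is a solution on `[-T, T]` of `∂ₜ u = iθ u + G(u)`, in the sense that the profile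
`e^{-itθ} u(t)`, whose equation has a bounded right-hand side, is differentiable. -/
structure IsMildSol (θ : ℤ → ℝ) (G : Wiener m → Wiener m) (T ρ : ℝ) (u : ℝ → Wiener m) : Prop where
  norm_le : ∀ t ∈ Set.Icc (-T) T, ‖u t‖ ≤ ρ
  continuousOn : ContinuousOn u (Set.Icc (-T) T)
  hasDerivAt_profile : ∀ t ∈ Set.Ioo (-T) T,
    HasDerivAt (fun t => evo θ (-t) le_rfl (u t)) (evo θ (-t) le_rfl (G (u t))) t

/-- Local existence, on a time interval that does not depend on `θ`. -/
theorem exists_isMildSol (θ : ℤ → ℝ) (G : Wiener m → Wiener m) (a₀ : Wiener m) {R L T : ℝ}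
    (hR : 0 ≤ R) (hL : 0 ≤ L) (hT : 0 ≤ T) (ha₀ : ‖a₀‖ ≤ R)
    (hG : ∀ a b, ‖a‖ ≤ 2 * R → ‖b‖ ≤ 2 * R → ‖G a - G b‖ ≤ L * ‖a - b‖)
    {B : ℝ} (hB : 0 ≤ B) (hGB : ∀ a, ‖a‖ ≤ 2 * R → ‖G a‖ ≤ B) (hBT : B * T ≤ R) :
    ∃ u : ℝ → Wiener m, u 0 = a₀ ∧ IsMildSol θ G T (2 * R) u := by
  set f : ℝ → Wiener m → Wiener m := fun t x => evo θ (-t) le_rfl (G (evo θ t le_rfl x)) with hf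
  have hball : ∀ x ∈ Metric.closedBall a₀ R, ‖x‖ ≤ 2 * R := fun x hx => by
    have h1 : ‖x‖ ≤ ‖x - a₀‖ + ‖a₀‖ := by simpa using norm_add_le (x - a₀) a₀
    rw [mem_closedBall_iff_norm] at hx
    linarith
  have hGc : ContinuousOn G {a | ‖a‖ ≤ 2 * R} :=
    (LipschitzOnWith.of_dist_le_mul (K := L.toNNReal) fun a ha b hb => by
      rw [dist_eq_norm, dist_eq_norm, Real.coe_toNNReal L hL]; exact hG a b ha hb).continuousOn
  have hevo : ∀ t (x : Wiener m), ‖x‖ ≤ 2 * R → ‖evo θ t le_rfl x‖ ≤ 2 * R := fun t x hx => by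
    rw [norm_evo]; exact hx
  have h0 : (0 : ℝ) ∈ Set.Icc (-T) T := ⟨by linarith, hT⟩
  have hpl : IsPicardLindelof f (tmin := -T) (tmax := T) ⟨0, h0⟩ a₀ R.toNNReal 0 B.toNNReal
      L.toNNReal :=
    { lipschitzOnWith := fun t _ => LipschitzOnWith.of_dist_le_mul fun x hx y hy => by
        rw [Real.coe_toNNReal R hR] at hx hy
        rw [dist_eq_norm, dist_eq_norm, Real.coe_toNNReal L hL, hf]
        simp only
        rw [← map_sub, norm_evo]
        refine (hG _ _ (hevo t x (hball x hx)) (hevo t y (hball y hy))).trans_eq ?_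
        rw [← map_sub, norm_evo]
      continuousOn := fun x hx => by
        rw [Real.coe_toNNReal R hR] at hx
        have h1 : ContinuousOn (fun s => G (evo θ (-s) le_rfl x)) Set.univ :=
          hGc.comp ((continuous_evo_apply θ le_rfl x).comp continuous_neg).continuousOn
            fun s _ => hevo _ x (hball x hx)
        have h2 := (continuousOn_evo_apply θ (le_refl m) h1).comp
          (continuous_neg (G := ℝ)).continuousOn (Set.mapsTo_univ _ (Set.Icc (-T) T))
        simpa [Function.comp_def, hf] using h2
      norm_le := fun t _ x hx => by
        rw [Real.coe_toNNReal R hR] at hx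
        rw [Real.coe_toNNReal B hB, hf]
        simp only
        rw [norm_evo]
        exact hGB _ (hevo t x (hball x hx))
      mul_max_le := by
        rw [Real.coe_toNNReal R hR, Real.coe_toNNReal B hB]
        simpa using hBT }
  have hx0 : a₀ ∈ Metric.closedBall a₀ ((0 : NNReal) : ℝ) := by simp
  obtain ⟨α, hα⟩ := ODE.FunSpace.exists_isFixedPt_next hpl hx0
  have hmem : ∀ t, α.compProj t ∈ Metric.closedBall a₀ R := fun t => by
    have := α.compProj_mem_closedBall hpl.mul_max_le (t := t)
    rwa [Real.coe_toNNReal R hR] at this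
  have hU : ∀ t ∈ Set.Ioo (-T) T, HasDerivAt α.compProj (f t (α.compProj t)) t := by
    intro t ht
    have htI := Set.Ioo_subset_Icc_self ht
    have hpic : ∀ t ∈ Set.Icc (-T) T, α.compProj t = ODE.picard f (0 : ℝ) a₀ α.compProj t := by
      intro t ht
      conv_lhs => rw [← hα]
      rw [ODE.FunSpace.compProj_apply, ODE.FunSpace.next_apply, Set.projIcc_of_mem _ ht]
    have h1 := ODE.hasDerivWithinAt_picard_Icc h0 hpl.continuousOn_uncurry
      α.continuous_compProj.continuousOn
      (fun t _ => by rw [Real.coe_toNNReal R hR]; exact hmem t) a₀ htI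
    exact (h1.congr hpic (hpic t htI)).hasDerivAt (Icc_mem_nhds ht.1 ht.2)
  refine ⟨fun t => evo θ t le_rfl (α.compProj t), ?_, ⟨?_, ?_, ?_⟩⟩
  · have : α.compProj 0 = a₀ := by
      rw [← hα]
      exact (ODE.FunSpace.compProj_val (t := (⟨0, h0⟩ : Set.Icc (-T) T))).trans
        (ODE.FunSpace.next_apply₀ hpl hx0 α)
    simp only [this, evo_zero]
  · intro t _
    exact hevo t _ (hball _ (hmem t))
  · exact continuousOn_evo_apply θ le_rfl α.continuous_compProj.continuousOn
  · intro t ht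
    have e : (fun t => evo θ (-t) le_rfl (evo θ t le_rfl (α.compProj t))) = α.compProj := by
      funext t
      rw [evo_evo, neg_add_cancel, evo_zero]
    simp only [e]
    exact hU t ht

namespace IsMildSol

variable {θ : ℤ → ℝ} {G : Wiener m → Wiener m} {T ρ : ℝ} {u : ℝ → Wiener m}

/-- A solution satisfies its equation in a space of lower regularity. -/
lemma hasDerivAt (hu : IsMildSol θ G T ρ u) {C : ℝ} {q : ℕ} (hθ : ∀ k, |θ k| ≤ C * wt k ^ q)
    (h : n ≤ m) (h2 : n + 2 * q ≤ m) (hg : IsMult m n (gen θ)) {t : ℝ} (ht : t ∈ Set.Ioo (-T) T) :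
    HasDerivAt (fun t => incl h (u t)) (mult m n (gen θ) hg (u t) + incl h (G (u t))) t := by
  have h1 := hasDerivAt_evo_apply hθ h h2 hg (hu.hasDerivAt_profile t ht)
  rw [evo_evo, add_neg_cancel, evo_zero, evo_evo, add_neg_cancel] at h1
  have e : ∀ a : Wiener m, evo θ 0 h a = incl h a := fun a => by ext1 k; simp [phase_zero]
  rw [e] at h1
  refine h1.congr_of_eventuallyEq (Filter.Eventually.of_forall fun s => ?_)
  simp only
  rw [evo_evo, add_neg_cancel, e]

end IsMildSol

/-! ### Smoothness of evaluation in space and time -/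

lemma abs_id_le (k : ℤ) : |((fun k : ℤ => (k : ℝ)) k)| ≤ 1 * wt k ^ 1 := by
  simpa using abs_le_wt k

/-- The symbol `ik` of the derivative. -/
abbrev dx : ℤ → ℂ := gen fun k => (k : ℝ)

lemma isMult_dx (h : n + 1 ≤ m) : IsMult m n dx := (multBound_gen abs_id_le h).isMult

/-- Translations depend continuously on the amount, in operator norm with loss of one order. -/
lemma continuous_translation (h : n ≤ m) (h1 : n + 1 ≤ m) :
    Continuous fun x => (evo (fun k => (k : ℝ)) x h : Wiener m →L[ℝ] Wiener n) := by
  refine (LipschitzWith.of_dist_le_mul (K := 1) fun x y => ?_).continuous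
  rw [dist_eq_norm, dist_eq_norm, NNReal.coe_one, one_mul]
  refine ContinuousLinearMap.opNorm_le_bound _ (norm_nonneg _) fun a => ?_
  have hb : MultBound m n ‖x - y‖ (fun k => phase (fun k => (k : ℝ)) x k
      - phase (fun k => (k : ℝ)) y k) := by
    refine MultBound.of_growth (q := 1) (fun k => ?_) h1
    have e : phase (fun k => (k : ℝ)) x k - phase (fun k => (k : ℝ)) y k
        = (phase (fun k => (k : ℝ)) (x - y) k - 1) * phase (fun k => (k : ℝ)) y k := by
      rw [sub_mul, ← phase_add, sub_add_cancel, one_mul]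
    rw [e, norm_mul, norm_phase, mul_one]
    refine (norm_phase_sub_one_le _ _ _).trans ?_
    rw [Real.norm_eq_abs, pow_one]
    exact mul_le_mul_of_nonneg_left (abs_le_wt k) (abs_nonneg _)
  have e2 : ((evo (fun k => (k : ℝ)) x h : Wiener m →L[ℝ] Wiener n)
      - evo (fun k => (k : ℝ)) y h) a = mult m n _ hb.isMult a := by
    ext1 k; simp [sub_smul]
  rw [e2]
  exact norm_mult_le _ hb a

lemma hasDerivAt_translation {l : ℕ} (h : n ≤ m) (hl : n ≤ l) (hlm : l + 1 ≤ m) (h2 : n + 2 ≤ m)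
    (x : ℝ) : HasDerivAt (fun x => (evo (fun k => (k : ℝ)) x h : Wiener m →L[ℝ] Wiener n))
      ((evo (fun k => (k : ℝ)) x hl).comp (mult m l dx (isMult_dx hlm))) x := by
  refine (hasDerivAt_evo abs_id_le h (by simpa using h2)
    (multBound_gen_phase abs_id_le x (by omega)).isMult).congr_deriv ?_
  ext1 a
  ext1 k
  simp only [ContinuousLinearMap.comp_apply, coeff_mult, coeff_evo, smul_smul]
  rw [mul_comm]

lemma contDiff_translation : ∀ (j m n : ℕ) (h : n ≤ m), n + j + 1 ≤ m →
    ContDiff ℝ j fun x => (evo (fun k => (k : ℝ)) x h : Wiener m →L[ℝ] Wiener n)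
  | 0, m, n, h, h1 => by
    rw [Nat.cast_zero]
    exact contDiff_zero.2 (continuous_translation h (by omega))
  | j + 1, m, n, h, h1 => by
    have hd := hasDerivAt_translation (l := m - 1) h (by omega) (by omega) (by omega)
    push_cast
    rw [contDiff_succ_iff_deriv]
    refine ⟨fun x => (hd x).differentiableAt, by simp, ?_⟩
    rw [funext fun x => (hd x).deriv]
    have := contDiff_translation j (m - 1) n (by omega) (by omega)
    fun_prop

/-- The first component of the evaluation at `x`, as a continuous real-linear functional. -/
def evFst (x : ℝ) : Wiener m →L[ℝ] ℂ :=
  (ContinuousLinearMap.fst ℝ ℂ ℂ).comp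
    (((ev x).toLinearMap.restrictScalars ℝ).mkContinuous 1 fun a => by simpa using norm_ev_le x a)

/-- A `C²` curve in the Wiener algebra is a `C²` function of time and space. -/
lemma contDiffOn_ev {n : ℕ} (hn : 3 ≤ n) {s : Set ℝ} {ζ : ℝ → Wiener n} (hζ : ContDiffOn ℝ 2 ζ s) :
    ContDiffOn ℝ 2 (fun p : ℝ × ℝ => (ev p.2 (ζ p.1)).1) (s ×ˢ Set.univ) := by
  have h1 : ContDiffOn ℝ 2 (fun p : ℝ × ℝ => ζ p.1) (s ×ˢ Set.univ) :=
    hζ.comp contDiff_fst.contDiffOn fun p hp => hp.1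
  have h2 : ContDiffOn ℝ 2 (fun p : ℝ × ℝ =>
      (evo (fun k => (k : ℝ)) p.2 (Nat.zero_le n) : Wiener n →L[ℝ] Wiener 0)) (s ×ˢ Set.univ) :=
    ((contDiff_translation 2 n 0 (Nat.zero_le n) hn).comp contDiff_snd).contDiffOn
  have h3 : ContDiffOn ℝ 2 (fun p : ℝ × ℝ => (ContinuousLinearMap.fst ℝ ℂ ℂ).comp evZero
      ((evo (fun k => (k : ℝ)) p.2 (Nat.zero_le n) : Wiener n →L[ℝ] Wiener 0) (ζ p.1)))
      (s ×ˢ Set.univ) :=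
    (ContinuousLinearMap.contDiff _).comp_contDiffOn (h2.clm_apply h1)
  refine h3.congr fun p _ => ?_
  rw [ev_eq_evZero (Nat.zero_le n)]; rfl

lemma hasDerivAt_ev (h : n + 2 ≤ m) (a : Wiener m) (x : ℝ) :
    HasDerivAt (fun x => (ev x a).1) (ev x (mult m n dx (isMult_dx (by omega)) a)).1 x := by
  have h1 : n ≤ m := by omega
  have h2 := hasDerivAt_evo_apply (C := 1) (q := 1) abs_id_le h1 (by simpa using h)
    (isMult_dx (by omega)) (hasDerivAt_const x a)
  rw [map_zero, add_zero] at h2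
  have h3 := ((ContinuousLinearMap.fst ℝ ℂ ℂ).comp evZero).hasFDerivAt.comp_hasDerivAt x h2
  refine (h3.congr_deriv ?_).congr_of_eventuallyEq (Filter.Eventually.of_forall fun y => ?_)
  · rw [ev_eq_evZero le_rfl]
    simp only [ContinuousLinearMap.comp_apply, ContinuousLinearMap.coe_fst']
    congr 2
    ext1 k
    simp [smul_smul, mul_comm]
  · simp only [Function.comp_apply]
    rw [ev_eq_evZero h1]; rfl

lemma isMult_dx_sq (h : n + 2 ≤ m) : IsMult m n (fun k => -((k : ℂ) ^ 2)) :=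
  (MultBound.of_growth (C := 1) (q := 2) (fun k => by
    have := abs_le_wt k
    rw [norm_neg, norm_pow, Complex.norm_intCast, one_mul]
    exact pow_le_pow_left₀ (abs_nonneg _) this 2) h).isMult

lemma iteratedDeriv_two_ev (h : n + 4 ≤ m) (a : Wiener m) (x : ℝ) :
    iteratedDeriv 2 (fun x => (ev x a).1) x
      = (ev x (mult m n (fun k => -((k : ℂ) ^ 2)) (isMult_dx_sq (by omega)) a)).1 := by
  have h1 := hasDerivAt_ev (n := n + 2) (by omega) a
  rw [iteratedDeriv_succ, iteratedDeriv_one, funext fun x => (h1 x).deriv,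
    (hasDerivAt_ev (n := n) le_rfl _ x).deriv]
  congr 2
  ext1 k
  simp only [coeff_mult, gen, smul_smul]
  congr 1
  push_cast
  linear_combination (k : ℂ) ^ 2 * Complex.I_sq

lemma mode_periodic (k : ℤ) : Function.Periodic (mode k) (2 * Real.pi) := by
  intro x
  have : Complex.I * (k : ℂ) * ((x + 2 * Real.pi : ℝ) : ℂ)
      = Complex.I * k * x + k * (2 * Real.pi * Complex.I) := by push_cast; ring
  rw [mode, mode, this, Complex.exp_add, Complex.exp_int_mul_two_pi_mul_I, mul_one]

lemma ev_periodic (a : Wiener m) (x : ℝ) : ev (x + 2 * Real.pi) a = ev x a := by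
  simp only [ev_eq_tsum, mode_periodic _ x]

/-! ### The Klein-Gordon equation as a first-order system -/

/-- The symbol `c √(k² + c²)`. -/
def kgFreq (c : ℝ) (k : ℤ) : ℝ := c * Real.sqrt ((k : ℝ) ^ 2 + c ^ 2)

/-- The symbol `c / √(k² + c²)`. -/
def kgDamp (c : ℝ) (k : ℤ) : ℝ := c / Real.sqrt ((k : ℝ) ^ 2 + c ^ 2)

lemma sqrt_freq_pos {c : ℝ} (hc : 0 < c) (k : ℤ) : 0 < Real.sqrt ((k : ℝ) ^ 2 + c ^ 2) :=
  Real.sqrt_pos.2 (by positivity)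

lemma kgFreq_mul_kgDamp {c : ℝ} (hc : 0 < c) (k : ℤ) : kgFreq c k * kgDamp c k = c ^ 2 := by
  have := (sqrt_freq_pos hc k).ne'
  unfold kgFreq kgDamp
  field_simp

lemma kgFreq_sq (c : ℝ) (k : ℤ) : kgFreq c k ^ 2 = c ^ 2 * ((k : ℝ) ^ 2 + c ^ 2) := by
  rw [kgFreq, mul_pow, Real.sq_sqrt (by positivity)]

lemma abs_kgFreq_le {c : ℝ} (hc : 0 < c) (k : ℤ) : |kgFreq c k| ≤ c * (1 + c) * wt k ^ 1 := by
  have h : Real.sqrt ((k : ℝ) ^ 2 + c ^ 2) ≤ (1 + c) * wt k := by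
    refine Real.sqrt_le_iff.2 ⟨mul_nonneg (by linarith) (wt_pos k).le, ?_⟩
    have h1 := abs_le_wt k
    have h2 := one_le_wt k
    have h3 : (k : ℝ) ^ 2 ≤ wt k ^ 2 := by
      rw [← sq_abs]; exact pow_le_pow_left₀ (abs_nonneg _) h1 2
    have h4 : (1 : ℝ) ≤ wt k ^ 2 := one_le_pow₀ h2
    nlinarith [mul_le_mul_of_nonneg_left h4 (sq_nonneg c), mul_pos hc (pow_pos (wt_pos k) 2)]
  rw [kgFreq, abs_of_nonneg (mul_nonneg hc.le (Real.sqrt_nonneg _)), pow_one, mul_assoc]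
  exact mul_le_mul_of_nonneg_left h hc.le

lemma kgDamp_nonneg {c : ℝ} (hc : 0 < c) (k : ℤ) : 0 ≤ kgDamp c k :=
  div_nonneg hc.le (Real.sqrt_nonneg _)

lemma kgDamp_le_one {c : ℝ} (hc : 0 < c) (k : ℤ) : kgDamp c k ≤ 1 := by
  rw [kgDamp, div_le_one (sqrt_freq_pos hc k)]
  exact Real.le_sqrt_of_sq_le (by nlinarith [sq_nonneg (k : ℝ)])

lemma multBound_kgDamp {c : ℝ} (hc : 0 < c) (h : n ≤ m) :
    MultBound m n 1 (fun k => (kgDamp c k : ℂ)) :=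
  MultBound.of_growth (q := 0) (fun k => by
    rw [Complex.norm_real, Real.norm_of_nonneg (kgDamp_nonneg hc k)]
    simpa using kgDamp_le_one hc k) (by simpa using h)

/-- The multiplier `c / √(c² - ∂ₓₓ)`. -/
def damp (m : ℕ) {c : ℝ} (hc : 0 < c) : Wiener m →L[ℝ] Wiener m :=
  mult m m (fun k => (kgDamp c k : ℂ)) (multBound_kgDamp hc le_rfl).isMult

@[simp] lemma coeff_damp {c : ℝ} (hc : 0 < c) (a : Wiener m) (k : ℤ) :
    (damp m hc a).coeff k = (kgDamp c k : ℂ) • a.coeff k := coeff_mult _ _ a k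

lemma norm_damp_le {c : ℝ} (hc : 0 < c) (a : Wiener m) : ‖damp m hc a‖ ≤ ‖a‖ :=
  (norm_mult_le _ (multBound_kgDamp hc le_rfl) a).trans_eq (one_mul _)

lemma swap_damp {c : ℝ} (hc : 0 < c) (a : Wiener m) : swap (damp m hc a) = damp m hc (swap a) :=
  swap_mult _ _ a

lemma conj_damp {c : ℝ} (hc : 0 < c) (a : Wiener m) : conj (damp m hc a) = damp m hc (conj a) :=
  conj_mult (fun k => by simp [kgDamp]) _ a

lemma incl_damp (h : n ≤ m) {c : ℝ} (hc : 0 < c) (a : Wiener m) :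
    incl h (damp m hc a) = damp n hc (incl h a) := by ext1 k; simp

/-- The nonlinear part of the first-order Klein-Gordon system. -/
def kgNonlin (m : ℕ) (lam : ℝ) {c : ℝ} (hc : 0 < c) (a : Wiener m) : Wiener m :=
  damp m hc (kgs lam a)

lemma conj_field (a : Wiener m) : conj (field a) = swap (field a) := by
  simp only [field, conj_smul, map_add, conj_swap, conj_conj, swap_smul, swap_swap]
  rw [add_comm]
  congr 1
  rw [map_div₀, map_one, map_ofNat]

lemma swap_conj_kgs (lam : ℝ) (a : Wiener m) : swap (conj (kgs lam a)) = -kgs lam a := by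
  simp only [kgs, conj_smul, map_mul, conj_swap, conj_field, swap_smul, swap_swap, map_neg,
    Complex.conj_I, Complex.conj_ofReal]
  rw [neg_neg, ← neg_smul, neg_mul, neg_neg]

end Wiener

open Wiener

variable {m : ℕ}

/-- The solution of the first-order system gives a classical solution of the Klein-Gordon
equation. -/
theorem isKleinGordonSolution_of_isMildSol {lam c T T' : ℝ} (hc : 0 < c) (hT : 0 < T)
    (hTT' : T < T') {ρ : ℝ} (hm : 7 ≤ m) {φ γ : ℝ → ℂ} {Φ Γ : Wiener m}
    (hΦ : swap (conj Φ) = Φ) (hΓ : swap (conj Γ) = Γ) (hφ : ∀ x, (ev x Φ).1 = φ x)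
    (hγ : ∀ x, (ev x Γ).1 = γ x) {y : ℝ → Wiener m} (hy0 : y 0 = Φ - Complex.I • damp m hc Γ)
    (hy : IsMildSol (kgFreq c) (kgNonlin m lam hc) T' ρ y) :
    IsKleinGordonSolution lam c T φ γ (fun t x => (ev x (field (y t))).1) := by
  have h4m : 4 ≤ m := by omega
  have h5m : 5 ≤ m := by omega
  have hgen : ∀ {p q : ℕ}, q + 1 ≤ p → IsMult p q (gen (kgFreq c)) := fun h =>
    (multBound_gen (abs_kgFreq_le hc) h).isMult
  have hsub : Set.Icc 0 T ⊆ Set.Ioo (-T') T' := fun t ht =>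
    ⟨by linarith [ht.1], by linarith [ht.2]⟩
  have hc0 : (c : ℂ) ≠ 0 := by exact_mod_cast hc.ne'
  -- the first and second time derivatives of `field (y t)`
  set ζ : ℝ → Wiener 4 := fun t => incl h4m (field (y t)) with hζ
  set η : ℝ → Wiener 4 := fun t => mult 5 4 (gen (kgFreq c)) (hgen le_rfl)
    ((1 / 2 : ℂ) • (incl h5m (y t) - swap (conj (incl h5m (y t))))) with hη
  have hsq : IsMult m 4 (fun k => -((kgFreq c k : ℂ) ^ 2)) :=
    (MultBound.of_growth (q := 2) (C := (c * (1 + c)) ^ 2) (fun k => by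
      rw [norm_neg, norm_pow, Complex.norm_real, ← mul_pow]
      exact pow_le_pow_left₀ (norm_nonneg _) (by simpa using abs_kgFreq_le hc k) 2) (by omega)).isMult
  set ξ : ℝ → Wiener 4 := fun t => mult m 4 (fun k => -((kgFreq c k : ℂ) ^ 2)) hsq (field (y t))
    + ((c : ℂ) ^ 2 * lam) • incl h4m (field (y t) * field (y t) * swap (field (y t))) with hξ
  have hgc : ∀ k, (starRingEnd ℂ) (gen (kgFreq c) (-k)) = -gen (kgFreq c) k := fun k => by
    simp [gen, kgFreq]
  have dζ : ∀ t ∈ Set.Ioo (-T') T', HasDerivAt ζ (η t) t := by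
    intro t ht
    have h1 := hy.hasDerivAt (C := c * (1 + c)) (q := 1) (abs_kgFreq_le hc) h4m (by omega)
      (hgen (by omega)) ht
    have h2 := (h1.add h1.wiener_conj.wiener_swap).const_smul (1 / 2 : ℂ)
    refine (h2.congr_deriv ?_).congr_of_eventuallyEq (Filter.Eventually.of_forall fun s => ?_)
    · have e : swap (conj (kgNonlin m lam hc (y t))) = -kgNonlin m lam hc (y t) := by
        rw [kgNonlin, conj_damp, swap_damp, swap_conj_kgs, map_neg]
      simp only [map_add, ← incl_conj, ← incl_swap, e, hη, map_neg]
      ext1 k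
      simp only [coeff_smul, coeff_add, coeff_mult, coeff_conj, coeff_swap, coeff_incl, coeff_neg,
        coeff_sub, star_smul, Complex.star_def, hgc, Prod.smul_swap]
      module
    · simp only [hζ, field, incl_smul, map_add, incl_conj, incl_swap, Pi.smul_apply, Pi.add_apply]
  have dη : ∀ t ∈ Set.Ioo (-T') T', HasDerivAt η (ξ t) t := by
    intro t ht
    have h1 := hy.hasDerivAt (C := c * (1 + c)) (q := 1) (abs_kgFreq_le hc) h5m (by omega)
      (hgen (by omega)) ht
    have h2 := (h1.sub h1.wiener_conj.wiener_swap).const_smul (1 / 2 : ℂ)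
    have h3 := (mult 5 4 (gen (kgFreq c)) (hgen le_rfl)).hasFDerivAt.comp_hasDerivAt t h2
    refine h3.congr_deriv ?_
    have e : swap (conj (kgNonlin m lam hc (y t))) = -kgNonlin m lam hc (y t) := by
      rw [kgNonlin, conj_damp, swap_damp, swap_conj_kgs, map_neg]
    simp only [map_add, ← incl_conj, ← incl_swap, e, hξ, map_neg]
    ext1 k
    have hk : gen (kgFreq c) k * (kgDamp c k : ℂ) = Complex.I * (c : ℂ) ^ 2 := by
      rw [gen, mul_assoc, ← Complex.ofReal_mul, kgFreq_mul_kgDamp hc]; push_cast; ring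
    have hk2 : gen (kgFreq c) k * gen (kgFreq c) k = -((kgFreq c k : ℂ) ^ 2) := by
      rw [gen]; linear_combination (kgFreq c k : ℂ) ^ 2 * Complex.I_sq
    simp only [coeff_smul, coeff_add, coeff_mult, coeff_conj, coeff_swap, coeff_incl, coeff_neg,
      coeff_sub, star_smul, Complex.star_def, hgc, Prod.smul_swap, kgNonlin, coeff_damp, kgs,
      field, ← hk2]
    set g := ((1 / 2 : ℂ) • (y t + swap (conj (y t))) * (1 / 2 : ℂ) • (y t + swap (conj (y t))) *
      swap ((1 / 2 : ℂ) • (y t + swap (conj (y t))))).coeff k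
    have hg : gen (kgFreq c) k • ((kgDamp c k : ℂ) • (-Complex.I * (lam : ℂ)) • g)
        = ((c : ℂ) ^ 2 * lam) • g := by
      rw [smul_smul, smul_smul, hk]
      congr 1
      linear_combination (-(c : ℂ) ^ 2 * lam) * Complex.I_sq
    rw [← hg]
    module
  have cξ : ContinuousOn ξ (Set.Ioo (-T') T') := by
    have h1 : ContinuousOn y (Set.Ioo (-T') T') := hy.continuousOn.mono Set.Ioo_subset_Icc_self
    have h2 : ContinuousOn (fun t => field (y t)) (Set.Ioo (-T') T') := by
      unfold field
      exact (h1.add (continuous_swap.comp_continuousOn (continuous_conj.comp_continuousOn h1))).const_smul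
        (1 / 2 : ℂ)
    exact ((mult m 4 _ hsq).continuous.comp_continuousOn h2).add
      (((incl h4m).continuous.comp_continuousOn
        ((h2.mul h2).mul (continuous_swap.comp_continuousOn h2))).const_smul
          ((c : ℂ) ^ 2 * lam))
  have hC2 : ContDiffOn ℝ 2 ζ (Set.Ioo (-T') T') := by
    have h1 : ContDiffOn ℝ 1 η (Set.Ioo (-T') T') := by
      rw [show (1 : WithTop ℕ∞) = 0 + 1 by norm_num, contDiffOn_succ_iff_deriv_of_isOpen isOpen_Ioo]
      refine ⟨fun t ht => (dη t ht).differentiableAt.differentiableWithinAt, by simp, ?_⟩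
      exact contDiffOn_zero.2 (cξ.congr fun t ht => (dη t ht).deriv)
    rw [show (2 : WithTop ℕ∞) = 1 + 1 by norm_num, contDiffOn_succ_iff_deriv_of_isOpen isOpen_Ioo]
    exact ⟨fun t ht => (dζ t ht).differentiableAt.differentiableWithinAt, by simp,
      h1.congr fun t ht => (dζ t ht).deriv⟩
  have hz : ∀ t x, (ev x (field (y t))).1 = (ev x (ζ t)).1 := fun t x => by rw [hζ, ev_incl]
  have dz : ∀ t ∈ Set.Ioo (-T') T', ∀ x,
      HasDerivAt (fun t => (ev x (field (y t))).1) (ev x (η t)).1 t := by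
    intro t ht x
    have := (evFst (m := 4) x).hasFDerivAt.comp_hasDerivAt t (dζ t ht)
    exact this.congr_of_eventuallyEq (Filter.Eventually.of_forall fun s => hz s x)
  have dz2 : ∀ t ∈ Set.Ioo (-T') T', ∀ x, HasDerivAt (fun t => (ev x (η t)).1) (ev x (ξ t)).1 t :=
    fun t ht x => (evFst (m := 4) x).hasFDerivAt.comp_hasDerivAt t (dη t ht)
  have huniq : UniqueDiffOn ℝ (Set.Icc 0 T) := uniqueDiffOn_Icc hT
  have h0T : (0 : ℝ) ∈ Set.Icc 0 T := ⟨le_rfl, hT.le⟩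
  have dW : ∀ x, ∀ t ∈ Set.Icc 0 T,
      derivWithin (fun t => (ev x (field (y t))).1) (Set.Icc 0 T) t = (ev x (η t)).1 :=
    fun x t ht => (dz t (hsub ht) x).hasDerivWithinAt.derivWithin (huniq t ht)
  refine ⟨fun t _ x => by simp only [ev_periodic], ?_, fun x => ?_, fun x => ?_, fun t ht x => ?_⟩
  · refine ((contDiffOn_ev (by norm_num) hC2).mono
      (Set.prod_mono hsub subset_rfl)).congr fun p _ => hz p.1 p.2
  · have : field (y 0) = Φ := by
      rw [hy0, field, map_sub, map_sub, hΦ, conj_smul, swap_smul, conj_damp, swap_damp, hΓ,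
        Complex.conj_I]
      module
    simp only [this, hφ]
  · rw [dW x 0 h0T, ← hγ x]
    have : η 0 = ((c : ℂ) ^ 2) • incl h4m Γ := by
      simp only [hη, hy0, ← incl_conj, ← incl_swap]
      simp only [map_sub, hΦ, conj_smul, swap_smul, conj_damp, swap_damp, hΓ, Complex.conj_I]
      ext1 k
      have hk : gen (kgFreq c) k * (kgDamp c k : ℂ) = Complex.I * (c : ℂ) ^ 2 := by
        rw [gen, mul_assoc, ← Complex.ofReal_mul, kgFreq_mul_kgDamp hc]; push_cast; ring
      simp only [coeff_mult, coeff_smul, coeff_sub, coeff_incl, coeff_damp]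
      have e : gen (kgFreq c) k • (1 / 2 : ℂ) • (Φ.coeff k
          - Complex.I • (kgDamp c k : ℂ) • Γ.coeff k
          - (Φ.coeff k - -Complex.I • (kgDamp c k : ℂ) • Γ.coeff k))
          = (-Complex.I * (gen (kgFreq c) k * (kgDamp c k : ℂ))) • Γ.coeff k := by module
      rw [e, hk]
      congr 1
      linear_combination (-(c : ℂ) ^ 2) * Complex.I_sq
    rw [this, map_smul, ev_incl]; rfl
  · have e1 : iteratedDerivWithin 2 (fun r => (ev x (field (y r))).1) (Set.Icc 0 T) t
        = (ev x (ξ t)).1 := by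
      rw [iteratedDerivWithin_succ]
      have : Set.EqOn (iteratedDerivWithin 1 (fun r => (ev x (field (y r))).1) (Set.Icc 0 T))
          (fun t => (ev x (η t)).1) (Set.Icc 0 T) := fun s hs => by
        rw [iteratedDerivWithin_one]; exact dW x s hs
      rw [derivWithin_congr this (this ht)]
      exact (dz2 t (hsub ht) x).hasDerivWithinAt.derivWithin (huniq t ht)
    have e2 := iteratedDeriv_two_ev (n := 0) h4m (field (y t)) x
    rw [e1, e2]
    have hstar : (ev x (field (y t))).2 = (starRingEnd ℂ) (ev x (field (y t))).1 := by
      have h1 := congrArg (fun a => (ev x a).1) (conj_field (y t))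
      simp only [ev_conj, ev_swap] at h1
      exact h1.symm
    have e3 : (1 / (c : ℂ) ^ 2) • incl (Nat.zero_le 4) (ξ t)
        - mult m 0 (fun k => -((k : ℂ) ^ 2)) (isMult_dx_sq (by omega)) (field (y t))
        + ((c : ℂ) ^ 2) • incl (Nat.zero_le m) (field (y t))
        = (lam : ℂ) • incl (Nat.zero_le m) (field (y t) * field (y t) * swap (field (y t))) := by
      ext1 k
      have hk : (kgFreq c k : ℂ) ^ 2 = (c : ℂ) ^ 2 * ((k : ℂ) ^ 2 + (c : ℂ) ^ 2) := by
        exact_mod_cast kgFreq_sq c k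
      simp only [hξ, coeff_add, coeff_sub, coeff_smul, coeff_incl, coeff_mult]
      rw [hk]
      match_scalars
      · field_simp
        ring
      · field_simp
    have e4 := congrArg (fun a => (ev x a).1) e3
    simp only [map_add, map_sub, map_smul, ev_incl, map_mul, ev_swap, Prod.fst_add, Prod.fst_sub,
      Prod.smul_fst, Prod.fst_mul, Prod.fst_swap, hstar, smul_eq_mul] at e4
    rw [e4, ← Complex.mul_conj']
    ring

/-! ### Uniqueness of classical solutions -/

/-- The right-hand side of the equation in the form `z_tt - c² z_xx = kgForce z`. -/
def kgForce (lam c : ℝ) (w : ℂ) : ℂ := (c : ℂ) ^ 2 * ((lam : ℂ) * (‖w‖ : ℂ) ^ 2 * w - (c : ℂ) ^ 2 * w)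

/-- The space-time strip `[0, T] × ℝ`. -/
def strip (T : ℝ) : Set (ℝ × ℝ) := Set.Icc (0 : ℝ) T ×ˢ Set.univ

lemma uniqueDiffOn_strip {T : ℝ} (hT : 0 < T) : UniqueDiffOn ℝ (strip T) :=
  (uniqueDiffOn_Icc hT).prod uniqueDiffOn_univ

lemma mem_closure_interior_strip {T : ℝ} (hT : 0 < T) {p : ℝ × ℝ} (hp : p ∈ strip T) :
    p ∈ closure (interior (strip T)) := by
  rw [strip, interior_prod_eq, closure_prod_eq, interior_Icc, closure_Ioo hT.ne, interior_univ,
    closure_univ]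
  exact hp

/-- The derivative of a function on the strip in the direction `(1, -v)`. -/
def dirDeriv (T : ℝ) (z : ℝ → ℝ → ℂ) (v : ℝ) (p : ℝ × ℝ) : ℂ :=
  fderivWithin ℝ (fun p : ℝ × ℝ => z p.1 p.2) (strip T) p (1, -v)

section C2

variable {T : ℝ} {z : ℝ → ℝ → ℂ}

lemma hasDerivWithinAt_time {F : Type*} [NormedAddCommGroup F] [NormedSpace ℝ F] {f : ℝ × ℝ → F}
    {f' : ℝ × ℝ →L[ℝ] F} {v x t : ℝ} (hf : HasFDerivWithinAt f f' (strip T) (t, x + v * t)) :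
    HasDerivWithinAt (fun s => f (s, x + v * s)) (f' (1, v)) (Set.Icc 0 T) t := by
  have h1 : HasDerivWithinAt (fun s : ℝ => ((s, x + v * s) : ℝ × ℝ)) (1, v) (Set.Icc 0 T) t := by
    have := ((hasDerivAt_id t).prodMk (((hasDerivAt_id t).const_mul v).const_add x)).hasDerivWithinAt
      (s := Set.Icc 0 T)
    simpa using this
  exact hf.comp_hasDerivWithinAt t h1 fun s hs => Set.mk_mem_prod hs (Set.mem_univ _)

lemma hasDerivAt_space {F : Type*} [NormedAddCommGroup F] [NormedSpace ℝ F] {f : ℝ × ℝ → F}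
    {f' : ℝ × ℝ →L[ℝ] F} {x t : ℝ} (ht : t ∈ Set.Icc 0 T)
    (hf : HasFDerivWithinAt f f' (strip T) (t, x)) :
    HasDerivAt (fun y => f (t, y)) (f' (0, 1)) x := by
  rw [← hasDerivWithinAt_univ]
  have h1 : HasDerivWithinAt (fun y : ℝ => ((t, y) : ℝ × ℝ)) (0, 1) Set.univ x :=
    ((hasDerivAt_const x t).prodMk (hasDerivAt_id x)).hasDerivWithinAt
  exact hf.comp_hasDerivWithinAt x h1 fun s _ => Set.mk_mem_prod ht (Set.mem_univ _)

lemma hasFDerivWithinAt_strip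
    (hz : ContDiffOn ℝ 2 (fun p : ℝ × ℝ => z p.1 p.2) (strip T)) {p : ℝ × ℝ} (hp : p ∈ strip T) :
    HasFDerivWithinAt (fun p : ℝ × ℝ => z p.1 p.2)
      (fderivWithin ℝ (fun p : ℝ × ℝ => z p.1 p.2) (strip T) p) (strip T) p :=
  (hz.differentiableOn (by norm_num) p hp).hasFDerivWithinAt

lemma hasFDerivWithinAt_strip_two
    (hz : ContDiffOn ℝ 2 (fun p : ℝ × ℝ => z p.1 p.2) (strip T))
    (hT : 0 < T) {p : ℝ × ℝ} (hp : p ∈ strip T) :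
    HasFDerivWithinAt (fderivWithin ℝ (fun p : ℝ × ℝ => z p.1 p.2) (strip T))
      (fderivWithin ℝ (fderivWithin ℝ (fun p : ℝ × ℝ => z p.1 p.2) (strip T)) (strip T) p)
      (strip T) p :=
  (((hz.fderivWithin (m := 1) (uniqueDiffOn_strip hT) (by norm_num)).differentiableOn
    (by norm_num)) p hp).hasFDerivWithinAt

lemma derivWithin_time
    (hz : ContDiffOn ℝ 2 (fun p : ℝ × ℝ => z p.1 p.2) (strip T))
    (hT : 0 < T) {t x : ℝ} (ht : t ∈ Set.Icc 0 T) :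
    derivWithin (fun s => z s x) (Set.Icc 0 T) t
      = fderivWithin ℝ (fun p : ℝ × ℝ => z p.1 p.2) (strip T) (t, x) (1, 0) := by
  have h := hasDerivWithinAt_time (v := 0) (x := x) (t := t)
    (by simpa using hasFDerivWithinAt_strip hz (p := (t, x)) ⟨ht, Set.mem_univ _⟩)
  simp only [zero_mul, add_zero] at h
  exact h.derivWithin (uniqueDiffOn_Icc hT t ht)

lemma deriv_space
    (hz : ContDiffOn ℝ 2 (fun p : ℝ × ℝ => z p.1 p.2) (strip T)) {t x : ℝ} (ht : t ∈ Set.Icc 0 T) :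
    deriv (z t) x = fderivWithin ℝ (fun p : ℝ × ℝ => z p.1 p.2) (strip T) (t, x) (0, 1) :=
  (hasDerivAt_space ht (hasFDerivWithinAt_strip hz (p := (t, x)) ⟨ht, Set.mem_univ _⟩)).deriv

lemma iteratedDerivWithin_time
    (hz : ContDiffOn ℝ 2 (fun p : ℝ × ℝ => z p.1 p.2) (strip T))
    (hT : 0 < T) {t x : ℝ} (ht : t ∈ Set.Icc 0 T) :
    iteratedDerivWithin 2 (fun s => z s x) (Set.Icc 0 T) t
      = fderivWithin ℝ (fderivWithin ℝ (fun p : ℝ × ℝ => z p.1 p.2) (strip T)) (strip T) (t, x)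
          (1, 0) (1, 0) := by
  rw [iteratedDerivWithin_succ]
  have h1 : Set.EqOn (iteratedDerivWithin 1 (fun s => z s x) (Set.Icc 0 T))
      (fun s => fderivWithin ℝ (fun p : ℝ × ℝ => z p.1 p.2) (strip T) (s, x) (1, 0))
      (Set.Icc 0 T) := fun s hs => by
    rw [iteratedDerivWithin_one]; exact derivWithin_time hz hT hs
  rw [derivWithin_congr h1 (h1 ht)]
  have h := hasDerivWithinAt_time (v := 0) (x := x) (t := t)
    (by simpa using hasFDerivWithinAt_strip_two hz hT (p := (t, x)) ⟨ht, Set.mem_univ _⟩)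
  simp only [zero_mul, add_zero] at h
  have h2 := h.clm_apply (hasDerivWithinAt_const t (Set.Icc 0 T) ((1, 0) : ℝ × ℝ))
  rw [map_zero, add_zero] at h2
  exact h2.derivWithin (uniqueDiffOn_Icc hT t ht)

lemma iteratedDeriv_space
    (hz : ContDiffOn ℝ 2 (fun p : ℝ × ℝ => z p.1 p.2) (strip T))
    (hT : 0 < T) {t x : ℝ} (ht : t ∈ Set.Icc 0 T) :
    iteratedDeriv 2 (z t) x
      = fderivWithin ℝ (fderivWithin ℝ (fun p : ℝ × ℝ => z p.1 p.2) (strip T)) (strip T) (t, x)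
          (0, 1) (0, 1) := by
  rw [iteratedDeriv_succ, iteratedDeriv_one, show deriv (z t) = _ from funext fun x => deriv_space hz ht]
  have h := hasDerivAt_space ht
    (hasFDerivWithinAt_strip_two hz hT (p := (t, x)) ⟨ht, Set.mem_univ _⟩)
  have h2 := h.clm_apply (hasDerivAt_const x ((0, 1) : ℝ × ℝ))
  rw [map_zero, add_zero] at h2
  exact h2.deriv

/-- Along the characteristic of speed `v` the derivative of `z_t - v z_x` is `z_tt - v² z_xx`. -/
lemma hasDerivWithinAt_dirDeriv
    (hz : ContDiffOn ℝ 2 (fun p : ℝ × ℝ => z p.1 p.2) (strip T))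
    (hT : 0 < T) {v x t : ℝ} (ht : t ∈ Set.Icc 0 T) :
    HasDerivWithinAt (fun s => dirDeriv T z v (s, x + v * s))
      (iteratedDerivWithin 2 (fun s => z s (x + v * t)) (Set.Icc 0 T) t
        - (v : ℂ) ^ 2 * iteratedDeriv 2 (z t) (x + v * t)) (Set.Icc 0 T) t := by
  have hp : ((t, x + v * t) : ℝ × ℝ) ∈ strip T := ⟨ht, Set.mem_univ _⟩
  have h := hasDerivWithinAt_time (v := v) (x := x) (t := t) (hasFDerivWithinAt_strip_two hz hT hp)
  have h2 := h.clm_apply (hasDerivWithinAt_const t (Set.Icc 0 T) ((1, -v) : ℝ × ℝ))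
  rw [map_zero, add_zero] at h2
  refine h2.congr_deriv ?_
  rw [iteratedDerivWithin_time hz hT ht, iteratedDeriv_space hz hT ht]
  have hsymm := (hz _ hp).isSymmSndFDerivWithinAt (by simp) (uniqueDiffOn_strip hT)
    (mem_closure_interior_strip hT hp) hp (1, 0) (0, 1)
  set D := fderivWithin ℝ (fderivWithin ℝ (fun p : ℝ × ℝ => z p.1 p.2) (strip T)) (strip T)
    (t, x + v * t)
  have e1 : ((1, v) : ℝ × ℝ) = (1, 0) + v • (0, 1) := by simp
  have e2 : ((1, -v) : ℝ × ℝ) = (1, 0) - v • (0, 1) := by simp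
  rw [e1, e2]
  simp only [map_add, map_sub, map_smul, add_apply, smul_apply, hsymm, Complex.real_smul]
  ring

end C2

/-- The force is Lipschitz on bounded sets. -/
lemma norm_kgForce_sub_le (lam c : ℝ) {r : ℝ} {w w' : ℂ} (hw : ‖w‖ ≤ r) (hw' : ‖w'‖ ≤ r) :
    ‖kgForce lam c w - kgForce lam c w'‖
      ≤ c ^ 2 * (|lam| * (3 * r ^ 2) + c ^ 2) * ‖w - w'‖ := by
  have e : kgForce lam c w - kgForce lam c w' = (c : ℂ) ^ 2 * ((lam : ℂ) *
      (w * w * (starRingEnd ℂ) w - w' * w' * (starRingEnd ℂ) w') - (c : ℂ) ^ 2 * (w - w')) := by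
    unfold kgForce
    rw [← Complex.mul_conj', ← Complex.mul_conj']
    ring
  have h1 := Wiener.norm_mul_sub_mul_le (a := w) (a' := w') (b := w) (b' := w') hw hw'
  have h2 := Wiener.norm_mul_sub_mul_le (a := w * w) (a' := w' * w') (b := (starRingEnd ℂ) w)
    (b' := (starRingEnd ℂ) w') (ρ' := r) (by rwa [Complex.norm_conj]) (Wiener.norm_mul_le_sq hw' hw')
  rw [← map_sub, Complex.norm_conj] at h2
  have hr : 0 ≤ r := (norm_nonneg _).trans hw
  have h3 : ‖w * w * (starRingEnd ℂ) w - w' * w' * (starRingEnd ℂ) w'‖ ≤ 3 * r ^ 2 * ‖w - w'‖ :=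
    h2.trans (by nlinarith [mul_le_mul_of_nonneg_left h1 hr])
  have hc : ‖(c : ℂ) ^ 2‖ = c ^ 2 := by
    rw [norm_pow, Complex.norm_real, Real.norm_eq_abs, sq_abs]
  rw [e, norm_mul, hc]
  calc _ ≤ c ^ 2 * (|lam| * (3 * r ^ 2 * ‖w - w'‖) + c ^ 2 * ‖w - w'‖) := by
        refine mul_le_mul_of_nonneg_left ((norm_sub_le _ _).trans (add_le_add ?_ ?_)) (sq_nonneg c)
        · rw [norm_mul, Complex.norm_real, Real.norm_eq_abs]
          exact mul_le_mul_of_nonneg_left h3 (abs_nonneg _)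
        · rw [norm_mul, hc]
    _ = _ := by ring

namespace IsKleinGordonSolution

variable {lam c T : ℝ} {φ γ : ℝ → ℂ} {z z' : ℝ → ℝ → ℂ}

lemma exists_bound (hz : IsKleinGordonSolution lam c T φ γ z) :
    ∃ r, ∀ t ∈ Set.Icc (0 : ℝ) T, ∀ x, ‖z t x‖ ≤ r := by
  have hK : IsCompact (Set.Icc (0 : ℝ) T ×ˢ Set.Icc 0 (2 * Real.pi)) := isCompact_Icc.prod isCompact_Icc
  obtain ⟨r, hr⟩ := hK.exists_bound_of_continuousOn
    (hz.contDiffOn.continuousOn.mono (Set.prod_mono subset_rfl (Set.subset_univ _)))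
  refine ⟨r, fun t ht x => ?_⟩
  obtain ⟨y, hy, hxy⟩ := (hz.periodic t ht).exists_mem_Ico₀ Real.two_pi_pos x
  rw [hxy]
  exact hr (t, y) ⟨ht, Set.Ico_subset_Icc_self hy⟩

lemma hasDerivWithinAt_char (hz : IsKleinGordonSolution lam c T φ γ z) (hc : c ≠ 0) (hT : 0 < T)
    {v x t : ℝ} (hv : v ^ 2 = c ^ 2) (ht : t ∈ Set.Icc 0 T) :
    HasDerivWithinAt (fun s => dirDeriv T z v (s, x + v * s)) (kgForce lam c (z t (x + v * t)))
      (Set.Icc 0 T) t := by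
  refine (hasDerivWithinAt_dirDeriv hz.contDiffOn hT ht).congr_deriv ?_
  have h := hz.equation t ht (x + v * t)
  have hv' : (v : ℂ) ^ 2 = (c : ℂ) ^ 2 := by exact_mod_cast hv
  have hc' : (c : ℂ) ≠ 0 := by exact_mod_cast hc
  rw [hv', kgForce, ← h]
  field_simp
  ring

lemma hasDerivWithinAt_time (hz : IsKleinGordonSolution lam c T φ γ z)
    {x t : ℝ} (ht : t ∈ Set.Icc 0 T) :
    HasDerivWithinAt (fun s => z s x)
      (1 / 2 * (dirDeriv T z c (t, x) + dirDeriv T z (-c) (t, x))) (Set.Icc 0 T) t := by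
  have h := KGStrang.hasDerivWithinAt_time (v := 0) (x := x) (t := t)
    (by simpa using hasFDerivWithinAt_strip hz.contDiffOn (p := (t, x)) ⟨ht, Set.mem_univ _⟩)
  simp only [zero_mul, add_zero] at h
  refine h.congr_deriv ?_
  unfold dirDeriv
  rw [← map_add]
  have : ((1, -c) : ℝ × ℝ) + (1, - -c) = (2 : ℝ) • (1, 0) := by ext <;> norm_num
  rw [this, map_smul, Complex.real_smul]
  push_cast
  ring

lemma dirDeriv_zero (hz : IsKleinGordonSolution lam c T φ γ z) (hT : 0 < T) (v x : ℝ) :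
    dirDeriv T z v (0, x) = (c : ℂ) ^ 2 * γ x - v * deriv φ x := by
  have h0 : (0 : ℝ) ∈ Set.Icc 0 T := ⟨le_rfl, hT.le⟩
  have e : ((1, -v) : ℝ × ℝ) = (1, 0) - v • (0, 1) := by simp
  rw [dirDeriv, e, map_sub, map_smul, ← derivWithin_time hz.contDiffOn hT h0,
    ← deriv_space hz.contDiffOn h0, hz.init_deriv, funext hz.init, Complex.real_smul]

/-- Comparison of two functions on `[0, T]` whose derivatives differ by at most `A e^{μt}`. -/
lemma norm_sub_le_of_deriv {f g f' g' : ℝ → ℂ} {A μ : ℝ} (hA : 0 ≤ A) (hμ : 0 < μ)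
    (hf : ∀ t ∈ Set.Icc 0 T, HasDerivWithinAt f (f' t) (Set.Icc 0 T) t)
    (hg : ∀ t ∈ Set.Icc 0 T, HasDerivWithinAt g (g' t) (Set.Icc 0 T) t)
    (h0 : f 0 = g 0) (hb : ∀ t ∈ Set.Icc 0 T, ‖f' t - g' t‖ ≤ A * Real.exp (μ * t)) :
    ∀ t ∈ Set.Icc 0 T, ‖f t - g t‖ ≤ A / μ * Real.exp (μ * t) := by
  have hd : ∀ t ∈ Set.Icc 0 T, HasDerivWithinAt (fun t => f t - g t) (f' t - g' t)
      (Set.Icc 0 T) t := fun t ht => (hf t ht).sub (hg t ht)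
  refine image_norm_le_of_norm_deriv_right_le_deriv_boundary
    (f' := fun t => f' t - g' t) (B := fun t => A / μ * Real.exp (μ * t))
    (B' := fun t => A * Real.exp (μ * t)) (fun t ht => (hd t ht).continuousWithinAt)
    (fun t ht => ?_) ?_ (fun t => ?_) fun t ht => hb t (Set.Ico_subset_Icc_self ht)
  · exact (hd t (Set.Ico_subset_Icc_self ht)).mono_of_mem_nhdsWithin
      (Filter.mem_of_superset (Icc_mem_nhdsGE ht.2) (Set.Icc_subset_Icc_left ht.1))
  · simp only [h0, sub_self, norm_zero]; positivity
  · have := ((((hasDerivAt_id t).const_mul μ).exp).const_mul (A / μ))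
    refine this.congr_deriv ?_
    field_simp
    simp

/-- Classical solutions are unique: an exponentially weighted bound on the difference of two
solutions improves by a factor of two when it is propagated along the characteristics. -/
theorem unique (hz : IsKleinGordonSolution lam c T φ γ z)
    (hz' : IsKleinGordonSolution lam c T φ γ z') (hc : c ≠ 0) (hT : 0 < T) :
    ∀ t ∈ Set.Icc (0 : ℝ) T, ∀ x, z' t x = z t x := by
  obtain ⟨r₁, hr₁⟩ := hz.exists_bound
  obtain ⟨r₂, hr₂⟩ := hz'.exists_bound
  set r := max r₁ r₂
  have hr : ∀ t ∈ Set.Icc (0 : ℝ) T, ∀ x, ‖z t x‖ ≤ r := fun t ht x =>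
    (hr₁ t ht x).trans (le_max_left _ _)
  have hr' : ∀ t ∈ Set.Icc (0 : ℝ) T, ∀ x, ‖z' t x‖ ≤ r := fun t ht x =>
    (hr₂ t ht x).trans (le_max_right _ _)
  have hr0 : 0 ≤ r := (norm_nonneg _).trans (hr 0 ⟨le_rfl, hT.le⟩ 0)
  set L := c ^ 2 * (|lam| * (3 * r ^ 2) + c ^ 2) with hL
  have hLpos : 0 < L := by positivity
  set μ := Real.sqrt (2 * L) with hμ
  have hμpos : 0 < μ := Real.sqrt_pos.2 (by positivity)
  have hμsq : μ * μ = 2 * L := Real.mul_self_sqrt (by positivity)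
  have step : ∀ M : ℝ, 0 ≤ M →
      (∀ t ∈ Set.Icc (0 : ℝ) T, ∀ x, ‖z' t x - z t x‖ ≤ M * Real.exp (μ * t)) →
      ∀ t ∈ Set.Icc (0 : ℝ) T, ∀ x, ‖z' t x - z t x‖ ≤ M / 2 * Real.exp (μ * t) := by
    intro M hM hbd
    have hdir : ∀ v : ℝ, v ^ 2 = c ^ 2 → ∀ t ∈ Set.Icc (0 : ℝ) T, ∀ x,
        ‖dirDeriv T z' v (t, x) - dirDeriv T z v (t, x)‖ ≤ L * M / μ * Real.exp (μ * t) := by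
      intro v hv t ht x
      have := norm_sub_le_of_deriv (A := L * M) (by positivity) hμpos
        (fun s hs => hz'.hasDerivWithinAt_char hc hT (x := x - v * t) hv hs)
        (fun s hs => hz.hasDerivWithinAt_char hc hT (x := x - v * t) hv hs)
        (by rw [mul_zero, hz.dirDeriv_zero hT, hz'.dirDeriv_zero hT])
        (fun s hs => by
          refine (norm_kgForce_sub_le lam c (hr' s hs _) (hr s hs _)).trans ?_
          rw [mul_assoc L]
          exact mul_le_mul_of_nonneg_left (hbd s hs _) hLpos.le) t ht
      simpa using this
    intro t ht x
    have := norm_sub_le_of_deriv (A := L * M / μ) (by positivity) hμpos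
      (fun s hs => hz'.hasDerivWithinAt_time (x := x) hs)
      (fun s hs => hz.hasDerivWithinAt_time (x := x) hs) (by rw [hz.init, hz'.init])
      (fun s hs => by
        have h1 := hdir c rfl s hs x
        have h2 := hdir (-c) (neg_sq c) s hs x
        have e : 1 / 2 * (dirDeriv T z' c (s, x) + dirDeriv T z' (-c) (s, x))
            - 1 / 2 * (dirDeriv T z c (s, x) + dirDeriv T z (-c) (s, x))
            = 1 / 2 * ((dirDeriv T z' c (s, x) - dirDeriv T z c (s, x))
              + (dirDeriv T z' (-c) (s, x) - dirDeriv T z (-c) (s, x))) := by ring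
        rw [e, norm_mul]
        have h3 := norm_add_le (dirDeriv T z' c (s, x) - dirDeriv T z c (s, x))
          (dirDeriv T z' (-c) (s, x) - dirDeriv T z (-c) (s, x))
        norm_num
        linarith) t ht
    refine this.trans_eq ?_
    rw [div_div, hμsq]
    field_simp
  intro t ht x
  have hall : ∀ j : ℕ, ∀ t ∈ Set.Icc (0 : ℝ) T, ∀ x,
      ‖z' t x - z t x‖ ≤ 2 * r / 2 ^ j * Real.exp (μ * t) := by
    intro j
    induction j with
    | zero =>
      intro t ht x
      have h1 : 1 ≤ Real.exp (μ * t) := Real.one_le_exp (mul_nonneg hμpos.le ht.1)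
      have h2 := norm_sub_le (z' t x) (z t x)
      have h3 := hr t ht x
      have h4 := hr' t ht x
      rw [pow_zero, div_one]
      nlinarith
    | succ j ih =>
      have := step _ (by positivity) ih
      intro t ht x
      refine (this t ht x).trans_eq ?_
      rw [pow_succ]; ring
  have hlim : Filter.Tendsto (fun j : ℕ => 2 * r / 2 ^ j * Real.exp (μ * t)) Filter.atTop
      (nhds (0 * Real.exp (μ * t))) := by
    refine Filter.Tendsto.mul_const _ ?_
    have := (tendsto_pow_atTop_nhds_zero_of_lt_one (r := (1 / 2 : ℝ)) (by norm_num)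
      (by norm_num)).const_mul (2 * r)
    rw [mul_zero] at this
    refine this.congr fun j => ?_
    rw [one_div, inv_pow]; rfl
  rw [zero_mul] at hlim
  have := ge_of_tendsto' hlim fun j => hall j t ht x
  rw [← sub_eq_zero, ← norm_le_zero_iff]
  exact this

end IsKleinGordonSolution

namespace Wiener

variable {m : ℕ}

/-! ### Fourier series of smooth periodic functions -/

instance : Fact (0 < 2 * Real.pi) := ⟨Real.two_pi_pos⟩

/-- Integration by parts in the Fourier coefficient of a periodic function. -/
lemma fourierCoeffOn_deriv {f : ℝ → ℂ} (hf : ContDiff ℝ ∞ f)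
    (hp : Function.Periodic f (2 * Real.pi)) {k : ℤ} (hk : k ≠ 0) :
    fourierCoeffOn Real.two_pi_pos (deriv f) k
      = (Complex.I * k) * fourierCoeffOn Real.two_pi_pos f k := by
  have hd : ContDiff ℝ ∞ (deriv f) := (contDiff_infty_iff_deriv.1 hf).2
  have h := fourierCoeffOn_of_hasDerivAt Real.two_pi_pos (f := f) (f' := deriv f) hk
    (fun x _ => ((hf.differentiable (by simp)) x).hasDerivAt)
    (hd.continuous.intervalIntegrable _ _)
  have h0 : f (2 * Real.pi) = f 0 := by simpa using hp 0
  rw [h0] at h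
  rw [h]
  have hk' : (k : ℂ) ≠ 0 := by exact_mod_cast hk
  have hpi : (Real.pi : ℂ) ≠ 0 := by exact_mod_cast Real.pi_ne_zero
  have hI := Complex.I_ne_zero
  push_cast
  field_simp
  ring

lemma periodic_deriv {f : ℝ → ℂ} {p : ℝ} (hp : Function.Periodic f p) :
    Function.Periodic (deriv f) p := fun x => by
  rw [← deriv_comp_add_const, hp.funext]

/-- Fourier coefficients of a smooth periodic function decay faster than any power, by repeated
integration by parts. -/
lemma exists_decay (p : ℕ) : ∀ {f : ℝ → ℂ}, ContDiff ℝ ∞ f → Function.Periodic f (2 * Real.pi) →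
    ∃ C, ∀ k : ℤ, |(k : ℝ)| ^ p * ‖fourierCoeffOn Real.two_pi_pos f k‖ ≤ C := by
  induction p with
  | zero =>
    intro f hf hp
    obtain ⟨B, hB⟩ := (isCompact_Icc (a := (0 : ℝ)) (b := 2 * Real.pi)).exists_bound_of_continuousOn
      hf.continuous.continuousOn
    refine ⟨B, fun k => ?_⟩
    rw [pow_zero, one_mul, fourierCoeffOn_eq_integral, norm_smul]
    have h1 : ‖∫ x in (0 : ℝ)..(2 * Real.pi),
        fourier (-k) (x : AddCircle (2 * Real.pi - 0)) • f x‖ ≤ B * |2 * Real.pi - 0| := by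
      refine intervalIntegral.norm_integral_le_of_norm_le_const fun x hx => ?_
      rw [Set.uIoc_of_le Real.two_pi_pos.le] at hx
      rw [norm_smul, fourier_apply, Circle.norm_coe, one_mul]
      exact hB x ⟨hx.1.le, hx.2⟩
    have h2 := Real.two_pi_pos
    rw [sub_zero, abs_of_pos h2] at h1
    rw [sub_zero, Real.norm_of_nonneg (by positivity), one_div, inv_mul_le_iff₀ h2, mul_comm _ B]
    simpa using h1
  | succ p ih =>
    intro f hf hp
    obtain ⟨C, hC⟩ := ih (contDiff_infty_iff_deriv.1 hf).2 (periodic_deriv hp)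
    refine ⟨C, fun k => ?_⟩
    have hC0 : 0 ≤ C := (mul_nonneg (pow_nonneg (abs_nonneg _) _) (norm_nonneg _)).trans (hC 0)
    rcases eq_or_ne k 0 with rfl | hk
    · simpa using hC0
    · refine le_trans (le_of_eq ?_) (hC k)
      rw [fourierCoeffOn_deriv hf hp hk, norm_mul, norm_mul, Complex.norm_I, Complex.norm_intCast,
        pow_succ]
      ring

/-- A smooth periodic function is the sum of its rapidly converging Fourier series. -/
theorem exists_fourier_series (m : ℕ) {f : ℝ → ℂ} (hf : ContDiff ℝ ∞ f)
    (hp : Function.Periodic f (2 * Real.pi)) :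
    ∃ a : ℤ → ℂ, (Summable fun k => wt k ^ m * ‖a k‖) ∧ ∀ x, HasSum (fun k => mode k x * a k) (f x) := by
  set a : ℤ → ℂ := fourierCoeffOn Real.two_pi_pos f with ha
  have hsum : Summable fun k => wt k ^ m * ‖a k‖ := by
    obtain ⟨C, hC⟩ := exists_decay (m + 2) hf hp
    have h1 : Summable fun k : ℤ => (2 ^ m * C) * (1 / (k : ℝ) ^ 2) :=
      (Real.summable_one_div_int_pow.2 (by norm_num)).mul_left _
    refine Summable.of_norm_bounded_eventually h1 ?_
    refine (Filter.eventually_cofinite_ne (0 : ℤ)).mono fun k hk => ?_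
    have hk1 : (1 : ℝ) ≤ |(k : ℝ)| := by exact_mod_cast Int.one_le_abs hk
    have hw : wt k ^ m ≤ (2 * |(k : ℝ)|) ^ m :=
      pow_le_pow_left₀ (wt_pos k).le (by unfold wt; linarith) m
    rw [Real.norm_of_nonneg (mul_nonneg (wt_pow_pos m k).le (norm_nonneg _)), mul_one_div,
      le_div_iff₀ (by rw [← sq_abs]; positivity), ← sq_abs]
    calc wt k ^ m * ‖a k‖ * |(k : ℝ)| ^ 2 ≤ (2 * |(k : ℝ)|) ^ m * ‖a k‖ * |(k : ℝ)| ^ 2 := by gcongr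
      _ = 2 ^ m * (|(k : ℝ)| ^ (m + 2) * ‖a k‖) := by rw [mul_pow]; ring
      _ ≤ 2 ^ m * C := by gcongr; exact hC k
  refine ⟨a, hsum, fun x => ?_⟩
  have hc : Continuous hp.lift := by
    refine continuous_coinduced_dom.2 ?_
    exact hf.continuous
  set F : C(AddCircle (2 * Real.pi), ℂ) := ⟨hp.lift, hc⟩
  have hFa : fourierCoeff F = a := by
    funext k
    rw [ha, fourierCoeffOn_eq_integral, fourierCoeff_eq_intervalIntegral _ k 0]
    simp only [zero_add, sub_zero]
    congr 1
    refine intervalIntegral.integral_congr fun x _ => ?_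
    simp only [fourier_coe_apply, sub_zero]
    rfl
  have h2 : Summable (fourierCoeff F) := by
    rw [hFa]
    exact Summable.of_norm (hsum.of_nonneg_of_le (fun _ => norm_nonneg _) fun k =>
      le_mul_of_one_le_left (norm_nonneg _) (one_le_pow₀ (one_le_wt k)))
  have h3 := has_pointwise_sum_fourier_series_of_summable h2 (x : AddCircle (2 * Real.pi))
  have e : F (x : AddCircle (2 * Real.pi)) = f x := rfl
  rw [e, hFa] at h3
  refine h3.congr_fun fun k => ?_
  rw [fourier_coe_apply, smul_eq_mul, mul_comm, mode]
  congr 2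
  have hpi : (Real.pi : ℂ) ≠ 0 := by exact_mod_cast Real.pi_ne_zero
  push_cast
  field_simp

/-- The pair `(f, f̄)` as an element of the Wiener algebra. -/
theorem exists_lift (m : ℕ) {f : ℝ → ℂ} (hf : ContDiff ℝ ∞ f)
    (hp : Function.Periodic f (2 * Real.pi)) :
    ∃ Φ : Wiener m, swap (conj Φ) = Φ ∧ ∀ x, ev x Φ = (f x, (starRingEnd ℂ) (f x)) := by
  obtain ⟨a, ha, hsum⟩ := exists_fourier_series m hf hp
  have ha' : Summable fun k => wt k ^ m * ‖a (-k)‖ := by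
    refine ((Equiv.neg ℤ).summable_iff.mpr ha).congr fun k => ?_
    simp [wt_neg]
  set b : ℤ → ℂ × ℂ := fun k => (a k, (starRingEnd ℂ) (a (-k))) with hb
  have hbs : Summable fun k => wt k ^ m * ‖b k‖ := by
    refine (ha.add ha').of_nonneg_of_le
      (fun k => mul_nonneg (wt_pow_pos m k).le (norm_nonneg _)) fun k => ?_
    rw [← mul_add]
    refine mul_le_mul_of_nonneg_left ?_ (wt_pow_pos m k).le
    rw [hb, Prod.norm_def, Complex.norm_conj]
    exact max_le_add_of_nonneg (norm_nonneg _) (norm_nonneg _)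
  have hsymm : swap (conj (mk b hbs)) = mk b hbs := by
    ext1 k
    rw [coeff_swap, coeff_conj, coeff_mk, coeff_mk, hb]
    ext <;> simp
  refine ⟨mk b hbs, hsymm, fun x => ?_⟩
  have h1 : (ev x (mk b hbs)).1 = f x := by
    rw [ev_eq_tsum]
    have h2 := (summable_mode x (mk b hbs)).hasSum.map (AddMonoidHom.fst ℂ ℂ) continuous_fst
    refine h2.unique ((hsum x).congr_fun fun k => ?_)
    simp [hb]
  have h2 : (ev x (mk b hbs)).2 = (starRingEnd ℂ) (ev x (mk b hbs)).1 := by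
    have := congrArg (fun a => (ev x a).2) hsymm
    simp only [ev_swap, ev_conj] at this
    exact this.symm
  rw [Prod.ext_iff]
  exact ⟨h1, by rw [h2, h1]⟩

variable {n : ℕ}

/-! ### Modulation: from Klein-Gordon to the limit system -/

/-- The frequencies `k²/2` of the limit system. -/
def schrFreq (k : ℤ) : ℝ := (k : ℝ) ^ 2 / 2

lemma sq_le_wt_sq (k : ℤ) : (k : ℝ) ^ 2 ≤ wt k ^ 2 := by
  rw [← sq_abs]; exact pow_le_pow_left₀ (abs_nonneg _) (abs_le_wt k) 2

lemma abs_schrFreq_le (k : ℤ) : |schrFreq k| ≤ 1 * wt k ^ 2 := by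
  have := sq_le_wt_sq k
  rw [schrFreq, abs_of_nonneg (by positivity)]
  nlinarith [sq_nonneg (k : ℝ)]

section symbols

variable {c : ℝ}

lemma abs_kgFreq_sub_le (hc : 0 < c) (k : ℤ) : |kgFreq c k - c ^ 2| ≤ 1 * wt k ^ 2 := by
  have hS := sqrt_freq_pos hc k
  have hS2 : Real.sqrt ((k : ℝ) ^ 2 + c ^ 2) ^ 2 = (k : ℝ) ^ 2 + c ^ 2 :=
    Real.sq_sqrt (by positivity)
  rw [kgFreq]
  set S := Real.sqrt ((k : ℝ) ^ 2 + c ^ 2)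
  have hSc : c ≤ S := Real.le_sqrt_of_sq_le (by nlinarith [sq_nonneg (k : ℝ)])
  have := sq_le_wt_sq k
  rw [abs_of_nonneg (by nlinarith)]
  nlinarith

lemma abs_schrFreq_sub_le (hc : 0 < c) (k : ℤ) :
    |schrFreq k - (kgFreq c k - c ^ 2)| ≤ (c ^ 2)⁻¹ * wt k ^ 4 := by
  have hS := sqrt_freq_pos hc k
  have hS2 : Real.sqrt ((k : ℝ) ^ 2 + c ^ 2) ^ 2 = (k : ℝ) ^ 2 + c ^ 2 :=
    Real.sq_sqrt (by positivity)
  rw [kgFreq, schrFreq]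
  set S := Real.sqrt ((k : ℝ) ^ 2 + c ^ 2)
  have hSc : c ≤ S := Real.le_sqrt_of_sq_le (by nlinarith [sq_nonneg (k : ℝ)])
  have h1 := sq_le_wt_sq k
  -- the difference equals `(S - c)² / 2`, and `(S - c) (S + c) = k²`
  have e : (k : ℝ) ^ 2 / 2 - (c * S - c ^ 2) = (S - c) ^ 2 / 2 := by nlinarith
  rw [e, abs_of_nonneg (by positivity), inv_mul_eq_div, le_div_iff₀ (by positivity)]
  have h2 : c * (S - c) ≤ (k : ℝ) ^ 2 := by nlinarith
  have h3 : (c * (S - c)) ^ 2 ≤ (wt k ^ 2) ^ 2 :=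
    pow_le_pow_left₀ (mul_nonneg hc.le (by linarith)) (h2.trans h1) 2
  nlinarith [sq_nonneg (c * (S - c))]

lemma abs_one_sub_kgDamp_le (hc : 0 < c) (k : ℤ) : |1 - kgDamp c k| ≤ (c ^ 2)⁻¹ * wt k ^ 2 := by
  have hS := sqrt_freq_pos hc k
  have hS2 : Real.sqrt ((k : ℝ) ^ 2 + c ^ 2) ^ 2 = (k : ℝ) ^ 2 + c ^ 2 :=
    Real.sq_sqrt (by positivity)
  have h0 := kgDamp_le_one hc k
  rw [abs_of_nonneg (by linarith), inv_mul_eq_div, le_div_iff₀ (by positivity), kgDamp]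
  set S := Real.sqrt ((k : ℝ) ^ 2 + c ^ 2)
  have hSc : c ≤ S := Real.le_sqrt_of_sq_le (by nlinarith [sq_nonneg (k : ℝ)])
  have h1 := sq_le_wt_sq k
  have e : (1 - c / S) * c ^ 2 = (S - c) * c * (c / S) := by field_simp
  have h3 : c / S ≤ 1 := (div_le_one hS).2 hSc
  have h4 : 0 ≤ (S - c) * c := mul_nonneg (by linarith) hc.le
  rw [e]
  nlinarith

end symbols

/-- The scalar oscillation `e^{iνt}`. -/
def osc (ν t : ℝ) : ℂ := Complex.exp (Complex.I * ν * t)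

@[simp] lemma norm_osc (ν t : ℝ) : ‖osc ν t‖ = 1 := by
  have : Complex.I * (ν : ℂ) * (t : ℂ) = ((ν * t : ℝ) : ℂ) * Complex.I := by push_cast; ring
  rw [osc, this]; exact Complex.norm_exp_ofReal_mul_I _

lemma osc_add (ν ν' t : ℝ) : osc (ν + ν') t = osc ν t * osc ν' t := by
  rw [osc, osc, osc, ← Complex.exp_add]; congr 1; push_cast; ring

lemma osc_zero (t : ℝ) : osc 0 t = 1 := by simp [osc]

lemma conj_osc (ν t : ℝ) : (starRingEnd ℂ) (osc ν t) = osc (-ν) t := by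
  rw [osc, osc, ← Complex.exp_conj]; congr 1; simp

lemma osc_mul_osc_neg (ν t : ℝ) : osc ν t * osc (-ν) t = 1 := by
  rw [← osc_add, add_neg_cancel, osc_zero]

lemma hasDerivAt_osc (ν t : ℝ) : HasDerivAt (osc ν) (Complex.I * ν * osc ν t) t := by
  have h := ((Complex.ofRealCLM.hasDerivAt (x := t)).const_mul (Complex.I * ν)).cexp
  refine h.congr_deriv ?_
  simp [osc, mul_comm]

/-- The part of the Klein-Gordon nonlinearity, evaluated at `e^{ic²t} w`, that still oscillates
after multiplication by `e^{-ic²t}`. -/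
def oscForce (lam c t : ℝ) (w : Wiener m) : Wiener m :=
  (-Complex.I * ((lam / 8 : ℝ) : ℂ)) • (osc (2 * c ^ 2) t • (w * w * swap w)
    + osc (-(2 * c ^ 2)) t • ((2 : ℂ) • (w * conj w * swap (conj w))
      + swap w * swap (conj w) * swap (conj w))
    + osc (-(4 * c ^ 2)) t • (swap (conj w) * swap (conj w) * conj w))

/-- A time primitive of `c² oscForce`, up to bounded terms. -/
def corrector (lam c t : ℝ) (w : Wiener m) : Wiener m :=
  ((-(lam / 16) : ℝ) : ℂ) • (osc (2 * c ^ 2) t • (w * w * swap w)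
    - osc (-(2 * c ^ 2)) t • ((2 : ℂ) • (w * conj w * swap (conj w))
      + swap w * swap (conj w) * swap (conj w))
    - osc (-(4 * c ^ 2)) t • ((1 / 2 : ℂ) • (swap (conj w) * swap (conj w) * conj w)))

/-- The nonlinearity of the limit system is the non-oscillating part of the Klein-Gordon
nonlinearity. -/
lemma nls_add_oscForce (lam c t : ℝ) (w : Wiener m) :
    nls lam w + oscForce lam c t w = osc (-c ^ 2) t • kgs lam (osc (c ^ 2) t • w) := by
  have e2 : osc (2 * c ^ 2) t = osc (c ^ 2) t ^ 2 := by rw [two_mul, osc_add, sq (osc _ _)]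
  have e3 : osc (-(2 * c ^ 2)) t = osc (-c ^ 2) t ^ 2 := by
    rw [show -(2 * c ^ 2) = -c ^ 2 + -c ^ 2 by ring, osc_add, sq (osc _ _)]
  have e4 : osc (-(4 * c ^ 2)) t = osc (-c ^ 2) t ^ 4 := by
    rw [show -(4 * c ^ 2) = -c ^ 2 + -c ^ 2 + -c ^ 2 + -c ^ 2 by ring, osc_add, osc_add, osc_add]
    ring
  have hEF := osc_mul_osc_neg (c ^ 2) t
  rw [oscForce, e2, e3, e4]
  set e := osc (c ^ 2) t with he
  set f := osc (-c ^ 2) t with hf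
  have hconj : (starRingEnd ℂ) e = f := conj_osc _ _
  have hconj' : (starRingEnd ℂ) f = e := by rw [← hconj, Complex.conj_conj]
  have h1 : nls lam w = (-Complex.I * ((lam / 8 : ℝ) : ℂ)) •
      ((w * conj w + (2 : ℂ) • (swap w * swap (conj w))) * w) := by
    rw [nls, pot, map_mul, smul_mul_assoc, smul_smul, ← neg_smul, neg_mul]
  have h2 : kgs lam (e • w) = (-Complex.I * ((lam / 8 : ℝ) : ℂ)) •
      ((e • w + f • swap (conj w)) * (e • w + f • swap (conj w))
        * (e • swap w + f • conj w)) := by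
    rw [kgs, field]
    simp only [conj_smul, hconj, swap_smul, map_add, swap_swap]
    rw [smul_mul_smul_comm, smul_mul_smul_comm, smul_smul]
    congr 1
    push_cast
    ring
  rw [h1, h2, smul_comm f, ← smul_add]
  congr 1
  have hEF' : algebraMap ℂ (Wiener m) e * algebraMap ℂ (Wiener m) f = 1 := by
    rw [← map_mul, hEF, map_one]
  simp only [Algebra.smul_def, map_pow, map_ofNat]
  set E := algebraMap ℂ (Wiener m) e
  set F := algebraMap ℂ (Wiener m) f
  set s := swap w
  set u := conj w
  set v := swap u
  linear_combination (-(E ^ 2 * w ^ 2 * s) - (E * F + 1) * (w ^ 2 * u + 2 * w * v * s)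
    - F ^ 2 * (2 * w * v * u + v ^ 2 * s)) * hEF'

lemma norm_triple_le {ρ : ℝ} {a b d : Wiener m} (ha : ‖a‖ ≤ ρ) (hb : ‖b‖ ≤ ρ) (hd : ‖d‖ ≤ ρ) :
    ‖a * b * d‖ ≤ ρ ^ 3 :=
  (norm_mul_le_sq (norm_mul_le_sq ha hb) hd).trans_eq (by ring)

lemma norm_half_smul (a : Wiener m) : ‖(1 / 2 : ℂ) • a‖ = 1 / 2 * ‖a‖ := by
  rw [norm_smul]; norm_num

lemma norm_corrector_le {lam c t ρ : ℝ} {w : Wiener m} (hw : ‖w‖ ≤ ρ) :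
    ‖corrector lam c t w‖ ≤ |lam| * ρ ^ 3 := by
  have hρ : 0 ≤ ρ := (norm_nonneg _).trans hw
  have h1 : ‖conj w‖ ≤ ρ := by simpa using hw
  have h2 : ‖swap w‖ ≤ ρ := by simpa using hw
  have h3 : ‖swap (conj w)‖ ≤ ρ := by simpa using hw
  rw [corrector, norm_ofReal_smul, abs_neg, abs_div, abs_of_pos (by norm_num : (0 : ℝ) < 16)]
  have k1 := norm_triple_le hw hw h2
  have k2 := norm_triple_le hw h1 h3
  have k3 := norm_triple_le h2 h3 h3
  have k4 := norm_triple_le h3 h3 h1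
  have hb : ‖osc (2 * c ^ 2) t • (w * w * swap w)
    - osc (-(2 * c ^ 2)) t • ((2 : ℂ) • (w * conj w * swap (conj w))
      + swap w * swap (conj w) * swap (conj w))
    - osc (-(4 * c ^ 2)) t • ((1 / 2 : ℂ) • (swap (conj w) * swap (conj w) * conj w))‖
      ≤ 5 * ρ ^ 3 := by
    refine (norm_sub_le _ _).trans ?_
    refine (add_le_add (norm_sub_le _ _) le_rfl).trans ?_
    rw [norm_smul, norm_smul, norm_smul, norm_osc, norm_osc, norm_osc, norm_half_smul]
    have := norm_add_le ((2 : ℂ) • (w * conj w * swap (conj w)))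
      (swap w * swap (conj w) * swap (conj w))
    rw [norm_two_smul] at this
    have := pow_nonneg hρ 3
    linarith
  have := mul_le_mul_of_nonneg_left hb (abs_nonneg lam)
  have : 0 ≤ |lam| * ρ ^ 3 := by positivity
  nlinarith

lemma exists_hasDerivAt_triple {ρ ρ' t : ℝ} {a b d : ℝ → Wiener m} {a' b' d' : Wiener m}
    (ha : HasDerivAt a a' t) (hb : HasDerivAt b b' t) (hd : HasDerivAt d d' t)
    (na : ‖a t‖ ≤ ρ) (nb : ‖b t‖ ≤ ρ) (nd : ‖d t‖ ≤ ρ)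
    (na' : ‖a'‖ ≤ ρ') (nb' : ‖b'‖ ≤ ρ') (nd' : ‖d'‖ ≤ ρ') :
    ∃ D, HasDerivAt (fun t => a t * b t * d t) D t ∧ ‖D‖ ≤ 3 * ρ ^ 2 * ρ' := by
  refine ⟨_, (ha.mul hb).mul hd, ?_⟩
  have h1 := norm_mul_le_sq na' nb
  have h2 := norm_mul_le_sq na nb'
  have h3 : ‖a' * b t + a t * b'‖ ≤ ρ' * ρ + ρ * ρ' := (norm_add_le _ _).trans (add_le_add h1 h2)
  refine ((norm_add_le _ _).trans (add_le_add (norm_mul_le_sq h3 nd)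
    (norm_mul_le_sq (norm_mul_le_sq na nb) nd'))).trans_eq ?_
  ring

/-- Along a differentiable curve the corrector reproduces the oscillating forcing: its derivative
is `c²` times that forcing, up to a term bounded uniformly in `c`. -/
lemma exists_hasDerivAt_corrector {lam c ρ ρ' t : ℝ} {w : ℝ → Wiener m} {w' : Wiener m}
    (hw : HasDerivAt w w' t) (hρ : ‖w t‖ ≤ ρ) (hρ' : ‖w'‖ ≤ ρ') :
    ∃ q, HasDerivAt (fun t => corrector lam c t (w t))
      ((c ^ 2 : ℂ) • oscForce lam c t (w t) + q) t ∧ ‖q‖ ≤ |lam| * ρ ^ 2 * ρ' := by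
  have h0 : 0 ≤ ρ := (norm_nonneg _).trans hρ
  have h0' : 0 ≤ ρ' := (norm_nonneg _).trans hρ'
  have d1 := hw.wiener_conj
  have d2 := hw.wiener_swap
  have d3 := d1.wiener_swap
  have n1 : ‖conj (w t)‖ ≤ ρ := by simpa using hρ
  have n2 : ‖swap (w t)‖ ≤ ρ := by simpa using hρ
  have n3 : ‖swap (conj (w t))‖ ≤ ρ := by simpa using hρ
  have n1' : ‖conj w'‖ ≤ ρ' := by simpa using hρ'
  have n2' : ‖swap w'‖ ≤ ρ' := by simpa using hρ'
  have n3' : ‖swap (conj w')‖ ≤ ρ' := by simpa using hρ'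
  obtain ⟨D1, hD1, b1⟩ := exists_hasDerivAt_triple hw hw d2 hρ hρ n2 hρ' hρ' n2'
  obtain ⟨D2, hD2, b2⟩ := exists_hasDerivAt_triple hw d1 d3 hρ n1 n3 hρ' n1' n3'
  obtain ⟨D3, hD3, b3⟩ := exists_hasDerivAt_triple d2 d3 d3 n2 n3 n3 n2' n3' n3'
  obtain ⟨D4, hD4, b4⟩ := exists_hasDerivAt_triple d3 d3 d1 n3 n3 n1 n3' n3' n1'
  have hd := ((((hasDerivAt_osc (2 * c ^ 2) t).smul hD1).sub
    ((hasDerivAt_osc (-(2 * c ^ 2)) t).smul ((hD2.const_smul (2 : ℂ)).add hD3))).sub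
    ((hasDerivAt_osc (-(4 * c ^ 2)) t).smul (hD4.const_smul (1 / 2 : ℂ)))).const_smul
      (((-(lam / 16) : ℝ) : ℂ))
  refine ⟨((-(lam / 16) : ℝ) : ℂ) • (osc (2 * c ^ 2) t • D1
      - osc (-(2 * c ^ 2)) t • ((2 : ℂ) • D2 + D3)
      - osc (-(4 * c ^ 2)) t • ((1 / 2 : ℂ) • D4)), ?_, ?_⟩
  · refine hd.congr_deriv ?_
    simp only [oscForce, Pi.add_apply, Pi.smul_apply]
    push_cast
    module
  · rw [norm_ofReal_smul, abs_neg, abs_div, abs_of_pos (by norm_num : (0 : ℝ) < 16)]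
    have hb : ‖osc (2 * c ^ 2) t • D1 - osc (-(2 * c ^ 2)) t • ((2 : ℂ) • D2 + D3)
        - osc (-(4 * c ^ 2)) t • ((1 / 2 : ℂ) • D4)‖ ≤ 5 * (3 * ρ ^ 2 * ρ') := by
      refine (norm_sub_le _ _).trans ?_
      refine (add_le_add (norm_sub_le _ _) le_rfl).trans ?_
      rw [norm_smul, norm_smul, norm_smul, norm_osc, norm_osc, norm_osc, norm_half_smul]
      have := norm_add_le ((2 : ℂ) • D2) D3
      rw [norm_two_smul] at this
      have : 0 ≤ 3 * ρ ^ 2 * ρ' := by positivity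
      linarith
    have := mul_le_mul_of_nonneg_left hb (abs_nonneg lam)
    have : 0 ≤ |lam| * (ρ ^ 2 * ρ') := by positivity
    nlinarith

lemma gronwallBound_le {δ K ε x : ℝ} (hε : 0 ≤ ε) (hK : 1 ≤ K) (hx : 0 ≤ x) :
    gronwallBound δ K ε x ≤ (δ + ε) * Real.exp (K * x) := by
  rw [gronwallBound_of_K_ne_0 (by linarith)]
  have h1 : 1 ≤ Real.exp (K * x) := Real.one_le_exp (by positivity)
  have h2 : ε / K ≤ ε := div_le_self hε hK
  nlinarith [mul_le_mul_of_nonneg_right h2 (by linarith : 0 ≤ Real.exp (K * x) - 1)]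

/-- `e^{ic²t}(w + c⁻² corrector)`, which solves the Klein-Gordon system up to `O(c⁻²)`. -/
def approx (lam c t : ℝ) (w : Wiener m) : Wiener m :=
  osc (c ^ 2) t • (w + ((c ^ 2)⁻¹ : ℂ) • corrector lam c t w)

lemma norm_inv_sq (c : ℝ) : ‖((c ^ 2)⁻¹ : ℂ)‖ = (c ^ 2)⁻¹ := by
  rw [norm_inv, norm_pow, Complex.norm_real, Real.norm_eq_abs, sq_abs]

lemma norm_approx_sub_le {lam c t ρ : ℝ} {w : Wiener m} (hw : ‖w‖ ≤ ρ) :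
    ‖approx lam c t w - osc (c ^ 2) t • w‖ ≤ (c ^ 2)⁻¹ * (|lam| * ρ ^ 3) := by
  have e : approx lam c t w - osc (c ^ 2) t • w
      = osc (c ^ 2) t • ((c ^ 2)⁻¹ : ℂ) • corrector lam c t w := by rw [approx]; module
  rw [e, norm_smul, norm_osc, one_mul, norm_smul, norm_inv_sq]
  exact mul_le_mul_of_nonneg_left (norm_corrector_le hw) (by positivity)

lemma norm_approx_le {lam c t ρ : ℝ} (hc : 1 ≤ c) {w : Wiener m} (hw : ‖w‖ ≤ ρ) :
    ‖approx lam c t w‖ ≤ ρ + |lam| * ρ ^ 3 := by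
  have hρ : 0 ≤ ρ := (norm_nonneg _).trans hw
  have h1 := norm_approx_sub_le (lam := lam) (c := c) (t := t) hw
  have h2 : ‖osc (c ^ 2) t • w‖ ≤ ρ := by rw [norm_smul, norm_osc, one_mul]; exact hw
  have h3 : (c ^ 2)⁻¹ ≤ 1 := inv_le_one_of_one_le₀ (one_le_pow₀ hc)
  have h4 := norm_add_le (approx lam c t w - osc (c ^ 2) t • w) (osc (c ^ 2) t • w)
  rw [sub_add_cancel] at h4
  have : 0 ≤ |lam| * ρ ^ 3 := by positivity
  nlinarith

lemma isMult_kgFreq {c : ℝ} (hc : 0 < c) (h : n + 1 ≤ m) : IsMult m n (gen (kgFreq c)) :=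
  (multBound_gen (abs_kgFreq_le hc) h).isMult

lemma isMult_schrFreq (h : n + 2 ≤ m) : IsMult m n (gen schrFreq) :=
  (multBound_gen abs_schrFreq_le h).isMult

lemma norm_kgNonlin_sub_le {lam c ρ : ℝ} (hc : 0 < c) {a b : Wiener m} (ha : ‖a‖ ≤ ρ)
    (hb : ‖b‖ ≤ ρ) :
    ‖kgNonlin m lam hc a - kgNonlin m lam hc b‖ ≤ 3 * |lam| * ρ ^ 2 * ‖a - b‖ := by
  rw [kgNonlin, kgNonlin, ← map_sub]
  exact (norm_damp_le _ _).trans (norm_kgs_sub_le ha hb)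

lemma norm_sub_damp_le {c : ℝ} (hc : 0 < c) (h : 2 ≤ m) (a : Wiener m) :
    ‖incl (Nat.zero_le m) (a - damp m hc a)‖ ≤ (c ^ 2)⁻¹ * ‖a‖ := by
  have hb : MultBound m 0 (c ^ 2)⁻¹ (fun k => ((1 - kgDamp c k : ℝ) : ℂ)) :=
    MultBound.of_growth (q := 2) (fun k => by
      rw [Complex.norm_real]; exact abs_one_sub_kgDamp_le hc k) (by simpa using h)
  refine le_trans (le_of_eq ?_) (norm_mult_le hb.isMult hb a)
  congr 1
  ext1 k
  simp [sub_smul]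

/-- The approximate solution satisfies the Klein-Gordon system up to a residual of size `c⁻²`. -/
lemma exists_residual {lam c T ρ t : ℝ} (hc : 1 ≤ c) (hc0 : 0 < c) (hm : 6 ≤ m) {w : ℝ → Wiener m}
    (hw : IsMildSol schrFreq (nls lam) T ρ w) (ht : t ∈ Set.Ioo (-T) T) {x : ℝ → Wiener 2}
    (hx : ∀ t, x t = approx lam c t (incl (by omega) (w t))) :
    ∃ D : Wiener 2, HasDerivAt x D t ∧
      ‖incl (Nat.zero_le 2) D - mult 2 0 (gen (kgFreq c)) (isMult_kgFreq hc0 (by omega)) (x t)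
        - kgNonlin 0 lam hc0 (incl (Nat.zero_le 2) (x t))‖ ≤ (c ^ 2)⁻¹ *
      (ρ + |lam| * ρ ^ 3 + |lam| * ρ ^ 2 * (ρ + 3 * |lam| * ρ ^ 3) + 3 * |lam| * ρ ^ 3
        + 3 * |lam| * (ρ + |lam| * ρ ^ 3) ^ 2 * (|lam| * ρ ^ 3)) := by
  have h2m : 2 ≤ m := by omega
  have hc1 : (c : ℂ) ≠ 0 := by exact_mod_cast hc0.ne'
  have hcpos : 0 ≤ (c ^ 2)⁻¹ := by positivity
  have hwt : ‖w t‖ ≤ ρ := hw.norm_le t (Set.Ioo_subset_Icc_self ht)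
  have hρ : 0 ≤ ρ := (norm_nonneg _).trans hwt
  have hlam := abs_nonneg lam
  set v : Wiener 2 := incl h2m (w t) with hv
  have hvρ : ‖v‖ ≤ ρ := (norm_incl_le _ _).trans hwt
  have hgs : IsMult m 2 (gen schrFreq) := isMult_schrFreq (by omega)
  have dw := hw.hasDerivAt abs_schrFreq_le h2m (by omega) hgs ht
  rw [incl_nls, ← hv] at dw
  set w' : Wiener 2 := mult m 2 (gen schrFreq) hgs (w t) + nls lam v with hw'
  have hw'ρ : ‖w'‖ ≤ ρ + 3 * |lam| * ρ ^ 3 := by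
    refine (norm_add_le _ _).trans (add_le_add ?_ (norm_nls_le hvρ))
    exact (norm_mult_le hgs (multBound_gen abs_schrFreq_le (by omega)) _).trans
      (by rw [one_mul]; exact hwt)
  obtain ⟨q, dr, hq⟩ := exists_hasDerivAt_corrector (lam := lam) (c := c) dw hvρ hw'ρ
  have dx := (hasDerivAt_osc (c ^ 2) t).smul (dw.add (dr.const_smul (((c ^ 2)⁻¹ : ℂ))))
  have hxe : x = fun t => approx lam c t (incl h2m (w t)) := funext hx
  set r := corrector lam c t v with hr
  have hrρ : ‖r‖ ≤ |lam| * ρ ^ 3 := norm_corrector_le hvρ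
  have hid := nls_add_oscForce lam c t v
  set e := osc (c ^ 2) t with he
  have hef : e * osc (-c ^ 2) t = 1 := osc_mul_osc_neg _ _
  have hnorme : ‖e‖ = 1 := norm_osc _ _
  have hD1 : MultBound m 0 (c ^ 2)⁻¹
      (fun k => gen schrFreq k + Complex.I * c ^ 2 - gen (kgFreq c) k) :=
    MultBound.of_growth (q := 4) (fun k => by
      have : gen schrFreq k + Complex.I * c ^ 2 - gen (kgFreq c) k
          = Complex.I * ((schrFreq k - (kgFreq c k - c ^ 2) : ℝ) : ℂ) := by
        simp only [gen]; push_cast; ring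
      rw [this, norm_mul, Complex.norm_I, one_mul, Complex.norm_real]
      exact abs_schrFreq_sub_le hc0 k) (by omega)
  have hD2 : MultBound 2 0 1 (fun k => Complex.I * c ^ 2 - gen (kgFreq c) k) :=
    MultBound.of_growth (q := 2) (fun k => by
      have : Complex.I * c ^ 2 - gen (kgFreq c) k
          = Complex.I * ((-(kgFreq c k - c ^ 2) : ℝ) : ℂ) := by
        simp only [gen]; push_cast; ring
      rw [this, norm_mul, Complex.norm_I, one_mul, Complex.norm_real, Real.norm_eq_abs, abs_neg]
      exact abs_kgFreq_sub_le hc0 k) (by omega)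
  refine ⟨_, by rw [hxe]; exact dx, ?_⟩
  have hxt : x t = e • (v + ((c ^ 2)⁻¹ : ℂ) • r) := hx t
  -- the four contributions to the residual
  have key : incl (Nat.zero_le 2) (e • (w' + ((c ^ 2)⁻¹ : ℂ) • ((c ^ 2 : ℂ) •
        oscForce lam c t v + q)) + (Complex.I * ((c ^ 2 : ℝ) : ℂ) * e) • (v + ((c ^ 2)⁻¹ : ℂ) • r))
      - mult 2 0 (gen (kgFreq c)) (isMult_kgFreq hc0 (by omega)) (x t)
      - kgNonlin 0 lam hc0 (incl (Nat.zero_le 2) (x t))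
      = e • (mult m 0 _ hD1.isMult (w t)) + e • ((c ^ 2)⁻¹ : ℂ) • (mult 2 0 _ hD2.isMult r
          + incl (Nat.zero_le 2) q)
        + incl (Nat.zero_le 2) (kgs lam (e • v) - damp 2 hc0 (kgs lam (e • v)))
        + (kgNonlin 0 lam hc0 (incl (Nat.zero_le 2) (e • v))
          - kgNonlin 0 lam hc0 (incl (Nat.zero_le 2) (x t))) := by
    have hO : oscForce lam c t v = osc (-c ^ 2) t • kgs lam (e • v) - nls lam v := by
      rw [← hid]; abel
    have hk : kgs lam (e • v) = e • osc (-c ^ 2) t • kgs lam (e • v) := by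
      rw [smul_smul, hef, one_smul]
    rw [hO, map_sub (incl (Nat.zero_le 2)) (kgs lam (e • v)), incl_damp, incl_kgs]
    rw [show kgNonlin 0 lam hc0 (incl (Nat.zero_le 2) (e • v))
      = damp 0 hc0 (kgs lam (incl (Nat.zero_le 2) (e • v))) from rfl, ← incl_kgs]
    conv_rhs => rw [hk]
    generalize kgNonlin 0 lam hc0 (incl (Nat.zero_le 2) (x t)) = N
    rw [hxt, hw']
    generalize osc (-c ^ 2) t • kgs lam (e • v) = g
    ext1 k
    simp only [coeff_add, coeff_sub, coeff_smul, coeff_incl, coeff_mult, coeff_damp, hv,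
      smul_add, smul_sub, smul_smul, add_smul, sub_smul]
    match_scalars <;> field_simp <;> ring
  refine (le_of_eq (congrArg norm key)).trans ?_
  have hev : ‖e • v‖ ≤ ρ := by rw [norm_smul, hnorme, one_mul]; exact hvρ
  have b1 : ‖e • (mult m 0 _ hD1.isMult (w t))‖ ≤ (c ^ 2)⁻¹ * ρ := by
    rw [norm_smul, hnorme, one_mul]
    exact (norm_mult_le _ hD1 _).trans (mul_le_mul_of_nonneg_left hwt hcpos)
  have b2 : ‖e • ((c ^ 2)⁻¹ : ℂ) • (mult 2 0 _ hD2.isMult r + incl (Nat.zero_le 2) q)‖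
      ≤ (c ^ 2)⁻¹ * (|lam| * ρ ^ 3 + |lam| * ρ ^ 2 * (ρ + 3 * |lam| * ρ ^ 3)) := by
    rw [norm_smul, hnorme, one_mul, norm_smul, norm_inv_sq]
    refine mul_le_mul_of_nonneg_left ((norm_add_le _ _).trans (add_le_add ?_ ?_)) hcpos
    · exact (norm_mult_le _ hD2 _).trans (by rw [one_mul]; exact hrρ)
    · exact (norm_incl_le _ _).trans hq
  have b3 : ‖incl (Nat.zero_le 2) (kgs lam (e • v) - damp 2 hc0 (kgs lam (e • v)))‖
      ≤ (c ^ 2)⁻¹ * (3 * |lam| * ρ ^ 3) :=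
    (norm_sub_damp_le hc0 le_rfl _).trans (mul_le_mul_of_nonneg_left (norm_kgs_le hev) hcpos)
  have b4 : ‖kgNonlin 0 lam hc0 (incl (Nat.zero_le 2) (e • v))
      - kgNonlin 0 lam hc0 (incl (Nat.zero_le 2) (x t))‖
      ≤ (c ^ 2)⁻¹ * (3 * |lam| * (ρ + |lam| * ρ ^ 3) ^ 2 * (|lam| * ρ ^ 3)) := by
    have hxn : ‖x t‖ ≤ ρ + |lam| * ρ ^ 3 := by rw [hx]; exact norm_approx_le hc hvρ
    have hd : ‖e • v - x t‖ ≤ (c ^ 2)⁻¹ * (|lam| * ρ ^ 3) := by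
      rw [norm_sub_rev, hx]; exact norm_approx_sub_le hvρ
    have hev' : ‖e • v‖ ≤ ρ + |lam| * ρ ^ 3 := hev.trans (by
      have : 0 ≤ |lam| * ρ ^ 3 := by positivity
      linarith)
    refine (norm_kgNonlin_sub_le hc0 ((norm_incl_le _ _).trans hev')
      ((norm_incl_le _ _).trans hxn)).trans ?_
    rw [← map_sub]
    calc _ ≤ 3 * |lam| * (ρ + |lam| * ρ ^ 3) ^ 2 * ((c ^ 2)⁻¹ * (|lam| * ρ ^ 3)) :=
          mul_le_mul_of_nonneg_left ((norm_incl_le _ _).trans hd) (by positivity)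
      _ = _ := by ring
  refine (norm_add_le _ _).trans ((add_le_add ((norm_add_le _ _).trans (add_le_add
    ((norm_add_le _ _).trans (add_le_add b1 b2)) b3)) b4).trans (le_of_eq ?_))
  ring

/-- The solution of the Klein-Gordon system is `e^{ic²t}` times the solution of the limit system,
up to an error of size `c⁻²`. -/
theorem exists_modulation_error (lam ρ T G : ℝ) :
    ∃ C, 0 ≤ C ∧ ∀ {m : ℕ}, 6 ≤ m → ∀ {c : ℝ} (_ : 1 ≤ c) (hc0 : 0 < c) {Φ Γ : Wiener m}
      {w y : ℝ → Wiener m}, ‖Γ‖ ≤ G → w 0 = Φ - Complex.I • Γ →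
      y 0 = Φ - Complex.I • damp m hc0 Γ → IsMildSol schrFreq (nls lam) T ρ w →
      IsMildSol (kgFreq c) (kgNonlin m lam hc0) T ρ y → ∀ t, 0 ≤ t → t < T →
      ‖incl (Nat.zero_le m) (y t) - osc (c ^ 2) t • incl (Nat.zero_le m) (w t)‖
        ≤ C * (c ^ 2)⁻¹ := by
  set K := ρ + |lam| * ρ ^ 3 + |lam| * ρ ^ 2 * (ρ + 3 * |lam| * ρ ^ 3) + 3 * |lam| * ρ ^ 3
        + 3 * |lam| * (ρ + |lam| * ρ ^ 3) ^ 2 * (|lam| * ρ ^ 3) with hK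
  set ρ₁ := ρ + |lam| * ρ ^ 3 with hρ₁
  set Λ := 3 * |lam| * ρ₁ ^ 2 + 1 with hΛ
  refine ⟨|(|G| + |lam| * ρ ^ 3 + K) * Real.exp (Λ * T) + |lam| * ρ ^ 3|, abs_nonneg _, ?_⟩
  intro m hm c hc hc0 Φ Γ w y hΓ hw0 hy0 hw hy t ht0 htT
  have h2m : 2 ≤ m := by omega
  have hTpos : 0 < T := lt_of_le_of_lt ht0 htT
  have hmem0 : (0 : ℝ) ∈ Set.Icc (-T) T := ⟨by linarith, hTpos.le⟩
  have hρ : 0 ≤ ρ := (norm_nonneg _).trans (hw.norm_le 0 hmem0)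
  have hlr : 0 ≤ |lam| * ρ ^ 3 := by positivity
  have hK0 : 0 ≤ K := by positivity
  have hcpos : 0 ≤ (c ^ 2)⁻¹ := by positivity
  have hΛ1 : 1 ≤ Λ := by rw [hΛ]; have : 0 ≤ 3 * |lam| * ρ₁ ^ 2 := by positivity
                         linarith
  set x : ℝ → Wiener 2 := fun s => approx lam c s (incl h2m (w s)) with hx
  set X : ℝ → Wiener 0 := fun s => evo (kgFreq c) (-s) (Nat.zero_le 2) (x s) with hX
  set Y : ℝ → Wiener 0 := fun s => incl (Nat.zero_le m) (evo (kgFreq c) (-s) le_rfl (y s)) with hY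
  set F : ℝ → Wiener 0 → Wiener 0 := fun s a =>
    evo (kgFreq c) (-s) le_rfl (kgNonlin 0 lam hc0 (evo (kgFreq c) s le_rfl a)) with hF
  have hsub : ∀ s ∈ Set.Icc 0 t, s ∈ Set.Ioo (-T) T := fun s hs =>
    ⟨by linarith [hs.1], by linarith [hs.2]⟩
  have hwn : ∀ s ∈ Set.Icc 0 t, ‖incl h2m (w s)‖ ≤ ρ := fun s hs =>
    (norm_incl_le _ _).trans (hw.norm_le s (Set.Ioo_subset_Icc_self (hsub s hs)))
  have hxn : ∀ s ∈ Set.Icc 0 t, ‖x s‖ ≤ ρ₁ := fun s hs => norm_approx_le hc (hwn s hs)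
  have hYeq : ∀ s, Y s = evo (kgFreq c) (-s) le_rfl (incl (Nat.zero_le m) (y s)) := fun s => by
    ext1 k; simp [hY]
  have hXeq : ∀ s, X s = evo (kgFreq c) (-s) le_rfl (incl (Nat.zero_le 2) (x s)) := fun s => by
    ext1 k; simp [hX]
  -- the derivative of the twisted approximate solution
  have dX : ∀ s ∈ Set.Icc 0 t, ∃ D, HasDerivAt X D s ∧ dist D (F s (X s)) ≤ (c ^ 2)⁻¹ * K := by
    intro s hs
    obtain ⟨D, hD, hres⟩ := exists_residual hc hc0 hm hw (hsub s hs) (x := x) (fun _ => rfl)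
    have hneg : ∀ k, |(fun k => -kgFreq c k) k| ≤ c * (1 + c) * wt k ^ 1 := fun k => by
      simpa using abs_kgFreq_le hc0 k
    have h1 := hasDerivAt_evo_apply hneg (Nat.zero_le 2) (by omega)
      (multBound_gen hneg (by omega)).isMult hD
    have e1 : (fun s => evo (fun k => -kgFreq c k) s (Nat.zero_le 2) (x s)) = X := by
      funext s; ext1 k; simp [hX, phase]
    rw [e1] at h1
    refine ⟨_, h1, ?_⟩
    rw [dist_eq_norm]
    refine le_trans (le_of_eq ?_) hres
    rw [← norm_evo (kgFreq c) (-s) (incl (Nat.zero_le 2) D - _ - _)]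
    congr 1
    have e2 : evo (kgFreq c) s le_rfl (X s) = incl (Nat.zero_le 2) (x s) := by
      rw [hXeq, evo_evo, add_neg_cancel, evo_zero]
    simp only [hF]
    rw [e2, map_sub, map_sub]
    congr 1
    ext1 k
    have e3 : phase (fun k => -kgFreq c k) s k = phase (kgFreq c) (-s) k := by simp [phase]
    simp only [coeff_add, coeff_mult, coeff_evo, coeff_sub, coeff_incl, gen, e3]
    push_cast
    module
  have dY : ∀ s ∈ Set.Icc 0 t, HasDerivAt Y (F s (Y s)) s := by
    intro s hs
    have h1 := (incl (Nat.zero_le m)).hasFDerivAt.comp_hasDerivAt s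
      (hy.hasDerivAt_profile s (hsub s hs))
    refine h1.congr_deriv ?_
    simp only [hF, hYeq, evo_evo, add_neg_cancel, evo_zero]
    ext1 k
    simp only [kgNonlin, ← incl_kgs, ← incl_damp]
    simp
  have hlip : ∀ s ∈ Set.Ico 0 t, LipschitzOnWith Λ.toNNReal (F s) {a | ‖a‖ ≤ ρ₁} := by
    intro s _
    refine LipschitzOnWith.of_dist_le_mul fun a ha b hb => ?_
    rw [dist_eq_norm, dist_eq_norm, Real.coe_toNNReal _ (by linarith)]
    simp only [hF]
    rw [← map_sub, norm_evo]
    refine (norm_kgNonlin_sub_le hc0 (ρ := ρ₁) (by rw [norm_evo]; exact ha)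
      (by rw [norm_evo]; exact hb)).trans ?_
    rw [← map_sub, norm_evo]
    exact mul_le_mul_of_nonneg_right (by linarith) (norm_nonneg _)
  choose! D hD hDF using dX
  have hgr := dist_le_of_approx_trajectories_ODE_of_mem (K := Λ.toNNReal) (v := F)
    (s := fun _ => {a | ‖a‖ ≤ ρ₁}) (f := Y) (g := X) (f' := fun s => F s (Y s)) (g' := D)
    (εf := 0) (εg := (c ^ 2)⁻¹ * K) (δ := (c ^ 2)⁻¹ * (|G| + |lam| * ρ ^ 3)) (a := 0) (b := t)
    hlip (fun s hs => (dY s hs).continuousAt.continuousWithinAt)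
    (fun s hs => (dY s (Set.Ico_subset_Icc_self hs)).hasDerivWithinAt)
    (fun s _ => by rw [dist_self])
    (fun s hs => by
      have hs' := Set.Ico_subset_Icc_self hs
      rw [Set.mem_ofPred_eq, hYeq, norm_evo]
      exact ((norm_incl_le _ _).trans (hy.norm_le s (Set.Ioo_subset_Icc_self (hsub s hs')))).trans
        (by rw [hρ₁]; linarith))
    (fun s hs => (hD s hs).continuousAt.continuousWithinAt)
    (fun s hs => (hD s (Set.Ico_subset_Icc_self hs)).hasDerivWithinAt)
    (fun s hs => hDF s (Set.Ico_subset_Icc_self hs))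
    (fun s hs => by
      rw [Set.mem_ofPred_eq, hXeq, norm_evo]
      exact (norm_incl_le _ _).trans (hxn s (Set.Ico_subset_Icc_self hs)))
    (by
      have h0 : (0 : ℝ) ∈ Set.Icc 0 t := ⟨le_rfl, ht0⟩
      have hos : osc (c ^ 2) 0 = 1 := by simp [osc]
      have e : Y 0 - X 0 = Complex.I • incl (Nat.zero_le m) (Γ - damp m hc0 Γ)
          - incl (Nat.zero_le 2) (x 0 - osc (c ^ 2) 0 • incl h2m (w 0)) := by
        rw [hYeq, hXeq, neg_zero, evo_zero, evo_zero, hos, one_smul, hy0, hw0]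
        ext1 k
        simp only [coeff_sub, coeff_smul, coeff_incl]
        module
      rw [dist_eq_norm, e]
      refine (norm_sub_le _ _).trans ?_
      rw [mul_add, norm_I_smul]
      refine add_le_add ((norm_sub_damp_le hc0 h2m Γ).trans ?_) ((norm_incl_le _ _).trans
        (norm_approx_sub_le (hwn 0 h0)))
      exact mul_le_mul_of_nonneg_left (hΓ.trans (le_abs_self G)) hcpos)
    t ⟨ht0, le_rfl⟩
  rw [Real.coe_toNNReal _ (by linarith), sub_zero, zero_add] at hgr
  have h1 := hgr.trans (gronwallBound_le (by positivity) hΛ1 ht0)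
  rw [dist_eq_norm, hYeq, hXeq, ← map_sub, norm_evo] at h1
  have h2 : ‖incl (Nat.zero_le 2) (x t - osc (c ^ 2) t • incl h2m (w t))‖
      ≤ (c ^ 2)⁻¹ * (|lam| * ρ ^ 3) :=
    (norm_incl_le _ _).trans (norm_approx_sub_le (hwn t ⟨ht0, le_rfl⟩))
  have e3 : incl (Nat.zero_le m) (y t) - osc (c ^ 2) t • incl (Nat.zero_le m) (w t)
      = (incl (Nat.zero_le m) (y t) - incl (Nat.zero_le 2) (x t))
        + incl (Nat.zero_le 2) (x t - osc (c ^ 2) t • incl h2m (w t)) := by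
    ext1 k
    simp
  rw [e3]
  have h4 : Real.exp (Λ * t) ≤ Real.exp (Λ * T) :=
    Real.exp_le_exp.2 (mul_le_mul_of_nonneg_left htT.le (by linarith))
  have h5 : ((c ^ 2)⁻¹ * (|G| + |lam| * ρ ^ 3) + (c ^ 2)⁻¹ * K) * Real.exp (Λ * t)
      ≤ ((c ^ 2)⁻¹ * (|G| + |lam| * ρ ^ 3) + (c ^ 2)⁻¹ * K) * Real.exp (Λ * T) :=
    mul_le_mul_of_nonneg_left h4 (by positivity)
  refine ((norm_add_le _ _).trans (add_le_add (h1.trans h5) h2)).trans ?_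
  have h6 := mul_le_mul_of_nonneg_right
    (le_abs_self ((|G| + |lam| * ρ ^ 3 + K) * Real.exp (Λ * T) + |lam| * ρ ^ 3)) hcpos
  refine le_trans (le_of_eq ?_) h6
  ring

open Asymptotics Filter

/-! ### The exponential in a Banach algebra -/

lemma norm_exp_sub_sum_le {R : Type*} [NormedCommRing R] [NormedAlgebra ℂ R] [NormOneClass R]
    [CompleteSpace R] (x : R) (n : ℕ) :
    ‖NormedSpace.exp x - ∑ i ∈ Finset.range n, ((i.factorial : ℂ)⁻¹) • x ^ i‖
      ≤ ‖x‖ ^ n * Real.exp ‖x‖ := by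
  have hs : Summable fun i : ℕ => ((i.factorial : ℂ)⁻¹) • x ^ i :=
    NormedSpace.expSeries_summable' x
  have hr : Summable fun i : ℕ => ((i.factorial : ℝ)⁻¹) • ‖x‖ ^ i :=
    NormedSpace.expSeries_summable' ‖x‖
  rw [congrFun (NormedSpace.exp_eq_tsum ℂ) x, ← hs.sum_add_tsum_nat_add n, add_sub_cancel_left]
  have hb : ∀ i : ℕ, ‖(((i + n).factorial : ℂ)⁻¹) • x ^ (i + n)‖
      ≤ ‖x‖ ^ n * (((i.factorial : ℝ)⁻¹) • ‖x‖ ^ i) := fun i => by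
    rw [norm_smul, norm_inv, Complex.norm_natCast, smul_eq_mul]
    have h1 : (((i + n).factorial : ℝ))⁻¹ ≤ ((i.factorial : ℝ))⁻¹ :=
      inv_anti₀ (by positivity) (by exact_mod_cast Nat.factorial_le (by omega))
    calc _ ≤ ((i.factorial : ℝ))⁻¹ * ‖x‖ ^ (i + n) :=
          mul_le_mul h1 (norm_pow_le _ _) (norm_nonneg _) (by positivity)
      _ = _ := by ring
  refine (tsum_of_norm_bounded (hr.mul_left _).hasSum hb).trans (le_of_eq ?_)
  rw [tsum_mul_left, Real.exp_eq_exp_ℝ, congrFun (NormedSpace.exp_eq_tsum ℝ) ‖x‖]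

lemma norm_exp_le' {R : Type*} [NormedCommRing R] [NormedAlgebra ℂ R] [NormOneClass R]
    [CompleteSpace R] (x : R) : ‖NormedSpace.exp x‖ ≤ Real.exp ‖x‖ := by
  simpa using norm_exp_sub_sum_le x 0

lemma norm_exp_sub_one_le {R : Type*} [NormedCommRing R] [NormedAlgebra ℂ R] [NormOneClass R]
    [CompleteSpace R] (x : R) : ‖NormedSpace.exp x - 1‖ ≤ ‖x‖ * Real.exp ‖x‖ := by
  simpa using norm_exp_sub_sum_le x 1

/-! ### The potential flow -/

/-- The generator `-itV(a)` of the potential flow. -/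
def potGen (lam t : ℝ) (a : Wiener m) : Wiener m := (-Complex.I * (t : ℂ)) • pot lam a

/-- The flow of the potential part: as `V` is conserved, it is multiplication by `e^{-itV(a)}`. -/
def potFlow (lam t : ℝ) (a : Wiener m) : Wiener m := NormedSpace.exp (potGen lam t a) * a

lemma norm_neg_I_smul (t : ℝ) (a : Wiener m) : ‖(-Complex.I * (t : ℂ)) • a‖ = |t| * ‖a‖ := by
  rw [norm_smul, norm_mul, norm_neg, Complex.norm_I, one_mul, Complex.norm_real, Real.norm_eq_abs]

lemma norm_potGen_le {lam t ρ : ℝ} {a : Wiener m} (ha : ‖a‖ ≤ ρ) :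
    ‖potGen lam t a‖ ≤ |t| * (|lam| * ρ ^ 2) := by
  rw [potGen, norm_neg_I_smul]
  exact mul_le_mul_of_nonneg_left (norm_pot_le ha) (abs_nonneg t)

lemma norm_potFlow_le {lam t ρ : ℝ} {a : Wiener m} (ha : ‖a‖ ≤ ρ) :
    ‖potFlow lam t a‖ ≤ Real.exp (|t| * (|lam| * ρ ^ 2)) * ‖a‖ :=
  (norm_mul_le _ _).trans (mul_le_mul_of_nonneg_right
    ((norm_exp_le' _).trans (Real.exp_le_exp.2 (norm_potGen_le ha))) (norm_nonneg _))

/-- The potential flow is stable: its Lipschitz constant on bounded sets is `1 + O(t)`. -/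
lemma norm_potFlow_sub_le {lam t ρ : ℝ} (ht0 : 0 ≤ t) (ht : t ≤ 1) {a b : Wiener m}
    (ha : ‖a‖ ≤ ρ) (hb : ‖b‖ ≤ ρ) :
    ‖potFlow lam t a - potFlow lam t b‖ ≤
      Real.exp (t * (|lam| * ρ ^ 2 * (1 + Real.exp (2 * (|lam| * ρ ^ 2))))) * ‖a - b‖ := by
  have hρ : 0 ≤ ρ := (norm_nonneg _).trans ha
  set L := |lam| * ρ ^ 2 with hL
  have hL0 : 0 ≤ L := by positivity
  have hX := norm_potGen_le (lam := lam) (t := t) ha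
  have hY := norm_potGen_le (lam := lam) (t := t) hb
  rw [abs_of_nonneg ht0, ← hL] at hX hY
  have e : potFlow lam t a - potFlow lam t b = NormedSpace.exp (potGen lam t a) * (a - b)
      + NormedSpace.exp (potGen lam t b) *
        ((NormedSpace.exp (potGen lam t a - potGen lam t b) - 1) * b) := by
    have : NormedSpace.exp (potGen lam t a) = NormedSpace.exp (potGen lam t b) *
        NormedSpace.exp (potGen lam t a - potGen lam t b) := by
      rw [← NormedSpace.exp_add, add_sub_cancel]
    rw [potFlow, potFlow, mul_sub (NormedSpace.exp (potGen lam t a)), this]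
    ring
  have hd : ‖potGen lam t a - potGen lam t b‖ ≤ t * (|lam| * ρ * ‖a - b‖) := by
    rw [potGen, potGen, ← smul_sub, norm_neg_I_smul, abs_of_nonneg ht0]
    exact mul_le_mul_of_nonneg_left (norm_pot_sub_le ha hb) ht0
  have hd' : ‖potGen lam t a - potGen lam t b‖ ≤ 2 * L := by
    refine (norm_sub_le _ _).trans ?_
    nlinarith
  have h1 : ‖NormedSpace.exp (potGen lam t a) * (a - b)‖ ≤ Real.exp (t * L) * ‖a - b‖ :=
    (norm_mul_le _ _).trans (mul_le_mul_of_nonneg_right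
      ((norm_exp_le' _).trans (Real.exp_le_exp.2 hX)) (norm_nonneg _))
  have h2 : ‖(NormedSpace.exp (potGen lam t a - potGen lam t b) - 1) * b‖
      ≤ (t * (|lam| * ρ * ‖a - b‖) * Real.exp (2 * L)) * ρ := by
    refine norm_mul_le_sq ((norm_exp_sub_one_le _).trans ?_) hb
    exact mul_le_mul hd (Real.exp_le_exp.2 hd') (Real.exp_pos _).le (by positivity)
  have h3 := norm_mul_le_sq ((norm_exp_le' (potGen lam t b)).trans (Real.exp_le_exp.2 hY)) h2
  rw [e]
  refine (norm_add_le _ _).trans ((add_le_add h1 h3).trans ?_)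
  have h4 : t * (L * Real.exp (2 * L)) + 1 ≤ Real.exp (t * (L * Real.exp (2 * L))) :=
    Real.add_one_le_exp _
  calc Real.exp (t * L) * ‖a - b‖
        + Real.exp (t * L) * ((t * (|lam| * ρ * ‖a - b‖) * Real.exp (2 * L)) * ρ)
      = Real.exp (t * L) * (t * (L * Real.exp (2 * L)) + 1) * ‖a - b‖ := by rw [hL]; ring
    _ ≤ Real.exp (t * L) * Real.exp (t * (L * Real.exp (2 * L))) * ‖a - b‖ := by gcongr
    _ = _ := by rw [← Real.exp_add]; congr 2; ring

lemma incl_potGen (h : n ≤ m) (lam t : ℝ) (a : Wiener m) :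
    incl h (potGen lam t a) = potGen lam t (incl h a) := by
  rw [potGen, potGen, incl_smul, incl_pot]

/-- The inclusion as a homomorphism of algebras. -/
def inclHom (h : n ≤ m) : Wiener m →+* Wiener n where
  toFun := incl h
  map_one' := incl_one h
  map_mul' := incl_mul h
  map_zero' := map_zero _
  map_add' := map_add _

lemma incl_exp (h : n ≤ m) (a : Wiener m) :
    incl h (NormedSpace.exp a) = NormedSpace.exp (incl h a) :=
  NormedSpace.map_exp (inclHom h) (incl h).continuous a

lemma incl_potFlow (h : n ≤ m) (lam t : ℝ) (a : Wiener m) :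
    incl h (potFlow lam t a) = potFlow lam t (incl h a) := by
  rw [potFlow, potFlow, incl_mul, incl_exp, incl_potGen]

/-! ### Taylor expansions of the nonlinearity -/

/-- The derivative of `pot` at `a` in direction `h`. -/
def dpot (lam : ℝ) (a h : Wiener m) : Wiener m :=
  ((lam / 8 : ℝ) : ℂ) • ((a * conj h + h * conj a) + (2 : ℂ) • swap (a * conj h + h * conj a))

/-- The derivative of `nls` at `a` in direction `h`. -/
def dnls (lam : ℝ) (a h : Wiener m) : Wiener m :=
  -(Complex.I • (dpot lam a h * a + pot lam a * h))

lemma norm_dpot_le (lam : ℝ) (a h : Wiener m) : ‖dpot lam a h‖ ≤ |lam| * (‖a‖ * ‖h‖) := by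
  have h1 : ‖a * conj h + h * conj a‖ ≤ ‖a‖ * ‖h‖ + ‖h‖ * ‖a‖ :=
    (norm_add_le _ _).trans (add_le_add (norm_mul_le_sq le_rfl (norm_conj h).le)
      (norm_mul_le_sq le_rfl (norm_conj a).le))
  have h2 : ‖(a * conj h + h * conj a) + (2 : ℂ) • swap (a * conj h + h * conj a)‖
      ≤ 6 * (‖a‖ * ‖h‖) := by
    refine (norm_add_le _ _).trans ?_
    rw [norm_two_smul, norm_swap]; linarith
  rw [dpot, norm_ofReal_smul, abs_div, abs_of_pos (by norm_num : (0 : ℝ) < 8)]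
  nlinarith [mul_le_mul_of_nonneg_left h2 (abs_nonneg lam),
    mul_nonneg (abs_nonneg lam) (mul_nonneg (norm_nonneg a) (norm_nonneg h))]

lemma norm_pot_le' (lam : ℝ) (a : Wiener m) : ‖pot lam a‖ ≤ |lam| * ‖a‖ ^ 2 := norm_pot_le le_rfl

lemma norm_dnls_le (lam : ℝ) (a h : Wiener m) : ‖dnls lam a h‖ ≤ 2 * |lam| * ‖a‖ ^ 2 * ‖h‖ := by
  rw [dnls, norm_neg, norm_I_smul]
  refine (norm_add_le _ _).trans ((add_le_add (norm_mul_le_sq (norm_dpot_le lam a h) le_rfl)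
    (norm_mul_le_sq (norm_pot_le' lam a) le_rfl)).trans (le_of_eq ?_))
  ring

lemma pot_add (lam : ℝ) (a h : Wiener m) :
    pot lam (a + h) = pot lam a + dpot lam a h + pot lam h := by
  have e : (a + h) * conj (a + h) = a * conj a + (a * conj h + h * conj a) + h * conj h := by
    rw [map_add]; ring
  rw [pot, e, map_add, map_add, pot, pot, dpot]
  module

/-- The remainder in the first-order Taylor expansion of the nonlinearity is quadratic. -/
lemma norm_nls_add_sub_le (lam : ℝ) (a h : Wiener m) :
    ‖nls lam (a + h) - nls lam a - dnls lam a h‖ ≤ |lam| * (2 * ‖a‖ + ‖h‖) * ‖h‖ ^ 2 := by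
  have e : nls lam (a + h) - nls lam a - dnls lam a h
      = -(Complex.I • (dpot lam a h * h + pot lam h * (a + h))) := by
    rw [nls, nls, dnls, pot_add, add_mul, add_mul, mul_add, mul_add, mul_add]
    module
  rw [e, norm_neg, norm_I_smul]
  refine (norm_add_le _ _).trans ((add_le_add (norm_mul_le_sq (norm_dpot_le lam a h) le_rfl)
    (norm_mul_le_sq (norm_pot_le' lam h) (norm_add_le a h))).trans (le_of_eq ?_))
  ring

lemma dnls_add (lam : ℝ) (a h k : Wiener m) :
    dnls lam a (h + k) = dnls lam a h + dnls lam a k := by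
  have e : dpot lam a (h + k) = dpot lam a h + dpot lam a k := by
    simp only [dpot, map_add, mul_add, add_mul]; module
  rw [dnls, e, add_mul, mul_add, dnls, dnls]; module

lemma conj_real_smul (r : ℝ) (a : Wiener m) : conj (r • a) = r • conj a := map_smul conj r a

lemma dnls_smul (lam r : ℝ) (a h : Wiener m) : dnls lam a (r • h) = r • dnls lam a h := by
  have e : dpot lam a (r • h) = r • dpot lam a h := by
    rw [dpot, conj_real_smul, mul_smul_comm, smul_mul_assoc, ← smul_add, map_smul, dpot]
    module
  rw [dnls, e, smul_mul_assoc, mul_smul_comm, dnls]; module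

lemma conj_pot (lam : ℝ) (a : Wiener m) : conj (pot lam a) = pot lam a := by
  have e : conj (a * conj a) = a * conj a := by rw [map_mul, conj_conj, mul_comm]
  rw [pot, conj_smul, map_add, conj_smul, conj_swap, e, Complex.conj_ofReal, map_ofNat]

/-- The second derivative at time zero of the potential flow starting at `a`. -/
def potSnd (lam : ℝ) (a : Wiener m) : Wiener m := -(pot lam a * (pot lam a * a))

lemma dnls_nls (lam : ℝ) (a : Wiener m) : dnls lam a (nls lam a) = potSnd lam a := by
  have e : a * conj (nls lam a) + nls lam a * conj a = 0 := by
    rw [nls, map_neg, conj_smul, map_mul, conj_pot, Complex.conj_I]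
    simp only [neg_mul, mul_smul_comm, smul_mul_assoc, neg_smul, neg_neg]
    rw [show a * (pot lam a * conj a) = pot lam a * a * conj a by ring]
    abel
  rw [dnls, dpot, e, nls, potSnd]
  simp only [map_zero, smul_zero, add_zero, zero_mul, zero_add, mul_neg, mul_smul_comm, smul_neg,
    smul_smul, Complex.I_mul_I, neg_smul, one_smul, neg_neg]

lemma incl_dnls (h : n ≤ m) (lam : ℝ) (a b : Wiener m) :
    incl h (dnls lam a b) = dnls lam (incl h a) (incl h b) := by
  simp [dnls, dpot, incl_smul, incl_pot]

lemma incl_potSnd (h : n ≤ m) (lam : ℝ) (a : Wiener m) :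
    incl h (potSnd lam a) = potSnd lam (incl h a) := by
  simp [potSnd, incl_pot]

lemma potGen_mul (lam t : ℝ) (a : Wiener m) : potGen lam t a * a = t • nls lam a := by
  rw [potGen, nls, smul_mul_assoc]
  module

lemma potGen_sq_mul (lam t : ℝ) (a : Wiener m) :
    potGen lam t a ^ 2 * a = t ^ 2 • potSnd lam a := by
  rw [sq, mul_assoc, potGen_mul, mul_smul_comm, potSnd, nls, potGen, mul_neg, mul_smul_comm,
    smul_mul_assoc]
  match_scalars
  simp
  ring_nf
  simp

lemma norm_potFlow_sub_taylor_le {lam t ρ : ℝ} {a : Wiener m} (ha : ‖a‖ ≤ ρ) :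
    ‖potFlow lam t a - (a + t • nls lam a + (t ^ 2 / 2) • potSnd lam a)‖
      ≤ |t| ^ 3 * ((|lam| * ρ ^ 2) ^ 3 * Real.exp (|t| * (|lam| * ρ ^ 2)) * ρ) := by
  have h := norm_exp_sub_sum_le (potGen lam t a) 3
  have e : potFlow lam t a - (a + t • nls lam a + (t ^ 2 / 2) • potSnd lam a)
      = (NormedSpace.exp (potGen lam t a)
        - ∑ i ∈ Finset.range 3, ((i.factorial : ℂ)⁻¹) • potGen lam t a ^ i) * a := by
    rw [Finset.sum_range_succ, Finset.sum_range_succ, Finset.sum_range_succ, Finset.sum_range_zero,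
      sub_mul, add_mul, add_mul, add_mul, smul_mul_assoc, smul_mul_assoc, smul_mul_assoc,
      potGen_sq_mul, pow_one, potGen_mul, potFlow]
    simp only [pow_zero, Nat.factorial, one_mul, zero_mul]
    push_cast
    module
  rw [e]
  have h2 := norm_potGen_le (lam := lam) (t := t) ha
  have hρ : 0 ≤ ρ := (norm_nonneg _).trans ha
  refine (norm_mul_le_sq (h.trans (mul_le_mul (pow_le_pow_left₀ (norm_nonneg _) h2 3)
    (Real.exp_le_exp.2 h2) (Real.exp_pos _).le (by positivity))) ha).trans (le_of_eq ?_)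
  ring

/-- The generator of the linear limit equation. -/
def lap (h : n + 2 ≤ m) : Wiener m →L[ℝ] Wiener n := mult m n (gen schrFreq) (isMult_schrFreq h)

@[simp] lemma coeff_lap (h : n + 2 ≤ m) (a : Wiener m) (k : ℤ) :
    (lap h a).coeff k = gen schrFreq k • a.coeff k := coeff_mult _ _ _ _

lemma norm_exp_I_sub_taylor_le (x : ℝ) :
    ‖Complex.exp (Complex.I * x) - 1 - Complex.I * x - (Complex.I * x) ^ 2 / 2‖ ≤ |x| ^ 3 := by
  have hd : ∀ y : ℝ, HasDerivAt
      (fun y : ℝ => Complex.exp (Complex.I * y) - 1 - Complex.I * y - (Complex.I * y) ^ 2 / 2)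
      (Complex.I * (Complex.exp (Complex.I * y) - 1 - Complex.I * y)) y := by
    intro y
    have h1 : HasDerivAt (fun y : ℝ => Complex.I * (y : ℂ)) (Complex.I * 1) y :=
      (Complex.ofRealCLM.hasDerivAt (x := y)).const_mul Complex.I
    refine ((((h1.cexp.sub_const 1).sub h1).sub ((h1.pow 2).div_const 2))).congr_deriv ?_
    simp
    ring
  have hb : ∀ y ∈ Set.uIcc 0 x,
      ‖Complex.I * (Complex.exp (Complex.I * y) - 1 - Complex.I * y)‖ ≤ |x| ^ 2 := by
    intro y hy
    rw [norm_mul, Complex.norm_I, one_mul]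
    refine (norm_exp_I_sub_le y).trans ?_
    rw [← sq_abs y]
    refine pow_le_pow_left₀ (abs_nonneg _) ?_ 2
    simpa using Set.abs_sub_left_of_mem_uIcc hy
  have := (convex_uIcc 0 x).norm_image_sub_le_of_norm_hasDerivWithin_le
    (fun y _ => (hd y).hasDerivWithinAt) hb (Set.left_mem_uIcc) (Set.right_mem_uIcc)
  refine le_trans (le_of_eq ?_) (this.trans (le_of_eq ?_))
  · simp
  · rw [sub_zero, Real.norm_eq_abs]; ring

/-- The second-order Taylor expansion of the free evolution. -/
lemma norm_evo_sub_taylor_le (t : ℝ) (a : Wiener 8) :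
    ‖evo schrFreq t (Nat.zero_le 8) a - (incl (Nat.zero_le 8) a + t • lap (by norm_num) a
      + (t ^ 2 / 2) • lap (by norm_num) (lap (n := 2) (by norm_num) a))‖ ≤ |t| ^ 3 * ‖a‖ := by
  have hb : MultBound 8 0 (|t| ^ 3) (fun k => phase schrFreq t k - 1 - t * gen schrFreq k
      - (t * gen schrFreq k) ^ 2 / 2) := by
    refine MultBound.of_growth (q := 6) (fun k => ?_) (by norm_num)
    have e : phase schrFreq t k - 1 - t * gen schrFreq k - (t * gen schrFreq k) ^ 2 / 2
        = Complex.exp (Complex.I * ((t * schrFreq k : ℝ) : ℂ)) - 1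
          - Complex.I * ((t * schrFreq k : ℝ) : ℂ)
          - (Complex.I * ((t * schrFreq k : ℝ) : ℂ)) ^ 2 / 2 := by
      rw [phase, gen]; push_cast; ring
    rw [e]
    refine (norm_exp_I_sub_taylor_le _).trans ?_
    rw [abs_mul, mul_pow]
    refine mul_le_mul_of_nonneg_left ?_ (by positivity)
    calc |schrFreq k| ^ 3 ≤ (1 * wt k ^ 2) ^ 3 :=
          pow_le_pow_left₀ (abs_nonneg _) (abs_schrFreq_le k) 3
      _ = wt k ^ 6 := by ring
  refine le_trans (le_of_eq ?_) (norm_mult_le hb.isMult hb a)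
  congr 1
  ext1 k
  simp only [coeff_sub, coeff_add, coeff_evo, coeff_incl, coeff_real_smul, coeff_lap, coeff_mult]
  module

/-! ### The local error of the splitting -/

/-- Pairs `(t, τ)` of a time and a step size for which `[t, t + τ]` stays in `[0, T)`. -/
def steps (T : ℝ) : Set (ℝ × ℝ) := {p | 0 ≤ p.1 ∧ 0 ≤ p.2 ∧ p.2 ≤ 1 ∧ p.1 + p.2 < T}

lemma isBigO_of_hasDerivAt {E : Type*} [NormedAddCommGroup E] [NormedSpace ℝ E] {T : ℝ}
    {f f' : ℝ × ℝ → E} {k : ℕ}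
    (hd : ∀ p ∈ steps T, HasDerivAt (fun r => f (p.1, r)) (f' p) p.2) (h0 : ∀ t, f (t, 0) = 0)
    (h : f' =O[𝓟 (steps T)] fun p => p.2 ^ k) : f =O[𝓟 (steps T)] fun p => p.2 ^ (k + 1) := by
  rw [isBigO_principal] at h ⊢
  obtain ⟨C, hC⟩ := h
  refine ⟨|C|, fun p hp => ?_⟩
  obtain ⟨h1, h2, h3, h4⟩ := hp
  have hmem : ∀ r ∈ Set.Icc 0 p.2, (p.1, r) ∈ steps T := fun r hr =>
    ⟨h1, hr.1, hr.2.trans h3, by have := hr.2; simp only; linarith⟩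
  have := norm_image_sub_le_of_norm_deriv_le_segment' (f := fun r => f (p.1, r))
    (f' := fun r => f' (p.1, r)) (a := 0) (b := p.2) (C := |C| * p.2 ^ k)
    (fun r hr => (hd (p.1, r) (hmem r hr)).hasDerivWithinAt)
    (fun r hr => by
      refine (hC _ (hmem r (Set.Ico_subset_Icc_self hr))).trans ?_
      simp only [norm_pow, Real.norm_eq_abs, abs_of_nonneg hr.1]
      exact mul_le_mul (le_abs_self C) (pow_le_pow_left₀ hr.1 hr.2.le k)
        (pow_nonneg hr.1 k) (abs_nonneg C)) p.2 ⟨h2, le_rfl⟩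
  simp only [h0, sub_zero] at this
  rw [norm_pow, Real.norm_eq_abs, abs_of_nonneg h2]
  refine this.trans (le_of_eq ?_)
  ring

section bigO

variable {ι : Type*} {l : Filter ι} {lam : ℝ} {a b h : ι → Wiener m} {f : ι → ℝ}

lemma isBigO_incl (hmn : n ≤ m) (ha : a =O[l] f) : (fun i => incl hmn (a i)) =O[l] f :=
  ((incl hmn).isBigO_comp a l).trans ha

lemma isBigO_lap (hmn : n + 2 ≤ m) (ha : a =O[l] f) : (fun i => lap hmn (a i)) =O[l] f :=
  ((lap hmn).isBigO_comp a l).trans ha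

lemma isBigO_dnls (ha : a =O[l] fun _ => (1 : ℝ)) (hh : h =O[l] f) :
    (fun i => dnls lam (a i) (h i)) =O[l] f := by
  have h1 : (fun i => dnls lam (a i) (h i)) =O[l] fun i => ‖a i‖ ^ 2 * ‖h i‖ :=
    IsBigO.of_bound (2 * |lam|) (Eventually.of_forall fun i => by
      rw [Real.norm_of_nonneg (by positivity)]
      exact (norm_dnls_le lam (a i) (h i)).trans (le_of_eq (by ring)))
  refine h1.trans ?_
  simpa using (ha.norm_left.pow 2).mul hh.norm_left

lemma isBigO_nls_add_sub (ha : a =O[l] fun _ => (1 : ℝ)) (hh1 : h =O[l] fun _ => (1 : ℝ))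
    (hh : h =O[l] f) :
    (fun i => nls lam (a i + h i) - nls lam (a i) - dnls lam (a i) (h i)) =O[l]
      fun i => f i ^ 2 := by
  have h1 : (fun i => nls lam (a i + h i) - nls lam (a i) - dnls lam (a i) (h i)) =O[l]
      fun i => (2 * ‖a i‖ + ‖h i‖) * ‖h i‖ ^ 2 :=
    IsBigO.of_bound |lam| (Eventually.of_forall fun i => by
      rw [Real.norm_of_nonneg (by positivity)]
      exact (norm_nls_add_sub_le lam (a i) (h i)).trans (le_of_eq (by ring)))
  refine h1.trans ?_
  simpa using ((ha.norm_left.const_mul_left 2).add hh1.norm_left).mul (hh.norm_left.pow 2)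

lemma isBigO_nls_sub (ha : a =O[l] fun _ => (1 : ℝ)) (hh1 : h =O[l] fun _ => (1 : ℝ))
    (hh : h =O[l] f) : (fun i => nls lam (a i + h i) - nls lam (a i)) =O[l] f := by
  have h1 := isBigO_nls_add_sub (lam := lam) ha hh1 (isBigO_refl (fun i => ‖h i‖) l).of_norm_left
  have h2 : (fun i => ‖h i‖ ^ 2) =O[l] f := by
    simpa [sq] using hh1.norm_left.mul hh.norm_left
  have := (h1.trans h2).add (isBigO_dnls (lam := lam) ha hh)
  refine this.congr_left fun i => ?_
  abel

lemma isBigO_nls (ha : a =O[l] fun _ => (1 : ℝ)) :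
    (fun i => nls lam (a i)) =O[l] fun _ => (1 : ℝ) := by
  obtain ⟨C, hC⟩ := ha.bound
  refine IsBigO.of_bound (3 * |lam| * C ^ 3) (hC.mono fun i hi => ?_)
  rw [norm_one, mul_one] at hi ⊢
  exact norm_nls_le hi

lemma norm_potSnd_sub_le {ρ : ℝ} {a b : Wiener m} (ha : ‖a‖ ≤ ρ) (hb : ‖b‖ ≤ ρ) :
    ‖potSnd lam a - potSnd lam b‖ ≤ 4 * (|lam| * ρ ^ 2) ^ 2 * ‖a - b‖ := by
  have hW : ‖pot lam a * a - pot lam b * b‖ ≤ 3 * |lam| * ρ ^ 2 * ‖a - b‖ := by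
    have e : nls lam a - nls lam b = -(Complex.I • (pot lam a * a - pot lam b * b)) := by
      rw [nls, nls]; module
    have := norm_nls_sub_le (lam := lam) ha hb
    rwa [e, norm_neg, norm_I_smul] at this
  have hρ : 0 ≤ ρ := (norm_nonneg _).trans ha
  have h1 := norm_mul_sub_mul_le (a := pot lam a) (a' := pot lam b) (b' := pot lam b * b)
    (norm_mul_le_sq (norm_pot_le (lam := lam) ha) ha) (norm_pot_le (lam := lam) hb)
  have e : potSnd lam a - potSnd lam b
      = -(pot lam a * (pot lam a * a) - pot lam b * (pot lam b * b)) := by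
    rw [potSnd, potSnd]; abel
  rw [e, norm_neg]
  refine h1.trans ?_
  have h2 := mul_le_mul_of_nonneg_left (norm_pot_sub_le (lam := lam) ha hb)
    (by positivity : 0 ≤ |lam| * ρ ^ 2 * ρ)
  have h3 := mul_le_mul_of_nonneg_left hW (by positivity : 0 ≤ |lam| * ρ ^ 2)
  refine (add_le_add h2 h3).trans (le_of_eq ?_)
  ring

lemma isBigO_potSnd_sub (ha : a =O[l] fun _ => (1 : ℝ)) (hb : b =O[l] fun _ => (1 : ℝ))
    (hab : (fun i => a i - b i) =O[l] f) :
    (fun i => potSnd lam (a i) - potSnd lam (b i)) =O[l] f := by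
  obtain ⟨C, hC⟩ := ha.bound
  obtain ⟨D, hD⟩ := hb.bound
  refine IsBigO.trans (IsBigO.of_bound (4 * (|lam| * (max C D) ^ 2) ^ 2)
    ((hC.and hD).mono fun i hi => ?_)) hab
  rw [norm_one, mul_one, mul_one] at hi
  exact norm_potSnd_sub_le (hi.1.trans (le_max_left _ _)) (hi.2.trans (le_max_right _ _))

lemma isBigO_potFlow_sub_taylor {s : ι → ℝ} (hs : s =O[l] fun _ => (1 : ℝ))
    (ha : a =O[l] fun _ => (1 : ℝ)) :
    (fun i => potFlow lam (s i) (a i)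
      - (a i + s i • nls lam (a i) + (s i ^ 2 / 2) • potSnd lam (a i))) =O[l] fun i => s i ^ 3 := by
  obtain ⟨C, hC⟩ := ha.bound
  obtain ⟨D, hD⟩ := hs.bound
  refine IsBigO.of_bound ((|lam| * C ^ 2) ^ 3 * Real.exp (D * (|lam| * C ^ 2)) * C)
    ((hC.and hD).mono fun i hi => ?_)
  rw [norm_one, mul_one, mul_one, Real.norm_eq_abs] at hi
  refine (norm_potFlow_sub_taylor_le hi.1).trans ?_
  have hC0 : 0 ≤ C := (norm_nonneg _).trans hi.1
  rw [norm_pow, Real.norm_eq_abs, mul_comm]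
  refine mul_le_mul_of_nonneg_right ?_ (by positivity)
  refine mul_le_mul_of_nonneg_right ?_ hC0
  refine mul_le_mul_of_nonneg_left (Real.exp_le_exp.2 ?_) (by positivity)
  exact mul_le_mul_of_nonneg_right hi.2 (by positivity)

end bigO

/-- The time derivative of a solution `w` of the limit system with `w t = a`. -/
def fstDeriv (lam : ℝ) (a : Wiener 8) : Wiener 4 :=
  lap (by norm_num) a + nls lam (incl (by norm_num) a)

/-- The second time derivative of a solution `w` of the limit system with `w t = a`. -/
def sndDeriv (lam : ℝ) (a : Wiener 8) : Wiener 2 :=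
  lap (by norm_num) (fstDeriv lam a)
    + dnls lam (incl (by norm_num) a) (incl (by norm_num) (fstDeriv lam a))

lemma incl_incl {p : ℕ} (h : n ≤ m) (h' : p ≤ n) (a : Wiener m) :
    incl h' (incl h a) = incl (h'.trans h) a := by
  ext1 k; simp

lemma incl_fstDeriv (lam : ℝ) (a : Wiener 8) : incl (Nat.zero_le 4) (fstDeriv lam a)
    = lap (by norm_num) a + nls lam (incl (Nat.zero_le 8) a) := by
  rw [fstDeriv, map_add, incl_nls, incl_incl]
  congr 1
  ext1 k; simp

lemma incl_sndDeriv (lam : ℝ) (a : Wiener 8) : incl (Nat.zero_le 2) (sndDeriv lam a)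
    = lap (by norm_num) (lap (n := 2) (by norm_num) a) + lap (by norm_num) (nls lam a)
      + (dnls lam (incl (Nat.zero_le 8) a) (lap (by norm_num) a)
        + potSnd lam (incl (Nat.zero_le 8) a)) := by
  rw [← dnls_nls, ← dnls_add, ← incl_fstDeriv, sndDeriv, map_add, incl_dnls, incl_incl, incl_incl]
  congr 1
  rw [fstDeriv, ← incl_nls]
  ext1 k; simp

section localError

variable {lam T ρ : ℝ} {w : ℝ → Wiener 8}

lemma isBigO_fst_of_isMildSol {θ : ℤ → ℝ} {G : Wiener m → Wiener m} {w : ℝ → Wiener m}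
    (hw : IsMildSol θ G T ρ w) :
    (fun p : ℝ × ℝ => w p.1) =O[𝓟 (steps T)] fun _ => (1 : ℝ) :=
  isBigO_principal.2 ⟨ρ, fun p hp => by
    obtain ⟨h1, h2, h3, h4⟩ := hp
    rw [norm_one, mul_one]
    exact hw.norm_le _ ⟨by linarith, by linarith⟩⟩

lemma isBigO_add_of_isMildSol {θ : ℤ → ℝ} {G : Wiener m → Wiener m} {w : ℝ → Wiener m}
    (hw : IsMildSol θ G T ρ w) :
    (fun p : ℝ × ℝ => w (p.1 + p.2)) =O[𝓟 (steps T)] fun _ => (1 : ℝ) :=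
  isBigO_principal.2 ⟨ρ, fun p hp => by
    obtain ⟨h1, h2, h3, h4⟩ := hp
    rw [norm_one, mul_one]
    exact hw.norm_le _ ⟨by linarith, by linarith⟩⟩

lemma isBigO_snd_one (T : ℝ) :
    (fun p : ℝ × ℝ => p.2) =O[𝓟 (steps T)] fun _ => (1 : ℝ) :=
  isBigO_principal.2 ⟨1, fun p hp => by
    rw [norm_one, mul_one, Real.norm_eq_abs, abs_of_nonneg hp.2.1]; exact hp.2.2.1⟩

/-- The second-order Taylor expansion of a solution of the limit system. -/
lemma isBigO_solution_sub_taylor (hw : IsMildSol schrFreq (nls lam) T ρ w) :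
    (fun p : ℝ × ℝ => incl (Nat.zero_le 8) (w (p.1 + p.2)) - (incl (Nat.zero_le 8) (w p.1)
      + p.2 • incl (Nat.zero_le 4) (fstDeriv lam (w p.1))
      + (p.2 ^ 2 / 2) • incl (Nat.zero_le 2) (sndDeriv lam (w p.1))))
      =O[𝓟 (steps T)] fun p => p.2 ^ 3 := by
  have h84 : 4 ≤ 8 := by norm_num
  have h42 : 2 ≤ 4 := by norm_num
  have h20 : 0 ≤ 2 := by norm_num
  have h80 : 0 ≤ 8 := by norm_num
  have h82 : 2 ≤ 8 := by norm_num
  have hb0 := isBigO_fst_of_isMildSol hw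
  have hb1 := isBigO_add_of_isMildSol hw
  have hF : ∀ {c : ℝ × ℝ → Wiener 8}, c =O[𝓟 (steps T)] (fun _ => (1 : ℝ)) →
      (fun p => fstDeriv lam (c p)) =O[𝓟 (steps T)] fun _ => (1 : ℝ) := fun hc =>
    (isBigO_lap _ hc).add (isBigO_nls (isBigO_incl _ hc))
  -- the solution as a differentiable function with values in `Wiener 4`
  have hd : ∀ p ∈ steps T, HasDerivAt (fun r => incl h84 (w (p.1 + r)))
      (fstDeriv lam (w (p.1 + p.2))) p.2 := fun p hp => by
    obtain ⟨h1, h2, h3, h4⟩ := hp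
    have := hw.hasDerivAt (n := 4) abs_schrFreq_le h84 (by norm_num)
      (isMult_schrFreq (by norm_num)) (t := p.1 + p.2) ⟨by linarith, h4⟩
    rw [incl_nls] at this
    exact this.comp_const_add p.1 p.2
  set e₁ : ℝ × ℝ → Wiener 4 := fun p => incl h84 (w (p.1 + p.2)) - incl h84 (w p.1) with he₁
  have d1 : ∀ p ∈ steps T, HasDerivAt (fun r => e₁ (p.1, r))
      (fstDeriv lam (w (p.1 + p.2))) p.2 := fun p hp => (hd p hp).sub_const (incl h84 (w p.1))
  have h1 : e₁ =O[𝓟 (steps T)] fun p => p.2 := by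
    have := isBigO_of_hasDerivAt (T := T) (f := e₁) (k := 0) d1 (fun t => by simp [he₁]) (by simpa using hF hb1)
    simpa using this
  have h1' : e₁ =O[𝓟 (steps T)] fun _ => (1 : ℝ) := h1.trans (isBigO_snd_one T)
  set e₂ : ℝ × ℝ → Wiener 2 := fun p => incl h42 (e₁ p) - p.2 • incl h42 (fstDeriv lam (w p.1))
    with he₂
  have d2 : ∀ p ∈ steps T, HasDerivAt (fun r => e₂ (p.1, r))
      (incl h42 (fstDeriv lam (w (p.1 + p.2))) - (1 : ℝ) • incl h42 (fstDeriv lam (w p.1))) p.2 :=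
    fun p hp => ((incl h42).hasFDerivAt.comp_hasDerivAt p.2 (d1 p hp)).sub
        ((hasDerivAt_id p.2).smul_const (incl h42 (fstDeriv lam (w p.1))))
  have h2 : e₂ =O[𝓟 (steps T)] fun p => p.2 ^ 2 := by
    refine isBigO_of_hasDerivAt (k := 1) d2 (fun t => by simp [he₂, he₁]) ?_
    · have key := (isBigO_lap (m := 4) (n := 2) le_rfl h1).add (isBigO_nls_sub (lam := lam)
        (isBigO_incl h82 hb0) (isBigO_incl h42 h1') (isBigO_incl h42 h1))
      refine (key.congr_left fun p => ?_).congr_right fun p => (pow_one p.2).symm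
      have e : incl h82 (w p.1) + incl h42 (e₁ p) = incl h82 (w (p.1 + p.2)) := by
        ext1 k; simp [he₁]
      rw [e, one_smul, fstDeriv, fstDeriv, map_add, map_add, incl_nls, incl_nls]
      have e' : ∀ a : Wiener 8, incl h42 (incl h84 a) = incl h82 a := fun a => by ext1 k; simp
      rw [e', e']
      generalize nls lam (incl h82 (w (p.1 + p.2))) = N
      generalize nls lam (incl h82 (w p.1)) = N'
      ext1 k
      simp [he₁]
      abel
  set e₃ : ℝ × ℝ → Wiener 0 := fun p => incl h20 (e₂ p)
    - (p.2 ^ 2 / 2) • incl h20 (sndDeriv lam (w p.1)) with he₃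
  have d3 : ∀ p ∈ steps T, HasDerivAt (fun r => e₃ (p.1, r)) (incl h20
      (incl h42 (fstDeriv lam (w (p.1 + p.2))) - (1 : ℝ) • incl h42 (fstDeriv lam (w p.1)))
      - p.2 • incl h20 (sndDeriv lam (w p.1))) p.2 := fun p hp => by
    have hq : HasDerivAt (fun r : ℝ => r ^ 2 / 2) p.2 p.2 := by
      simpa using ((hasDerivAt_id p.2).pow 2).div_const 2
    exact ((incl h20).hasFDerivAt.comp_hasDerivAt p.2 (d2 p hp)).sub
      (hq.smul_const (incl h20 (sndDeriv lam (w p.1))))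
  have h3 : e₃ =O[𝓟 (steps T)] fun p => p.2 ^ 3 := by
    refine isBigO_of_hasDerivAt (k := 2) d3 (fun t => by simp [he₃, he₂, he₁]) ?_
    · have h40 : 0 ≤ 4 := by norm_num
      have key := ((isBigO_lap (m := 2) (n := 0) le_rfl h2).add (isBigO_nls_add_sub (lam := lam)
        (isBigO_incl h80 hb0) (isBigO_incl h40 h1') (isBigO_incl h40 h1))).add
        (isBigO_dnls (lam := lam) (isBigO_incl h80 hb0) (isBigO_incl h20 h2))
      refine key.congr_left fun p => ?_
      have e : incl h80 (w p.1) + incl h40 (e₁ p) = incl h80 (w (p.1 + p.2)) := by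
        ext1 k; simp [he₁]
      have e5 : dnls lam (incl h80 (w p.1)) (incl h40 (e₁ p))
          = dnls lam (incl h80 (w p.1)) (incl h20 (e₂ p))
            + p.2 • dnls lam (incl h80 (w p.1)) (incl h40 (fstDeriv lam (w p.1))) := by
        rw [← dnls_smul, ← dnls_add]
        congr 1
        ext1 k; simp [he₂]
      have e' : ∀ a : Wiener 8, incl h20 (incl h82 a) = incl h80 a := fun a => by ext1 k; simp
      have e6 : ∀ a : Wiener 8, incl h20 (incl h42 (fstDeriv lam a))
          = lap (by norm_num) a + nls lam (incl h80 a) := fun a => by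
        rw [← e', ← incl_nls]
        have e' : ∀ a : Wiener 8, incl h42 (incl h84 a) = incl h82 a := fun a => by ext1 k; simp
        rw [← e', ← incl_nls, fstDeriv]
        ext1 k; simp
      have e7 : incl h20 (incl h42 (fstDeriv lam (w p.1))) = incl h40 (fstDeriv lam (w p.1)) := by
        ext1 k; simp
      have e8 : incl h20 (sndDeriv lam (w p.1)) = incl h20 (lap (by norm_num) (fstDeriv lam (w p.1)))
          + dnls lam (incl h80 (w p.1)) (incl h40 (fstDeriv lam (w p.1))) := by
        rw [sndDeriv, map_add, incl_dnls, e', e7]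
      rw [e, e5, one_smul, map_sub (incl h20) (incl h42 (fstDeriv lam (w (p.1 + p.2)))), e6, e6, e8]
      generalize nls lam (incl h80 (w (p.1 + p.2))) = N
      generalize nls lam (incl h80 (w p.1)) = N'
      generalize dnls lam (incl h80 (w p.1)) (incl h20 (e₂ p)) = M
      generalize dnls lam (incl h80 (w p.1)) (incl h40 (fstDeriv lam (w p.1))) = M'
      ext1 k
      simp [he₂, he₁]
      module
  refine h3.congr_left fun p => ?_
  ext1 k
  simp [he₃, he₂, he₁]
  abel

/-- One step of the semi-discrete Strang splitting, starting in a regular space. -/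
def strang (lam τ : ℝ) (a : Wiener 8) : Wiener 0 :=
  potFlow lam (τ / 2) (evo schrFreq τ (Nat.zero_le 8) (potFlow lam (τ / 2) a))

/-- The local error of the Strang splitting is of third order. -/
theorem isBigO_strang_sub (hw : IsMildSol schrFreq (nls lam) T ρ w) :
    (fun p : ℝ × ℝ => strang lam p.2 (w p.1) - incl (Nat.zero_le 8) (w (p.1 + p.2)))
      =O[𝓟 (steps T)] fun p => p.2 ^ 3 := by
  have h84 : 4 ≤ 8 := by norm_num
  have h20 : 0 ≤ 2 := by norm_num
  have h40 : 0 ≤ 4 := by norm_num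
  have h80 : 0 ≤ 8 := by norm_num
  have ha := isBigO_fst_of_isMildSol hw
  have hτ := isBigO_snd_one T
  have hs : (fun p : ℝ × ℝ => p.2 / 2) =O[𝓟 (steps T)] fun p => p.2 :=
    IsBigO.of_bound 1 (Eventually.of_forall fun p => by
      rw [norm_div, one_mul]; exact div_le_self (norm_nonneg _) (by norm_num))
  have hs2 : (fun p : ℝ × ℝ => (p.2 / 2) ^ 2 / 2) =O[𝓟 (steps T)] fun p => p.2 ^ 2 :=
    (IsBigO.of_bound 1 (Eventually.of_forall fun p => by
      rw [norm_div, one_mul]; exact div_le_self (norm_nonneg _) (by norm_num))).trans (hs.pow 2)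
  have hτ2 : (fun p : ℝ × ℝ => p.2 ^ 2 / 2) =O[𝓟 (steps T)] fun p => p.2 ^ 2 :=
    IsBigO.of_bound 1 (Eventually.of_forall fun p => by
      rw [norm_div, one_mul]; exact div_le_self (norm_nonneg _) (by norm_num))
  have h21 : (fun p : ℝ × ℝ => p.2 ^ 2) =O[𝓟 (steps T)] fun p => p.2 := by
    simpa [sq] using (isBigO_refl (fun p : ℝ × ℝ => p.2) (𝓟 (steps T))).mul hτ
  have h32 : (fun p : ℝ × ℝ => p.2 ^ 3) =O[𝓟 (steps T)] fun p => p.2 ^ 2 := by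
    have := (isBigO_refl (fun p : ℝ × ℝ => p.2 ^ 2) (𝓟 (steps T))).mul hτ
    exact this.congr (fun p => by ring) fun p => by ring
  have hmul : ∀ {j : ℕ} {b : ℝ × ℝ → Wiener j} {s : ℝ × ℝ → ℝ} {f g : ℝ × ℝ → ℝ},
      s =O[𝓟 (steps T)] f → b =O[𝓟 (steps T)] g →
      (fun p => s p • b p) =O[𝓟 (steps T)] fun p => f p * g p := fun hs hb => hs.smul hb
  -- the first potential substep
  set P : ℝ × ℝ → Wiener 8 := fun p => potFlow lam (p.2 / 2) (w p.1) with hP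
  have hB := isBigO_nls (lam := lam) ha
  have hD : (fun p : ℝ × ℝ => potSnd lam (w p.1)) =O[𝓟 (steps T)] fun _ => (1 : ℝ) := by
    simpa only [dnls_nls] using isBigO_dnls (lam := lam) ha hB
  have E1 : (fun p : ℝ × ℝ => P p - (w p.1 + (p.2 / 2) • nls lam (w p.1)
      + ((p.2 / 2) ^ 2 / 2) • potSnd lam (w p.1))) =O[𝓟 (steps T)] fun p => p.2 ^ 3 :=
    (isBigO_potFlow_sub_taylor (lam := lam) (hs.trans hτ) ha).trans (hs.pow 3)
  have P2 : (fun p : ℝ × ℝ => P p - (w p.1 + (p.2 / 2) • nls lam (w p.1)))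
      =O[𝓟 (steps T)] fun p => p.2 ^ 2 := by
    refine ((E1.trans h32).add (by simpa using hmul hs2 hD)).congr_left fun p => ?_
    abel
  have P1 : (fun p : ℝ × ℝ => P p - w p.1) =O[𝓟 (steps T)] fun p => p.2 := by
    refine ((P2.trans h21).add (by simpa using hmul hs hB)).congr_left fun p => ?_
    abel
  have P0 : P =O[𝓟 (steps T)] fun _ => (1 : ℝ) :=
    ((P1.trans hτ).add ha).congr_left fun p => by abel
  -- the kinetic substep
  set Q : ℝ × ℝ → Wiener 0 := fun p => evo schrFreq p.2 h80 (P p) with hQ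
  have E2 : (fun p : ℝ × ℝ => Q p - (incl h80 (P p) + p.2 • lap (by norm_num) (P p)
      + (p.2 ^ 2 / 2) • lap (by norm_num) (lap (n := 2) (by norm_num) (P p))))
      =O[𝓟 (steps T)] fun p => p.2 ^ 3 := by
    have i := (isBigO_refl (fun p : ℝ × ℝ => p.2 ^ 3) (𝓟 (steps T))).mul P0.norm_left
    refine IsBigO.trans (IsBigO.of_bound 1 (Eventually.of_forall fun p => ?_))
      (i.congr_right fun p => mul_one _)
    rw [norm_mul, norm_pow, norm_norm, one_mul, Real.norm_eq_abs]
    exact norm_evo_sub_taylor_le _ _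
  set q₁ : ℝ × ℝ → Wiener 0 := fun p =>
    lap (by norm_num) (w p.1) + (1 / 2 : ℝ) • nls lam (incl h80 (w p.1)) with hq₁
  set q₂ : ℝ × ℝ → Wiener 0 := fun p =>
    (1 / 2 : ℝ) • lap (by norm_num) (lap (n := 2) (by norm_num) (w p.1))
      + (1 / 2 : ℝ) • lap (by norm_num) (nls lam (w p.1))
      + (1 / 8 : ℝ) • potSnd lam (incl h80 (w p.1)) with hq₂
  have hq1 : q₁ =O[𝓟 (steps T)] fun _ => (1 : ℝ) :=
    (isBigO_lap _ ha).add ((isBigO_nls (isBigO_incl _ ha)).const_smul_left _)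
  have hD0 : (fun p : ℝ × ℝ => potSnd lam (incl h80 (w p.1))) =O[𝓟 (steps T)]
      fun _ => (1 : ℝ) := by
    simpa only [incl_potSnd] using isBigO_incl h80 hD
  have hq2 : q₂ =O[𝓟 (steps T)] fun _ => (1 : ℝ) :=
    (((isBigO_lap _ (isBigO_lap _ ha)).const_smul_left _).add
      ((isBigO_lap _ hB).const_smul_left _)).add (hD0.const_smul_left _)
  have Q3 : (fun p => Q p - (incl h80 (w p.1) + p.2 • q₁ p + p.2 ^ 2 • q₂ p))
      =O[𝓟 (steps T)] fun p => p.2 ^ 3 := by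
    have i1 := hmul (isBigO_refl (fun p : ℝ × ℝ => p.2) (𝓟 (steps T)))
      (isBigO_lap (n := 0) (by norm_num) P2)
    have i2 := hmul hτ2 (isBigO_lap (n := 0) (by norm_num) (isBigO_lap (n := 2) (by norm_num) P1))
    have := ((E2.add (isBigO_incl h80 E1)).add (i1.congr_right fun p => by ring)).add
      (i2.congr_right fun p => by ring)
    refine this.congr_left fun p => ?_
    rw [hq₁, hq₂]
    simp only [← incl_nls, ← incl_potSnd]
    generalize nls lam (w p.1) = B
    generalize potSnd lam (w p.1) = D
    generalize Q p = q
    ext1 k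
    simp only [coeff_add, coeff_sub, coeff_real_smul, coeff_incl, coeff_lap]
    module
  have Q2 : (fun p => Q p - incl h80 (w p.1) - p.2 • q₁ p) =O[𝓟 (steps T)] fun p => p.2 ^ 2 := by
    have i := hmul (isBigO_refl (fun p : ℝ × ℝ => p.2 ^ 2) _) hq2
    refine ((Q3.trans h32).add (i.congr_right fun p => mul_one _)).congr_left fun p => ?_
    abel
  have Q1 : (fun p => Q p - incl h80 (w p.1)) =O[𝓟 (steps T)] fun p => p.2 := by
    have i := hmul (isBigO_refl (fun p : ℝ × ℝ => p.2) _) hq1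
    refine ((Q2.trans h21).add (i.congr_right fun p => mul_one _)).congr_left fun p => ?_
    abel
  have ha0 := isBigO_incl h80 ha
  have Q0 : Q =O[𝓟 (steps T)] fun _ => (1 : ℝ) :=
    ((Q1.trans hτ).add ha0).congr_left fun p => by abel
  -- the second potential substep
  have E3 : (fun p : ℝ × ℝ => potFlow lam (p.2 / 2) (Q p) - (Q p + (p.2 / 2) • nls lam (Q p)
      + ((p.2 / 2) ^ 2 / 2) • potSnd lam (Q p))) =O[𝓟 (steps T)] fun p => p.2 ^ 3 :=
    (isBigO_potFlow_sub_taylor (lam := lam) (hs.trans hτ) Q0).trans (hs.pow 3)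
  have N2 := hmul hs (isBigO_nls_add_sub (lam := lam) ha0 (Q1.trans hτ) Q1)
  have N1 := hmul hs (isBigO_dnls (lam := lam) ha0 Q2)
  have N0 := hmul hs2 (isBigO_potSnd_sub (lam := lam) Q0 ha0 Q1)
  have R := (((E3.add Q3).add (N2.congr_right fun p => by ring)).add
    (N1.congr_right fun p => by ring)).add (N0.congr_right fun p => by ring)
  have key := R.sub (isBigO_solution_sub_taylor hw)
  refine key.congr_left fun p => ?_
  have e0 : incl h80 (w p.1) + (Q p - incl h80 (w p.1)) = Q p := by abel
  have e1 : dnls lam (incl h80 (w p.1)) (Q p - incl h80 (w p.1))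
      = dnls lam (incl h80 (w p.1)) (Q p - incl h80 (w p.1) - p.2 • q₁ p)
        + p.2 • dnls lam (incl h80 (w p.1)) (q₁ p) := by
    rw [← dnls_smul, ← dnls_add]; congr 1; abel
  have e2 : dnls lam (incl h80 (w p.1)) (q₁ p) = dnls lam (incl h80 (w p.1))
      (lap (by norm_num) (w p.1)) + (1 / 2 : ℝ) • potSnd lam (incl h80 (w p.1)) := by
    rw [hq₁, dnls_add, dnls_smul, dnls_nls]
  rw [e0, e1, e2, incl_fstDeriv, incl_sndDeriv, strang]
  change _ = potFlow lam (p.2 / 2) (Q p) - _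
  rw [hq₁, hq₂]
  module

end localError

variable {K : ℕ}

/-! ### Trigonometric interpolation -/

lemma bmod_mem_freqs (hK : 0 < K) (k : ℤ) : k.bmod K ∈ freqs K := by
  have h1 := Int.le_bmod (x := k) hK
  have h2 := Int.bmod_lt (x := k) hK
  rw [freqs, Finset.mem_Ico]
  omega

lemma bmod_of_mem_freqs {k : ℤ} (hk : k ∈ freqs K) : k.bmod K = k := by
  rw [freqs, Finset.mem_Ico] at hk
  exact Int.bmod_eq_of_le (by omega) (by omega)

lemma le_two_mul_wt_of_notMem_freqs {k : ℤ} (hk : k ∉ freqs K) : (K : ℝ) ≤ 2 * wt k := by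
  rw [freqs, Finset.mem_Ico, not_and_or, not_le, not_lt] at hk
  have h : (K : ℤ) ≤ 2 * |k| + 2 := by
    rcases abs_cases k with ⟨h, _⟩ | ⟨h, _⟩ <;> omega
  have h' : (K : ℝ) ≤ 2 * |(k : ℝ)| + 2 := by exact_mod_cast h
  rw [wt]; linarith

lemma wt_bmod_le (hK : 0 < K) (k : ℤ) : wt (k.bmod K) ≤ wt k := by
  by_cases hk : k ∈ freqs K
  · rw [bmod_of_mem_freqs hk]
  · have h1 := Int.le_bmod (x := k) hK
    have h2 := Int.bmod_lt (x := k) hK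
    rw [freqs, Finset.mem_Ico, not_and_or, not_le, not_lt] at hk
    have h : |k.bmod K| ≤ |k| := by
      rcases abs_cases k with ⟨h, _⟩ | ⟨h, _⟩ <;>
        rcases abs_cases (k.bmod K) with ⟨h', _⟩ | ⟨h', _⟩ <;> omega
    have h' : |((k.bmod K : ℤ) : ℝ)| ≤ |(k : ℝ)| := by exact_mod_cast h
    rw [wt, wt]; linarith

lemma mode_add_mul_gridPoint (hK : 0 < K) (j : ℕ) {k l : ℤ} (h : (K : ℤ) ∣ k - l) :
    mode k (gridPoint K j) = mode l (gridPoint K j) := by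
  obtain ⟨q, hq⟩ := h
  have hK' : (K : ℂ) ≠ 0 := by exact_mod_cast hK.ne'
  have e : k = l + K * q := by omega
  have e1 : mode (K * q) (gridPoint K j) = 1 := by
    rw [mode, gridPoint, Complex.exp_eq_one_iff]
    refine ⟨q * j, ?_⟩
    push_cast
    field_simp
  rw [e, mode_add, e1, mul_one]

/-- Discrete orthogonality of the Fourier modes on the grid. -/
lemma sum_mode_gridPoint_eq_zero (hK : 0 < K) {d : ℤ} (hd : ¬ (K : ℤ) ∣ d) :
    ∑ j ∈ Finset.range K, mode d (gridPoint K j) = 0 := by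
  have hK' : (K : ℂ) ≠ 0 := by exact_mod_cast hK.ne'
  have hpow : ∀ j : ℕ, mode d (gridPoint K j) = mode d (gridPoint K 1) ^ j := fun j => by
    rw [mode, mode, ← Complex.exp_nat_mul, gridPoint, gridPoint]
    congr 1
    push_cast
    ring
  have h1 : mode d (gridPoint K 1) ^ K = 1 := by
    rw [← hpow, mode, gridPoint, Complex.exp_eq_one_iff]
    refine ⟨d, ?_⟩
    push_cast
    field_simp
  have hne : mode d (gridPoint K 1) ≠ 1 := by
    intro h
    rw [mode, gridPoint, Complex.exp_eq_one_iff] at h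
    obtain ⟨q, hq⟩ := h
    refine hd ⟨q, ?_⟩
    have hpi : (2 * Real.pi * Complex.I : ℂ) ≠ 0 := Complex.two_pi_I_ne_zero
    have : (d : ℂ) = K * q := by
      push_cast at hq
      refine mul_right_cancel₀ hpi ?_
      rw [mul_assoc (K : ℂ), ← hq]
      field_simp
    exact_mod_cast this
  rw [Finset.sum_congr rfl fun j _ => hpow j]
  have := geom_sum_mul (mode d (gridPoint K 1)) K
  rw [h1, sub_self] at this
  exact (mul_eq_zero.1 this).resolve_right (sub_ne_zero.2 hne)

lemma not_dvd_sub_of_mem_freqs {k l : ℤ} (hk : k ∈ freqs K) (hl : l ∈ freqs K) (h : k ≠ l) :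
    ¬ (K : ℤ) ∣ k - l := by
  rw [freqs, Finset.mem_Ico] at hk hl
  intro hd
  have := Int.eq_zero_of_abs_lt_dvd hd (by rw [abs_lt]; omega)
  omega

/-- The pair of functions `x ↦ v e^{ikx}`. -/
def single (k : ℤ) (v : ℂ × ℂ) : Wiener m :=
  mk (Pi.single k v) (summable_of_ne_finset_zero (s := {k}) fun j hj => by
    rw [Pi.single_eq_of_ne (by simpa using hj), norm_zero, mul_zero])

lemma coeff_single (k : ℤ) (v : ℂ × ℂ) (j : ℤ) :
    (single k v : Wiener m).coeff j = if j = k then v else 0 := by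
  rw [single, coeff_mk, Pi.single_apply]

lemma norm_single (k : ℤ) (v : ℂ × ℂ) : ‖(single k v : Wiener m)‖ = wt k ^ m * ‖v‖ := by
  rw [norm_eq_tsum, tsum_eq_single k fun j hj => by simp [coeff_single, hj]]
  simp [coeff_single]

lemma single_add (k : ℤ) (v v' : ℂ × ℂ) :
    (single k (v + v') : Wiener m) = single k v + single k v' := by
  ext1 j
  rw [coeff_add, coeff_single, coeff_single, coeff_single]
  split_ifs <;> simp

lemma single_smul (k : ℤ) (c : ℝ) (v : ℂ × ℂ) :
    (single k (c • v) : Wiener m) = c • single k v := by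
  ext1 j
  rw [coeff_real_smul, coeff_single, coeff_single]
  split_ifs <;> simp

/-- The `k`-th coefficient as a continuous linear map. -/
def coeffL (k : ℤ) : Wiener m →L[ℝ] ℂ × ℂ :=
  LinearMap.mkContinuous
    { toFun := fun a => a.coeff k
      map_add' := fun a b => coeff_add a b k
      map_smul' := fun c a => by simp } 1 fun a => by simpa using norm_coeff_le a k

lemma coeffL_apply (k : ℤ) (a : Wiener m) : coeffL k a = a.coeff k := rfl

lemma norm_single_bmod_le (hK : 0 < K) (a : Wiener m) (k : ℤ) :
    ‖(single (k.bmod K) (a.coeff k) : Wiener m)‖ ≤ wt k ^ m * ‖a.coeff k‖ := by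
  rw [norm_single]
  exact mul_le_mul_of_nonneg_right (pow_le_pow_left₀ (wt_pos _).le (wt_bmod_le hK k) m)
    (norm_nonneg _)

lemma summable_single_bmod (hK : 0 < K) (a : Wiener m) :
    Summable fun k => (single (k.bmod K) (a.coeff k) : Wiener m) :=
  a.summable_norm.of_norm_bounded (norm_single_bmod_le hK a)

/-- Trigonometric interpolation at the `K` grid points. In Fourier space it moves the `k`-th
coefficient to the frequency in `freqs K` congruent to `k`. -/
def interp (hK : 0 < K) : Wiener m →L[ℝ] Wiener m :=
  LinearMap.mkContinuous
    { toFun := fun a => ∑' k : ℤ, single (k.bmod K) (a.coeff k)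
      map_add' := fun a b => by
        rw [← (summable_single_bmod hK a).tsum_add (summable_single_bmod hK b)]
        exact tsum_congr fun k => by rw [coeff_add, single_add]
      map_smul' := fun c a => by
        rw [RingHom.id_apply, ← tsum_const_smul'' c]
        exact tsum_congr fun k => by rw [coeff_real_smul, single_smul] }
    1 fun a => by
      rw [one_mul, norm_eq_tsum a]
      exact tsum_of_norm_bounded a.summable_norm.hasSum (norm_single_bmod_le hK a)

lemma interp_apply (hK : 0 < K) (a : Wiener m) :
    interp hK a = ∑' k : ℤ, single (k.bmod K) (a.coeff k) := rfl

lemma norm_interp_le (hK : 0 < K) (a : Wiener m) : ‖interp hK a‖ ≤ ‖a‖ := by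
  rw [interp_apply, norm_eq_tsum a]
  exact tsum_of_norm_bounded a.summable_norm.hasSum (norm_single_bmod_le hK a)

lemma coeff_interp (hK : 0 < K) (a : Wiener m) (l : ℤ) :
    (interp hK a).coeff l = ∑' k : ℤ, if l = k.bmod K then a.coeff k else 0 := by
  rw [interp_apply, ← coeffL_apply, (coeffL l).map_tsum (summable_single_bmod hK a)]
  exact tsum_congr fun k => by rw [coeffL_apply, coeff_single]

/-- Trigonometric polynomials with frequencies in `freqs K`. -/
def IsTrigPoly (K : ℕ) (a : Wiener m) : Prop := ∀ k ∉ freqs K, a.coeff k = 0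

lemma isTrigPoly_interp (hK : 0 < K) (a : Wiener m) : IsTrigPoly K (interp hK a) := by
  intro l hl
  rw [coeff_interp]
  refine (tsum_congr fun k => if_neg ?_).trans tsum_zero
  rintro rfl
  exact hl (bmod_mem_freqs hK k)

lemma incl_interp (hK : 0 < K) (h : n ≤ m) (a : Wiener m) :
    incl h (interp hK a) = interp hK (incl h a) := by
  ext1 l; simp [coeff_interp]

lemma IsTrigPoly.evo {a : Wiener m} (ha : IsTrigPoly K a) (θ : ℤ → ℝ) (t : ℝ) (h : n ≤ m) :
    IsTrigPoly K (evo θ t h a) := fun k hk => by rw [coeff_evo, ha k hk, smul_zero]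

lemma IsTrigPoly.ev_eq_sum {a : Wiener m} (ha : IsTrigPoly K a) (x : ℝ) :
    ev x a = ∑ k ∈ freqs K, mode k x • a.coeff k := by
  rw [ev_eq_tsum]
  exact tsum_eq_sum fun k hk => by rw [ha k hk, smul_zero]

lemma ev_single (x : ℝ) (k : ℤ) (v : ℂ × ℂ) : ev x (single k v : Wiener m) = mode k x • v := by
  rw [ev_eq_tsum, tsum_eq_single k fun j hj => by simp [coeff_single, hj]]
  simp [coeff_single]

lemma ev_interp (hK : 0 < K) (a : Wiener m) (j : ℕ) :
    ev (gridPoint K j) (interp hK a) = ev (gridPoint K j) a := by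
  rw [interp_apply, (summable_single_bmod hK a).map_tsum (ev (gridPoint K j)) (continuous_ev _),
    ev_eq_tsum]
  refine tsum_congr fun k => ?_
  rw [ev_single, mode_add_mul_gridPoint hK j Int.dvd_bmod_sub_self]

/-- Aliasing: the interpolation error is small for regular functions. -/
lemma norm_incl_sub_interp_le (hK : 0 < K) {q : ℕ} (h : n + q ≤ m) (a : Wiener m) :
    ‖incl (by omega : n ≤ m) (a - interp hK a)‖ ≤ 2 ^ (q + 1) * (1 / (K : ℝ)) ^ q * ‖a‖ := by
  have hnm : n ≤ m := by omega
  have hKr : (0 : ℝ) < K := by exact_mod_cast hK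
  have hb : ∀ k : ℤ, ‖(single k (a.coeff k) : Wiener n) - single (k.bmod K) (a.coeff k)‖
      ≤ 2 ^ (q + 1) * (1 / (K : ℝ)) ^ q * (wt k ^ m * ‖a.coeff k‖) := fun k => by
    by_cases hk : k ∈ freqs K
    · rw [bmod_of_mem_freqs hk, sub_self, norm_zero]
      exact mul_nonneg (by positivity) (mul_nonneg (wt_pow_pos m k).le (norm_nonneg _))
    · refine (norm_sub_le _ _).trans ?_
      rw [norm_single, norm_single]
      have h1 : wt (k.bmod K) ^ n ≤ wt k ^ n :=
        pow_le_pow_left₀ (wt_pos _).le (wt_bmod_le hK k) n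
      have h2 : (1 : ℝ) ≤ 2 ^ q * (1 / (K : ℝ)) ^ q * wt k ^ q := by
        rw [← mul_pow, ← mul_pow]
        refine one_le_pow₀ ?_
        have := le_two_mul_wt_of_notMem_freqs hk
        rw [mul_one_div, div_mul_eq_mul_div, le_div_iff₀ hKr]
        linarith
      have h3 : wt k ^ n ≤ 2 ^ q * (1 / (K : ℝ)) ^ q * wt k ^ m := by
        calc wt k ^ n ≤ 2 ^ q * (1 / (K : ℝ)) ^ q * wt k ^ q * wt k ^ n :=
              le_mul_of_one_le_left (wt_pow_pos n k).le h2
          _ = 2 ^ q * (1 / (K : ℝ)) ^ q * wt k ^ (n + q) := by ring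
          _ ≤ _ := mul_le_mul_of_nonneg_left (pow_le_pow_right₀ (one_le_wt k) h) (by positivity)
      have h4 := mul_le_mul_of_nonneg_right (add_le_add h3 (h1.trans h3)) (norm_nonneg (a.coeff k))
      rw [← add_mul]
      refine h4.trans (le_of_eq ?_)
      ring
  have e : incl hnm (a - interp hK a)
      = ∑' k : ℤ, ((single k (a.coeff k) : Wiener n) - single (k.bmod K) (a.coeff k)) := by
    have hs := (a.summable_norm.mul_left (2 ^ (q + 1) * (1 / (K : ℝ)) ^ q)).of_norm_bounded hb
    ext1 l
    rw [← coeffL_apply l (∑' k : ℤ, _), (coeffL l).map_tsum hs, coeff_incl, coeff_sub, coeff_interp]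
    have s1 : Summable fun k : ℤ => if l = k then a.coeff k else 0 :=
      summable_of_ne_finset_zero (s := {l}) fun k hk => if_neg fun h => hk (by simp [h])
    have s2 : Summable fun k : ℤ => if l = k.bmod K then a.coeff k else 0 :=
      a.summable_coeff_norm.of_norm_bounded fun k => by split_ifs <;> simp
    rw [← tsum_ite_eq' l a.coeff, ← s1.tsum_sub s2]
    refine tsum_congr fun k => ?_
    rw [map_sub, coeffL_apply, coeffL_apply, coeff_single, coeff_single]
  rw [e, norm_eq_tsum a, ← tsum_mul_left]
  exact tsum_of_norm_bounded (a.summable_norm.mul_left _).hasSum hb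

/-- The discrete Fourier coefficients of a trigonometric polynomial are its coefficients. -/
lemma IsTrigPoly.sum_ev_gridPoint {a : Wiener m} (ha : IsTrigPoly K a) (hK : 0 < K) {k : ℤ}
    (hk : k ∈ freqs K) :
    ∑ j ∈ Finset.range K, mode (-k) (gridPoint K j) • ev (gridPoint K j) a
      = (K : ℂ) • a.coeff k := by
  have e : ∀ j, mode (-k) (gridPoint K j) • ev (gridPoint K j) a
      = ∑ l ∈ freqs K, mode (l - k) (gridPoint K j) • a.coeff l := fun j => by
    rw [ha.ev_eq_sum, Finset.smul_sum]
    refine Finset.sum_congr rfl fun l _ => ?_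
    rw [smul_smul, ← mode_add]
    congr 2; ring
  rw [Finset.sum_congr rfl fun j _ => e j, Finset.sum_comm, Finset.sum_eq_single k]
  · rw [Finset.sum_congr rfl fun j _ => by rw [sub_self, mode_zero_left, one_smul],
      Finset.sum_const, Finset.card_range, Nat.cast_smul_eq_nsmul]
  · intro l hl hlk
    rw [← Finset.sum_smul, sum_mode_gridPoint_eq_zero hK (not_dvd_sub_of_mem_freqs hl hk hlk),
      zero_smul]
  · exact fun h => absurd hk h

lemma IsTrigPoly.ext_gridPoint {a b : Wiener m} (ha : IsTrigPoly K a) (hb : IsTrigPoly K b)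
    (hK : 0 < K) (h : ∀ j, ev (gridPoint K j) a = ev (gridPoint K j) b) : a = b := by
  have hK' : (K : ℂ) ≠ 0 := by exact_mod_cast hK.ne'
  ext1 k
  by_cases hk : k ∈ freqs K
  · refine smul_right_injective _ hK' ?_
    simp only
    rw [← ha.sum_ev_gridPoint hK hk, ← hb.sum_ev_gridPoint hK hk]
    exact Finset.sum_congr rfl fun j _ => by rw [h]
  · rw [ha k hk, hb k hk]

/-- The interpolant depends on the grid values only. -/
lemma interp_congr (hK : 0 < K) {a b : Wiener m}
    (h : ∀ j, ev (gridPoint K j) a = ev (gridPoint K j) b) : interp hK a = interp hK b :=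
  (isTrigPoly_interp hK a).ext_gridPoint (isTrigPoly_interp hK b) hK fun j => by
    rw [ev_interp, ev_interp, h]

/-! ### The numerical scheme in Fourier space -/

/-- The pair of functions on the line with the given Fourier coefficients. -/
def funPair (a : Wiener m) : (ℝ → ℂ) × (ℝ → ℂ) := (fun x => (ev x a).1, fun x => (ev x a).2)

lemma IsTrigPoly.dftCoeff_eq {a : Wiener m} (ha : IsTrigPoly K a) (hK : 0 < K)
    (π : ℂ × ℂ →ₗ[ℂ] ℂ) {f : ℝ → ℂ} (hf : ∀ j, f (gridPoint K j) = π (ev (gridPoint K j) a))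
    {k : ℤ} (hk : k ∈ freqs K) : dftCoeff K f k = π (a.coeff k) := by
  have hK' : (K : ℂ) ≠ 0 := by exact_mod_cast hK.ne'
  have h := congrArg π (ha.sum_ev_gridPoint hK hk)
  rw [map_sum, map_smul, smul_eq_mul] at h
  rw [dftCoeff, Finset.sum_congr rfl fun j _ => (?_ : _ = π (mode (-k) (gridPoint K j) •
    ev (gridPoint K j) a)), h, ← mul_assoc, one_div, inv_mul_cancel₀ hK', one_mul]
  rw [map_smul, hf, smul_eq_mul, mul_comm]

lemma trigInterp_eq (hK : 0 < K) (a : Wiener m) (π : ℂ × ℂ →ₗ[ℂ] ℂ) {f : ℝ → ℂ}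
    (hf : ∀ j, f (gridPoint K j) = π (ev (gridPoint K j) a)) (x : ℝ) :
    trigInterp K f x = π (ev x (interp hK a)) := by
  have ha := isTrigPoly_interp hK a
  rw [trigInterp, ha.ev_eq_sum, map_sum]
  refine Finset.sum_congr rfl fun k hk => ?_
  rw [ha.dftCoeff_eq hK π (fun j => by rw [ev_interp, hf]) hk, map_smul, smul_eq_mul, mul_comm]

lemma IsTrigPoly.kineticFlow_eq {a : Wiener m} (ha : IsTrigPoly K a) (hK : 0 < K)
    (π : ℂ × ℂ →ₗ[ℂ] ℂ) (t x : ℝ) :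
    kineticFlow K t (fun x => π (ev x a)) x = π (ev x (Wiener.evo schrFreq t le_rfl a)) := by
  rw [kineticFlow, (ha.evo schrFreq t le_rfl).ev_eq_sum, map_sum]
  refine Finset.sum_congr rfl fun k hk => ?_
  rw [ha.dftCoeff_eq hK π (fun j => rfl) hk, coeff_evo, map_smul, map_smul, smul_eq_mul,
    smul_eq_mul, phase, schrFreq]
  push_cast
  ring_nf

lemma ev_potFlow (lam t x : ℝ) (a : Wiener m) :
    ev x (potFlow lam t a) = potentialFlow lam t (ev x a) := by
  have h : ∀ z : ℂ, z * star z = ((‖z‖ ^ 2 : ℝ) : ℂ) := fun z => by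
    rw [Complex.ofReal_pow]; exact Complex.mul_conj' z
  rw [potFlow, map_mul, ev_exp, potGen, map_smul, pot, map_smul, map_add, map_smul, ev_swap,
    map_mul, ev_conj, potentialFlow]
  generalize ev x a = w
  ext
  · rw [Prod.fst_mul, Prod.fst_exp, ← Complex.exp_eq_exp_ℂ]
    simp only [Prod.smul_fst, Prod.fst_add, Prod.fst_mul, Prod.fst_star, Prod.fst_swap,
      Prod.snd_mul, Prod.snd_star, h, smul_eq_mul]
    push_cast
    ring_nf
  · rw [Prod.snd_mul, Prod.snd_exp, ← Complex.exp_eq_exp_ℂ]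
    simp only [Prod.smul_snd, Prod.snd_add, Prod.fst_mul, Prod.fst_star, Prod.snd_swap,
      Prod.snd_mul, Prod.snd_star, h, smul_eq_mul]
    push_cast
    ring_nf

lemma potentialStep_funPair (lam : ℝ) (hK : 0 < K) (t : ℝ) (a : Wiener m) :
    potentialStep lam K t (funPair a) = funPair (interp hK (potFlow lam t a)) := by
  ext x
  · exact trigInterp_eq hK (potFlow lam t a) (LinearMap.fst ℂ ℂ ℂ)
      (fun j => by rw [ev_potFlow]; rfl) x
  · exact trigInterp_eq hK (potFlow lam t a) (LinearMap.snd ℂ ℂ ℂ)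
      (fun j => by rw [ev_potFlow]; rfl) x

lemma kineticStep_funPair (hK : 0 < K) (t : ℝ) {a : Wiener m} (ha : IsTrigPoly K a) :
    kineticStep K t (funPair a) = funPair (evo schrFreq t le_rfl a) := by
  ext x
  · exact ha.kineticFlow_eq hK (LinearMap.fst ℂ ℂ ℂ) t x
  · exact ha.kineticFlow_eq hK (LinearMap.snd ℂ ℂ ℂ) t x

/-- One step of the fully discrete splitting, acting on Fourier coefficients. -/
def discreteStrang (lam τ : ℝ) (hK : 0 < K) (a : Wiener 0) : Wiener 0 :=
  interp hK (potFlow lam (τ / 2) (evo schrFreq τ le_rfl (interp hK (potFlow lam (τ / 2) a))))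

lemma strangStep_funPair (lam τ : ℝ) (hK : 0 < K) (a : Wiener 0) :
    strangStep lam K τ (funPair a) = funPair (discreteStrang lam τ hK a) := by
  rw [strangStep, potentialStep_funPair lam hK, kineticStep_funPair hK τ (isTrigPoly_interp hK _),
    potentialStep_funPair lam hK, discreteStrang]

lemma strangSolution_eq_funPair (lam τ : ℝ) (hK : 0 < K) {φ γ : ℝ → ℂ} {Φ Γ : Wiener m}
    (hΦ : ∀ x, ev x Φ = (φ x, (starRingEnd ℂ) (φ x)))
    (hΓ : ∀ x, ev x Γ = (γ x, (starRingEnd ℂ) (γ x))) (n : ℕ) :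
    strangSolution lam K τ φ γ n = funPair ((discreteStrang lam τ hK)^[n]
      (interp hK (incl (Nat.zero_le m) (Φ - Complex.I • Γ)))) := by
  have h0 : discreteInit K φ γ = funPair (interp hK (incl (Nat.zero_le m) (Φ - Complex.I • Γ))) := by
    ext x
    · exact trigInterp_eq hK (incl (Nat.zero_le m) (Φ - Complex.I • Γ)) (LinearMap.fst ℂ ℂ ℂ)
        (fun j => by simp [ev_incl, hΦ, hΓ]) x
    · exact trigInterp_eq hK (incl (Nat.zero_le m) (Φ - Complex.I • Γ)) (LinearMap.snd ℂ ℂ ℂ)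
        (fun j => by simp [ev_incl, hΦ, hΓ, sub_eq_add_neg]) x
  rw [strangSolution, h0]
  induction n with
  | zero => rfl
  | succ n ih => rw [Function.iterate_succ_apply', ih, strangStep_funPair _ _ hK,
      Function.iterate_succ_apply']

/-- As interpolation preserves grid values, it may be inserted before a potential substep. -/
lemma interp_potFlow_interp (lam t : ℝ) (hK : 0 < K) (a : Wiener m) :
    interp hK (potFlow lam t (interp hK a)) = interp hK (potFlow lam t a) :=
  interp_congr hK fun j => by rw [ev_potFlow, ev_potFlow, ev_interp]

lemma norm_evo_schrFreq_sub_le (t : ℝ) (h : n + 2 ≤ m) (a : Wiener m) :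
    ‖evo schrFreq t (by omega : n ≤ m) a - incl (by omega) a‖ ≤ |t| * ‖a‖ := by
  have hb : MultBound m n |t| (fun k => phase schrFreq t k - 1) :=
    MultBound.of_growth (q := 2) (fun k => (norm_phase_sub_one_le _ _ _).trans
      (mul_le_mul_of_nonneg_left (by simpa using abs_schrFreq_le k) (abs_nonneg t))) h
  refine le_trans (le_of_eq ?_) (norm_mult_le hb.isMult hb a)
  congr 1
  ext1 k
  simp [sub_smul]

/-- The commutator of interpolation and kinetic flow gains a factor `t`. -/
lemma norm_commutator_le (t : ℝ) (hK : 0 < K) {q : ℕ} (h : q + 2 ≤ m) (p : Wiener m) :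
    ‖evo schrFreq t le_rfl (interp hK (incl (Nat.zero_le m) p))
        - interp hK (evo schrFreq t (Nat.zero_le m) p)‖
      ≤ 2 * 2 ^ (q + 1) * (1 / (K : ℝ)) ^ q * |t| * ‖p‖ := by
  have h2 : 2 ≤ m := by omega
  have hq : q ≤ m := by omega
  have e : evo schrFreq t le_rfl (interp hK (incl (Nat.zero_le m) p))
        - interp hK (evo schrFreq t (Nat.zero_le m) p)
      = incl (Nat.zero_le q) ((evo schrFreq t hq p - incl hq p)
          - interp hK (evo schrFreq t hq p - incl hq p))
        - (evo schrFreq t (Nat.zero_le 2) (incl h2 (p - interp hK p))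
          - incl (Nat.zero_le 2) (incl h2 (p - interp hK p))) := by
    simp only [map_sub, incl_interp]
    have e1 : incl (Nat.zero_le q) (evo schrFreq t hq p) = evo schrFreq t (Nat.zero_le m) p := by
      ext1 k; simp
    have e2 : evo schrFreq t (Nat.zero_le 2) (incl h2 p) = evo schrFreq t (Nat.zero_le m) p := by
      ext1 k; simp
    have e3 : evo schrFreq t (Nat.zero_le 2) (interp hK (incl h2 p))
        = evo schrFreq t le_rfl (interp hK (incl (Nat.zero_le m) p)) := by
      ext1 k; simp [coeff_interp]
    rw [e1, e2, e3, incl_incl, incl_incl]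
    abel
  rw [e]
  refine (norm_sub_le _ _).trans ?_
  have b1 := norm_incl_sub_interp_le hK (n := 0) (q := q) (by omega : 0 + q ≤ q)
    (evo schrFreq t hq p - incl hq p)
  have b2 := norm_evo_schrFreq_sub_le (m := 2) (n := 0) t (by norm_num) (incl h2 (p - interp hK p))
  have b3 := norm_incl_sub_interp_le hK (n := 2) (q := q) (by omega : 2 + q ≤ m) p
  have b4 := mul_le_mul_of_nonneg_left (norm_evo_schrFreq_sub_le t h p)
    (by positivity : (0 : ℝ) ≤ 2 ^ (q + 1) * (1 / (K : ℝ)) ^ q)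
  have b5 := mul_le_mul_of_nonneg_left b3 (abs_nonneg t)
  refine (add_le_add (b1.trans b4) (b2.trans b5)).trans (le_of_eq ?_)
  ring

/-! ### The global error of the scheme -/

lemma IsMildSol.incl_nls {θ : ℤ → ℝ} {lam T ρ : ℝ} {w : ℝ → Wiener m}
    (hw : IsMildSol θ (nls lam) T ρ w) (h : n ≤ m) :
    IsMildSol θ (nls lam) T ρ (fun t => incl h (w t)) where
  norm_le t ht := (norm_incl_le _ _).trans (hw.norm_le t ht)
  continuousOn := (incl h).continuous.comp_continuousOn hw.continuousOn
  hasDerivAt_profile t ht := by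
    have h1 := (incl h).hasFDerivAt.comp_hasDerivAt t (hw.hasDerivAt_profile t ht)
    have e : ∀ (s : ℝ) (a : Wiener m), incl h (evo θ s le_rfl a) = evo θ s le_rfl (incl h a) :=
      fun s a => by ext1 k; simp
    rw [e, Wiener.incl_nls] at h1
    exact h1.congr_of_eventuallyEq (Eventually.of_forall fun s => (e _ _).symm)

section error

variable {lam R τ : ℝ}

lemma norm_interp_potFlow_le (hK : 0 < K) (hτ : 0 ≤ τ) {a : Wiener m} (ha : ‖a‖ ≤ 2 * R) :
    ‖interp hK (potFlow lam (τ / 2) a)‖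
      ≤ Real.exp (τ / 2 * (|lam| * (2 * R) ^ 2)) * ‖a‖ := by
  have := norm_potFlow_le (lam := lam) (t := τ / 2) ha
  rw [abs_of_nonneg (by positivity)] at this
  exact (norm_interp_le hK _).trans this

lemma norm_potFlow_half_le (hτ : 0 ≤ τ) (hτ1 : τ ≤ 1) {a : Wiener m} (ha : ‖a‖ ≤ 2 * R) :
    ‖potFlow lam (τ / 2) a‖ ≤ Real.exp (|lam| * (2 * R) ^ 2) * (2 * R) := by
  have := norm_potFlow_le (lam := lam) (t := τ / 2) ha
  rw [abs_of_nonneg (by positivity)] at this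
  have hL : 0 ≤ |lam| * (2 * R) ^ 2 := by positivity
  refine this.trans (mul_le_mul (Real.exp_le_exp.2 ?_) ha (norm_nonneg _) (Real.exp_pos _).le)
  nlinarith

/-- The numerical solution stays bounded on a short time interval. -/
lemma norm_iterate_discreteStrang_le (hK : 0 < K) (hτ : 0 ≤ τ) {T : ℝ} (hR : 0 ≤ R)
    (hT : T * (|lam| * (2 * R) ^ 2) ≤ 1 / 2) {a : Wiener 0} (ha : ‖a‖ ≤ R) (n : ℕ)
    (hn : n * τ ≤ T) : ‖(discreteStrang lam τ hK)^[n] a‖ ≤ 2 * R := by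
  set L := |lam| * (2 * R) ^ 2 with hL
  have hL0 : 0 ≤ L := by positivity
  have hexp : ∀ {r : ℝ}, r ≤ 1 / 2 → R * Real.exp r ≤ 2 * R := fun {r} hr => by
    have h1 : Real.exp r ≤ 2 := by
      have h2 : Real.exp r ≤ Real.exp (1 / 2) := Real.exp_le_exp.2 hr
      have h3 : Real.exp (1 / 2) ^ 2 = Real.exp 1 := by rw [← Real.exp_nat_mul]; norm_num
      nlinarith [Real.exp_one_lt_d9, Real.exp_pos (1 / 2)]
    nlinarith
  have key : ∀ n : ℕ, n * τ ≤ T →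
      ‖(discreteStrang lam τ hK)^[n] a‖ ≤ R * Real.exp (n * τ * L) := by
    intro n
    induction n with
    | zero => intro _; simpa using ha
    | succ n ih =>
      intro hn
      push_cast at hn
      have hn' : n * τ ≤ T := by linarith
      have hb : ((n : ℝ) + 1) * τ * L ≤ 1 / 2 :=
        (mul_le_mul_of_nonneg_right hn hL0).trans hT
      have hτL : 0 ≤ τ * L := by positivity
      rw [Function.iterate_succ_apply', discreteStrang]
      set b := (discreteStrang lam τ hK)^[n] a with hbdef
      have h1 := ih hn'
      have h2 := norm_interp_potFlow_le (lam := lam) hK hτ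
        (h1.trans (hexp (by nlinarith : n * τ * L ≤ 1 / 2)))
      have h3 : ‖interp hK (potFlow lam (τ / 2) b)‖ ≤ R * Real.exp (n * τ * L + τ / 2 * L) := by
        rw [Real.exp_add]
        refine (h2.trans (mul_le_mul_of_nonneg_left h1 (Real.exp_pos _).le)).trans (le_of_eq ?_)
        ring
      rw [← norm_evo schrFreq τ] at h3
      have h4 := norm_interp_potFlow_le (lam := lam) hK hτ
        (h3.trans (hexp (by nlinarith : n * τ * L + τ / 2 * L ≤ 1 / 2)))
      refine (h4.trans (mul_le_mul_of_nonneg_left h3 (Real.exp_pos _).le)).trans (le_of_eq ?_)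
      rw [mul_left_comm, ← Real.exp_add]
      congr 2
      push_cast
      ring
  refine (key n hn).trans (hexp ?_)
  exact (mul_le_mul_of_nonneg_right hn hL0).trans hT

/-- The discrete scheme is stable. -/
lemma norm_discreteStrang_sub_le (hK : 0 < K) (hτ : 0 ≤ τ) (hτ1 : τ ≤ 1) {ρ M : ℝ}
    (hρ : ρ = Real.exp (|lam| * (2 * R) ^ 2) * (2 * R))
    (hM : M = |lam| * ρ ^ 2 * (1 + Real.exp (2 * (|lam| * ρ ^ 2)))) {a b : Wiener 0}
    (ha : ‖a‖ ≤ 2 * R) (hb : ‖b‖ ≤ 2 * R) :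
    ‖discreteStrang lam τ hK a - discreteStrang lam τ hK b‖ ≤ Real.exp (τ * M) * ‖a - b‖ := by
  have hR : 0 ≤ 2 * R := (norm_nonneg _).trans ha
  have h2R : 2 * R ≤ ρ := by
    rw [hρ]
    exact le_mul_of_one_le_left hR (Real.one_le_exp (by positivity))
  have hPa := norm_potFlow_half_le (lam := lam) hτ hτ1 ha
  have hPb := norm_potFlow_half_le (lam := lam) hτ hτ1 hb
  rw [← hρ] at hPa hPb
  have s1 := norm_potFlow_sub_le (lam := lam) (t := τ / 2) (ρ := ρ) (by linarith) (by linarith)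
    (ha.trans h2R) (hb.trans h2R)
  have s2 := norm_potFlow_sub_le (lam := lam) (t := τ / 2) (ρ := ρ) (by linarith) (by linarith)
    (a := evo schrFreq τ le_rfl (interp hK (potFlow lam (τ / 2) a)))
    (b := evo schrFreq τ le_rfl (interp hK (potFlow lam (τ / 2) b)))
    (by rw [norm_evo]; exact (norm_interp_le hK _).trans hPa)
    (by rw [norm_evo]; exact (norm_interp_le hK _).trans hPb)
  rw [← hM] at s1 s2
  rw [← map_sub, norm_evo, ← map_sub] at s2
  rw [discreteStrang, discreteStrang, ← map_sub]
  refine (norm_interp_le hK _).trans (s2.trans ((mul_le_mul_of_nonneg_left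
    ((norm_interp_le hK _).trans s1) (Real.exp_pos _).le).trans (le_of_eq ?_)))
  rw [← mul_assoc, ← Real.exp_add]
  congr 2
  ring

/-- One discrete step, starting from the interpolant of a regular function, is close to one
semi-discrete step. -/
lemma norm_discreteStrang_interp_sub_le (hK : 0 < K) (hτ : 0 ≤ τ) (hτ1 : τ ≤ 1) {ρ M : ℝ}
    (hρ : ρ = Real.exp (|lam| * (2 * R) ^ 2) * (2 * R))
    (hM : M = |lam| * ρ ^ 2 * (1 + Real.exp (2 * (|lam| * ρ ^ 2)))) {q : ℕ} (hm : q + 8 ≤ m)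
    {a : Wiener m} (ha : ‖a‖ ≤ 2 * R) :
    ‖discreteStrang lam τ hK (interp hK (incl (Nat.zero_le m) a))
        - interp hK (strang lam τ (incl (by omega) a))‖
      ≤ Real.exp M * (2 * 2 ^ (q + 1) * ρ) * (τ * (1 / (K : ℝ)) ^ q) := by
  have h8 : 8 ≤ m := by omega
  have hR : 0 ≤ 2 * R := (norm_nonneg _).trans ha
  have hρ0 : 0 ≤ ρ := by rw [hρ]; positivity
  have hM0 : 0 ≤ M := by rw [hM]; positivity
  set p := potFlow lam (τ / 2) a with hp
  have hpρ : ‖p‖ ≤ ρ := by rw [hρ]; exact norm_potFlow_half_le hτ hτ1 ha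
  have e1 : discreteStrang lam τ hK (interp hK (incl (Nat.zero_le m) a))
      = interp hK (potFlow lam (τ / 2)
        (evo schrFreq τ le_rfl (interp hK (incl (Nat.zero_le m) p)))) := by
    rw [discreteStrang, interp_potFlow_interp, ← incl_potFlow]
  have e2 : interp hK (strang lam τ (incl h8 a)) = interp hK (potFlow lam (τ / 2)
      (interp hK (evo schrFreq τ (Nat.zero_le m) p))) := by
    have e3 : evo schrFreq τ (Nat.zero_le 8) (incl h8 p) = evo schrFreq τ (Nat.zero_le m) p := by
      ext1 k; simp
    rw [interp_potFlow_interp, strang, ← incl_potFlow, ← hp, e3]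
  rw [e1, e2, ← map_sub]
  have s := norm_potFlow_sub_le (lam := lam) (t := τ / 2) (ρ := ρ) (by linarith) (by linarith)
    (a := evo schrFreq τ le_rfl (interp hK (incl (Nat.zero_le m) p)))
    (b := interp hK (evo schrFreq τ (Nat.zero_le m) p))
    (by rw [norm_evo]; exact (norm_interp_le hK _).trans ((norm_incl_le _ _).trans hpρ))
    ((norm_interp_le hK _).trans ((norm_evo_le _ _ _ _).trans hpρ))
  rw [← hM] at s
  have h1 : Real.exp (τ / 2 * M) ≤ Real.exp M := Real.exp_le_exp.2 (by nlinarith)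
  have h2 := norm_commutator_le τ hK (by omega : q + 2 ≤ m) p
  rw [abs_of_nonneg hτ] at h2
  refine (norm_interp_le hK _).trans (s.trans ((mul_le_mul h1 (h2.trans
    (mul_le_mul_of_nonneg_left hpρ (by positivity))) (norm_nonneg _)
    (Real.exp_pos _).le).trans (le_of_eq ?_)))
  ring

end error

/-- The global error of the fully discrete Strang splitting for the limit system. -/
theorem exists_strang_error {q : ℕ} (hm : q + 8 ≤ m) {lam R T T' : ℝ} (hT0 : 0 < T) (hTT' : T < T')
    (hR : 0 ≤ R) (hT : T * (|lam| * (2 * R) ^ 2) ≤ 1 / 2) {w : ℝ → Wiener m}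
    (hw : IsMildSol schrFreq (nls lam) T' (2 * R) w) (hw0 : ‖w 0‖ ≤ R) :
    ∃ C, 0 ≤ C ∧ ∀ {K : ℕ} (hK : 0 < K) {τ : ℝ}, 0 < τ → τ ≤ 1 → ∀ n : ℕ, n * τ ≤ T →
      ‖(discreteStrang lam τ hK)^[n] (interp hK (incl (Nat.zero_le m) (w 0)))
        - incl (Nat.zero_le m) (w (n * τ))‖ ≤ C * (τ ^ 2 + (1 / (K : ℝ)) ^ q) := by
  have h8 : 8 ≤ m := by omega
  obtain ⟨C₁, hC₁⟩ := Asymptotics.isBigO_principal.1 (isBigO_strang_sub (hw.incl_nls h8))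
  set ρ := Real.exp (|lam| * (2 * R) ^ 2) * (2 * R) with hρ
  set M := |lam| * ρ ^ 2 * (1 + Real.exp (2 * (|lam| * ρ ^ 2))) with hM
  have hρ0 : 0 ≤ ρ := by positivity
  have hM0 : 0 ≤ M := by positivity
  set C₂ := |C₁| + Real.exp M * (2 * 2 ^ (q + 1) * ρ) with hC₂
  have hC₂0 : 0 ≤ C₂ := by positivity
  refine ⟨T * C₂ * Real.exp (T * M) + 2 ^ (q + 1) * (2 * R), by positivity, ?_⟩
  intro K hK τ hτ hτ1 n hn
  have hη : 0 ≤ (1 / (K : ℝ)) ^ q := by positivity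
  have hwn : ∀ n : ℕ, n * τ ≤ T → ‖w (n * τ)‖ ≤ 2 * R := fun n hn =>
    hw.norm_le _ ⟨by have : 0 ≤ n * τ := by positivity
                     linarith, by linarith⟩
  set a := interp hK (incl (Nat.zero_le m) (w 0)) with ha
  have haR : ‖a‖ ≤ R := (norm_interp_le hK _).trans ((norm_incl_le _ _).trans hw0)
  set η := τ ^ 2 + (1 / (K : ℝ)) ^ q with hηdef
  have hη0 : 0 ≤ η := by positivity
  have key : ∀ n : ℕ, n * τ ≤ T → ‖(discreteStrang lam τ hK)^[n] a
      - interp hK (incl (Nat.zero_le m) (w (n * τ)))‖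
        ≤ n * τ * C₂ * η * Real.exp (n * τ * M) := by
    intro n
    induction n with
    | zero => intro _; simp [ha]
    | succ n ih =>
      intro hn
      push_cast at hn ⊢
      have hn' : n * τ ≤ T := by linarith
      rw [Function.iterate_succ_apply']
      set b := (discreteStrang lam τ hK)^[n] a with hb
      have hbR : ‖b‖ ≤ 2 * R := norm_iterate_discreteStrang_le hK hτ.le hR hT haR n hn'
      set y := interp hK (incl (Nat.zero_le m) (w (n * τ))) with hy
      have hyR : ‖y‖ ≤ 2 * R :=
        (norm_interp_le hK _).trans ((norm_incl_le _ _).trans (hwn n hn'))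
      have s1 := norm_discreteStrang_sub_le (lam := lam) hK hτ.le hτ1 hρ hM hbR hyR
      have s2 := norm_discreteStrang_interp_sub_le hK hτ.le hτ1 hρ hM hm (hwn n hn')
      have s3 : ‖interp hK (strang lam τ (incl h8 (w (n * τ))))
          - interp hK (incl (Nat.zero_le m) (w ((n + 1) * τ)))‖ ≤ |C₁| * τ ^ 3 := by
        have := hC₁ (n * τ, τ) ⟨by positivity, hτ.le, hτ1, by simp only; linarith⟩
        simp only [incl_incl, norm_pow, Real.norm_eq_abs, abs_of_pos hτ] at this
        rw [show (n : ℝ) * τ + τ = (n + 1) * τ by ring] at this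
        rw [← map_sub]
        exact (norm_interp_le hK _).trans (this.trans
          (mul_le_mul_of_nonneg_right (le_abs_self _) (by positivity)))
      have e : discreteStrang lam τ hK b - interp hK (incl (Nat.zero_le m) (w ((n + 1) * τ)))
          = (discreteStrang lam τ hK b - discreteStrang lam τ hK y)
            + (discreteStrang lam τ hK y - interp hK (strang lam τ (incl h8 (w (n * τ)))))
            + (interp hK (strang lam τ (incl h8 (w (n * τ))))
              - interp hK (incl (Nat.zero_le m) (w ((n + 1) * τ)))) := by abel
      rw [e]
      have h1 := s1.trans (mul_le_mul_of_nonneg_left (ih hn') (Real.exp_pos _).le)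
      refine (norm_add₃_le).trans ((add_le_add (add_le_add h1 s2) s3).trans ?_)
      have h2 : Real.exp M * (2 * 2 ^ (q + 1) * ρ) * (τ * (1 / (K : ℝ)) ^ q) + |C₁| * τ ^ 3
          ≤ τ * C₂ * η := by
        rw [hC₂, hηdef]
        have i1 : 0 ≤ |C₁| * τ * (1 / (K : ℝ)) ^ q := by positivity
        have i2 : 0 ≤ Real.exp M * (2 * 2 ^ (q + 1) * ρ) * τ * τ ^ 2 := by positivity
        linarith
      have h3 : 1 ≤ Real.exp ((n + 1) * τ * M) := Real.one_le_exp (by positivity)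
      have h4 : Real.exp (τ * M) * (n * τ * C₂ * η * Real.exp (n * τ * M))
          = n * τ * C₂ * η * Real.exp ((n + 1) * τ * M) := by
        rw [show ((n : ℝ) + 1) * τ * M = τ * M + n * τ * M by ring, Real.exp_add]; ring
      have h5 : τ * C₂ * η ≤ τ * C₂ * η * Real.exp ((n + 1) * τ * M) :=
        le_mul_of_one_le_right (by positivity) h3
      rw [h4]
      linarith
  have h1 : ‖interp hK (incl (Nat.zero_le m) (w (n * τ))) - incl (Nat.zero_le m) (w (n * τ))‖
      ≤ 2 ^ (q + 1) * (2 * R) * η := by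
    have h := norm_incl_sub_interp_le hK (n := 0) (q := q) (by omega : 0 + q ≤ m) (w (n * τ))
    rw [map_sub, incl_interp, norm_sub_rev] at h
    refine h.trans ((mul_le_mul_of_nonneg_left (hwn n hn) (by positivity)).trans ?_)
    have i1 : 0 ≤ 2 ^ (q + 1) * (2 * R) * τ ^ 2 := by positivity
    rw [hηdef]
    linarith
  have h2 : n * τ * C₂ * η * Real.exp (n * τ * M) ≤ T * C₂ * η * Real.exp (T * M) := by
    have : Real.exp (n * τ * M) ≤ Real.exp (T * M) :=
      Real.exp_le_exp.2 (mul_le_mul_of_nonneg_right hn hM0)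
    gcongr
  rw [← sub_add_sub_cancel _ (interp hK (incl (Nat.zero_le m) (w (n * τ))))]
  refine (norm_add_le _ _).trans ((add_le_add ((key n hn).trans h2) h1).trans (le_of_eq ?_))
  ring

/-! ### The error in the original variables -/

lemma l2Norm_le {f : ℝ → ℂ} {M : ℝ} (hM : 0 ≤ M) (hf : ∀ x, ‖f x‖ ≤ M) : l2Norm f ≤ M := by
  have hpi := Real.pi_pos
  have h := intervalIntegral.norm_integral_le_of_norm_le_const (a := 0) (b := 2 * Real.pi)
    (f := fun x => ‖f x‖ ^ 2) (C := M ^ 2) fun x _ => by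
      rw [norm_pow, norm_norm]; exact pow_le_pow_left₀ (norm_nonneg _) (hf x) 2
  rw [sub_zero, abs_of_pos (by positivity)] at h
  refine Real.sqrt_le_iff.2 ⟨hM, ?_⟩
  calc _ ≤ 1 / (2 * Real.pi) * (M ^ 2 * (2 * Real.pi)) :=
        mul_le_mul_of_nonneg_left ((le_abs_self _).trans h) (by positivity)
    _ = M ^ 2 := by field_simp

lemma ev_field_fst (x : ℝ) (a : Wiener m) :
    (ev x (field a)).1 = 1 / 2 * ((ev x a).1 + (starRingEnd ℂ) (ev x a).2) := by
  rw [field, map_smul, map_add, ev_swap, ev_conj]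
  rfl

lemma zNum_eq {lam c τ : ℝ} {K : ℕ} {φ γ : ℝ → ℂ} {n : ℕ} {a : Wiener m}
    (h : strangSolution lam K τ φ γ n = funPair a) (x : ℝ) :
    zNum lam c K τ φ γ n x = (ev x (field (osc (c ^ 2) (n * τ) • a))).1 := by
  rw [zNum, h, ev_field_fst, map_smul, osc, funPair]
  have e : (starRingEnd ℂ) (Complex.exp (Complex.I * (c : ℂ) ^ 2 * (n * τ : ℂ)))
      = Complex.exp (-Complex.I * (c : ℂ) ^ 2 * (n * τ : ℂ)) := by
    rw [← Complex.exp_conj]; simp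
  have e' : Complex.exp (Complex.I * ((c ^ 2 : ℝ) : ℂ) * ((n * τ : ℝ) : ℂ))
      = Complex.exp (Complex.I * (c : ℂ) ^ 2 * (n * τ : ℂ)) := by push_cast; rfl
  rw [e', Prod.smul_fst, Prod.smul_snd, smul_eq_mul, smul_eq_mul, map_mul, e]
  ring

lemma norm_z_sub_zNum_le {lam c τ : ℝ} {K : ℕ} {φ γ : ℝ → ℂ} {n : ℕ} {a : Wiener 0} {y : Wiener m}
    (h : strangSolution lam K τ φ γ n = funPair a) (x : ℝ) :
    ‖(ev x (field y)).1 - zNum lam c K τ φ γ n x‖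
      ≤ ‖incl (Nat.zero_le m) y - osc (c ^ 2) (n * τ) • a‖ := by
  rw [zNum_eq h, ← ev_incl (Nat.zero_le m), incl_field, ← Prod.fst_sub, ← map_sub, field_sub]
  exact (norm_fst_le _).trans ((norm_ev_le _ _).trans (norm_field_le _))

end Wiener
end KGStrang

end

open KGStrang KGStrang.Wiener in
theorem theorem6p1 (lam s : ℝ) (hs : 1 / 2 < s) (φ γ : ℝ → ℂ)
    (hφ : ContDiff ℝ ∞ φ) (hφper : Function.Periodic φ (2 * Real.pi))
    (hγ : ContDiff ℝ ∞ γ) (hγper : Function.Periodic γ (2 * Real.pi)) :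
    ∃ T c₀ C h₀ τ₀ : ℝ, 0 < T ∧ 0 < c₀ ∧ 0 < C ∧ 0 < h₀ ∧ 0 < τ₀ ∧
      ∀ c : ℝ, c₀ < c →
        ∃ z : ℝ → ℝ → ℂ,
          KGStrang.IsKleinGordonSolution lam c T φ γ z ∧
          (∀ z' : ℝ → ℝ → ℂ, KGStrang.IsKleinGordonSolution lam c T φ γ z' →
            ∀ t ∈ Set.Icc (0 : ℝ) T, ∀ x, z' t x = z t x) ∧
          ∀ (K : ℕ) (h τ : ℝ) (n : ℕ), 0 < K → h = 1 / (K : ℝ) → h < h₀ →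
            0 < τ → τ < τ₀ → (n : ℝ) * τ ≤ T →
            KGStrang.l2Norm (fun x => z (n * τ) x - KGStrang.zNum lam c K τ φ γ n x)
              ≤ C * (τ ^ 2 + h ^ s + (c ^ 2)⁻¹) := by
  obtain ⟨q, hq⟩ := exists_nat_ge s
  obtain ⟨Φ, hΦ, hφΦ⟩ := exists_lift (q + 8) hφ hφper
  obtain ⟨Γ, hΓ, hγΓ⟩ := exists_lift (q + 8) hγ hγper
  set R := ‖Φ‖ + ‖Γ‖ + 1 with hR
  have hR0 : 0 < R := by positivity
  set L := 24 * |lam| * R ^ 2 with hL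
  have hL0 : 0 ≤ L := by positivity
  -- a lifespan on which Picard iteration converges and the numerical solution stays bounded
  set T' := 1 / (L + 1) with hT'
  have hT'0 : 0 < T' := by positivity
  have hLT : L * T' ≤ 1 := by
    rw [hT', mul_one_div, div_le_one (by positivity)]; linarith
  have hB : 3 * |lam| * (2 * R) ^ 3 * T' ≤ R := by
    have := mul_le_mul_of_nonneg_left hLT hR0.le
    rw [hL] at this
    linarith
  have hB0 : 0 ≤ 3 * |lam| * (2 * R) ^ 3 := by positivity
  have hLip : 0 ≤ 3 * |lam| * (2 * R) ^ 2 := by positivity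
  obtain ⟨w, hw0, hw⟩ := exists_isMildSol schrFreq (nls lam) (Φ - Complex.I • Γ) hR0.le hLip hT'0.le
    (by refine (norm_sub_le _ _).trans ?_
        rw [norm_I_smul, hR]; linarith)
    (fun a b ha hb => norm_nls_sub_le ha hb) hB0 (fun a ha => norm_nls_le ha) hB
  obtain ⟨C₁, hC₁0, hC₁⟩ := exists_modulation_error lam (2 * R) T' ‖Γ‖
  have hTT' : T' / 2 < T' := by linarith
  obtain ⟨C₂, hC₂0, hC₂⟩ := exists_strang_error (q := q) le_rfl (T := T' / 2) (by positivity) hTT'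
    hR0.le (by rw [hL] at hLT; linarith) hw
    (by rw [hw0]; refine (norm_sub_le _ _).trans ?_
        rw [norm_I_smul, hR]; linarith)
  refine ⟨T' / 2, 1, C₁ + C₂ + 1, 2, 1, by positivity, one_pos, by positivity, two_pos, one_pos, ?_⟩
  intro c hc
  have hc0 : 0 < c := one_pos.trans hc
  obtain ⟨y, hy0, hy⟩ := exists_isMildSol (kgFreq c) (kgNonlin (q + 8) lam hc0)
    (Φ - Complex.I • damp (q + 8) hc0 Γ) hR0.le hLip hT'0.le
    (by refine (norm_sub_le _ _).trans ?_
        rw [norm_I_smul, hR]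
        linarith [norm_damp_le hc0 Γ])
    (fun a b ha hb => norm_kgNonlin_sub_le hc0 ha hb) hB0
    (fun a ha => (norm_damp_le hc0 _).trans (norm_kgs_le ha)) hB
  have hz := isKleinGordonSolution_of_isMildSol hc0 (by positivity) hTT' (by omega) hΦ hΓ
    (fun x => by rw [hφΦ]) (fun x => by rw [hγΓ]) hy0 hy
  refine ⟨_, hz, fun z' hz' => hz.unique hz' hc0.ne' (by positivity), ?_⟩
  intro K h τ n hK hh _ hτ hτ1 hn
  have hKr : (1 : ℝ) ≤ K := by exact_mod_cast hK
  have hh0 : 0 < h := by rw [hh]; positivity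
  have hh1 : h ≤ 1 := by rw [hh, div_le_one (by linarith)]; exact hKr
  have hhq : (1 / (K : ℝ)) ^ q ≤ h ^ s := by
    rw [← hh, ← Real.rpow_natCast]
    exact Real.rpow_le_rpow_of_exponent_ge hh0 hh1 hq
  have hsol := strangSolution_eq_funPair lam τ hK hφΦ hγΓ n
  have ht0 : 0 ≤ n * τ := by positivity
  have e1 := hC₁ (by omega) hc.le hc0 le_rfl hw0 hy0 hw hy (n * τ) ht0 (by linarith)
  have e2 := hC₂ hK hτ hτ1.le n hn
  rw [hw0] at e2
  set a := (discreteStrang lam τ hK)^[n]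
    (interp hK (incl (Nat.zero_le (q + 8)) (Φ - Complex.I • Γ))) with ha
  have hs0 : 0 ≤ h ^ s := by positivity
  have hc2 : 0 ≤ (c ^ 2)⁻¹ := by positivity
  refine l2Norm_le (by positivity) fun x => (norm_z_sub_zNum_le hsol x).trans ?_
  rw [← sub_add_sub_cancel _ (osc (c ^ 2) (n * τ) • incl (Nat.zero_le (q + 8)) (w (n * τ))),
    ← smul_sub]
  refine (norm_add_le _ _).trans ?_
  rw [norm_smul, norm_osc, one_mul, norm_sub_rev _ a]
  refine (add_le_add e1 e2).trans ?_
  have e3 : C₂ * (τ ^ 2 + (1 / (K : ℝ)) ^ q) ≤ C₂ * (τ ^ 2 + h ^ s) := by gcongr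
  nlinarith [mul_nonneg hC₁0 (add_nonneg (sq_nonneg τ) hs0), mul_nonneg hC₂0 hc2, sq_nonneg τ]
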